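/- Let $h:\mathbb N\to[0,\infty)$ be a multiplicative function (so $h(1)=1$) and let $k\ge 0$ be a real number such that the following hypothesis holds, where $p$ denotes primes: (i) $\sum_p \frac{h(p)-k}{p}$ converges (summed over increasing $p$); (ii) there are $\eta>0$ and $C_0$ with $\Big|\sum_{p\le y}\frac{h(p)-k}{p^{1+it}}\Big|\le(\tfrac12-\eta)\log(|t|+2)+C_0$ for all $y$ and all real $t$; (iii) for every integer $n\ge1$ and every $\varepsilon>0$, $\sum_{p\le y}\frac{(h(p)-k)\log^n p}{p^{1+it}}\ll_{n,\varepsilon}(|t|+2)^{\varepsilon}$ for all $y$ and all real $t$; (iv) $h(p)<p$ for every prime $p$, and $h(d)\ll_\varepsilon d^{\varepsilon}$ for every $\varepsilon>0$. For a fixed integer $a\ne0$ define, for $q\ge1$, $$g_a(q)=\frac1{\phi(q/(q,a))}\sum_{d\mid q/(q,a)}\mu(d)\frac{h((q,a)d)}{(q,a)d},\qquad \gamma(q)=\prod_{p\mid q}\frac{1-1/p}{1-h(p)/p},\qquad f_a(q)=g_a(q)\,q\,\gamma(q).$$ For each prime $p$ let $f=f(p)\ge0$ be the exponent with $p^f\,\|\,a$,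 and call $p$ exceptional if $h(p^f)=h(p^{f+1})/p$ (an exceptional prime divides $a$). Let $\omega_h(a)$ be the number of exceptional primes and, for $M>1$, put $$\mu_k(a,M)=-\frac12\,\frac{(\log M)^{1-k-\omega_h(a)}}{\Gamma(2-k-\omega_h(a))}\prod_{p\text{ exceptional}}\frac{1+h(p)+\dots+h(p^f)}{(1-1/p)^{k-1}}\log p\ \prod_{p\text{ not exceptional}}\frac{h(p^f)-h(p^{f+1})/p}{(1-1/p)^k},$$ where $1/\Gamma$ is understood to be $0$ at the poles of $\Gamma$ and the last product is the limit of the partial products over $p\le N$ as $N\to\infty$. Then this limit exists and, for every fixed $\delta>0$, for all real $x,M,R$ with $M>1$ and $M^{1+\delta}\le R\le\sqrt x$, and for every $A>0$, $$\sum_{1\le r\le R}\frac{f_a(r)}{r\gamma(r)}\Big(1-\frac rR\Big)-\sum_{1\le r\le M}\frac{f_a(r)}{r\gamma(r)}\Big(1-\frac rM\Big)-\sum_{x/R<q\le x/M}\frac{f_a(q)}{q\gamma(q)} =\frac{\mu_k(a,M)}M\left(1+O\left(\frac{|\log\log M|}{\log M}\right)\right)+O_A\left(\frac1{M\log^A M}\right),$$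 where the implied constants depend only on $h,k,a,\delta$ (and, in the last term, also on $A$). -/

import Mathlib

namespace ArithSeq

noncomputable section

/-- The density `g_a(q)` of the progression `a mod q` predicted by the density function `h`. -/
def gDensity (h : ArithmeticFunction ℝ) (a : ℤ) (q : ℕ) : ℝ :=
  1 / (Nat.totient (q / Int.gcd q a) : ℝ) *
    ∑ d ∈ (q / Int.gcd q a).divisors,
      (ArithmeticFunction.moebius d : ℝ) * (h (Int.gcd q a * d) / ((Int.gcd q a : ℝ) * d))

/-- `γ(q) = ∏_{p ∣ q} (1 - 1/p) / (1 - h(p)/p)`. -/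
def gammaFactor (h : ArithmeticFunction ℝ) (q : ℕ) : ℝ :=
  ∏ p ∈ q.primeFactors, (1 - 1 / (p : ℝ)) / (1 - h p / p)

/-- `f_a(q) = g_a(q) q γ(q)`. -/
def fDensity (h : ArithmeticFunction ℝ) (a : ℤ) (q : ℕ) : ℝ :=
  gDensity h a q * q * gammaFactor h q

/-- The hypothesis, with an empty set of bad primes, that `h(p)` is `k` on average over the
primes. The inequality between a complex sum and a real bound is read in absolute value. -/
structure PrimeAverageHypothesis (h : ArithmeticFunction ℝ) (k : ℝ) : Prop where
  nonneg_k : 0 ≤ k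
  convergent : ∃ l : ℝ, Filter.Tendsto
    (fun N : ℕ => ∑ p ∈ Nat.primesLE N, (h p - k) / (p : ℝ)) Filter.atTop (nhds l)
  twisted : ∃ δ : ℝ, 0 < δ ∧ ∃ C : ℝ, ∀ (t : ℝ) (N : ℕ),
    ‖∑ p ∈ Nat.primesLE N, ((h p - k : ℝ) : ℂ) / (p : ℂ) ^ (1 + t * Complex.I)‖
      ≤ (1 / 2 - δ) * Real.log (|t| + 2) + C
  twisted_log : ∀ n : ℕ, 1 ≤ n → ∀ ε : ℝ, 0 < ε → ∃ C : ℝ, ∀ (t : ℝ) (N : ℕ),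
    ‖∑ p ∈ Nat.primesLE N,
        (((h p - k) * Real.log p ^ n : ℝ) : ℂ) / (p : ℂ) ^ (1 + t * Complex.I)‖
      ≤ C * (|t| + 2) ^ ε
  lt_self : ∀ p : ℕ, p.Prime → h p < p
  le_rpow : ∀ ε : ℝ, 0 < ε → ∃ C : ℝ, ∀ d : ℕ, 1 ≤ d → h d ≤ C * (d : ℝ) ^ ε

/-- With `p ^ f ∥ a` (where `f = 0` is allowed), the condition `h(p^f) = h(p^(f+1)) / p`. -/
def IsExceptional (h : ArithmeticFunction ℝ) (a : ℤ) (p : ℕ) : Prop :=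
  h (p ^ padicValInt p a) = h (p ^ (padicValInt p a + 1)) / p

open Classical in
/-- The exceptional primes dividing `a`. (A prime `p ∤ a` is never exceptional when `h 1 = 1`
and `h p < p`.) -/
def exceptionalPrimes (h : ArithmeticFunction ℝ) (a : ℤ) : Finset ℕ :=
  {p ∈ a.natAbs.primeFactors | IsExceptional h a p}

/-- `ω_h(a)`. -/
def omegaH (h : ArithmeticFunction ℝ) (a : ℤ) : ℕ :=
  (exceptionalPrimes h a).card

open Classical in
/-- Partial products, over primes `p ≤ N`, of the product over the non-exceptional primes. -/
def regularPartialProduct (h : ArithmeticFunction ℝ) (k : ℝ) (a : ℤ) (N : ℕ) : ℝ :=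
  ∏ p ∈ Nat.primesLE N with ¬ IsExceptional h a p,
    (h (p ^ padicValInt p a) - h (p ^ (padicValInt p a + 1)) / p) / (1 - 1 / (p : ℝ)) ^ k

/-- The (in general only conditionally convergent) product over the non-exceptional primes, taken
in increasing order. -/
def regularProduct (h : ArithmeticFunction ℝ) (k : ℝ) (a : ℤ) : ℝ :=
  Filter.limUnder Filter.atTop (regularPartialProduct h k a)

/-- The average `μ_k(a, M)`. Mathlib's `Real.Gamma` vanishes at the poles of the Gamma function and
division by zero gives zero, so that division by `Real.Gamma` is multiplication by the
entire function `1 / Γ`. -/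
def muAverage (h : ArithmeticFunction ℝ) (k : ℝ) (a : ℤ) (M : ℝ) : ℝ :=
  -(1 / 2) * (Real.log M ^ (1 - k - omegaH h a) / Real.Gamma (2 - k - omegaH h a)) *
    (∏ p ∈ exceptionalPrimes h a,
      (∑ j ∈ Finset.range (padicValInt p a + 1), h (p ^ j)) / (1 - 1 / (p : ℝ)) ^ (k - 1)
        * Real.log p) *
    regularProduct h k a

/-- The combination of sums that is evaluated. -/
def arithmeticSum (h : ArithmeticFunction ℝ) (a : ℤ) (x M R : ℝ) : ℝ :=
  ∑ r ∈ Finset.Icc 1 ⌊R⌋₊, fDensity h a r / (r * gammaFactor h r) * (1 - r / R)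
    - ∑ r ∈ Finset.Icc 1 ⌊M⌋₊, fDensity h a r / (r * gammaFactor h r) * (1 - r / M)
    - ∑ q ∈ Finset.Ioc ⌊x / R⌋₊ ⌊x / M⌋₊, fDensity h a q / (q * gammaFactor h q)

end

end ArithSeq

/-! The factor `gammaFactor` cancels, so all three sums run over `g r = gDensity h a r`. The
function r g(r) is multiplicative; write it as ∑_{d ∣ r} b(d) with b = `coeff h a`. Exchanging sums
turns ∑_{r ≤ M} g(r)(1 - r/M) into a linear function of log M plus W(log M)/M, where W = `oscSum b`
sums b(d) against the kernel `kern` at log(M/d), and ∑_{q ≤ Q} g(q) into the same kind of linear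
function of log Q plus a small error. In the combination the linear parts cancel exactly. As x/R ≥ R
≥ M^(1+δ), every other error is O(M^(-1-δ/2)) and -W(log M)/M remains
(`SumBound.exists_combination_le`).

The kernel tends to 1/2, so the bilateral Laplace transform of W is D(s) K(s)/s with K =
`kernFactor`, K(0) = 1/2, and D the Dirichlet series of b. The Euler product of D contributes
s^(k-1), because h(p) is k on average, and one further zero at s = 0 for each exceptional prime.
Hence the transform is s^α V(s) with α = k + ω - 2, where V has a nonzero limit V₀ at 0
(`exists_tempered_factor`). Formal inversion gives W(v) ~ V₀ v^(-α-1)/Γ(-α), which is the stated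
main term with sign reversed. If α is a natural number then 1/Γ(-α) = 0 and W decays faster than any
power of v.

Nothing is known to the left of Re s = 0, so contours cannot be shifted. What is known is that V and
all its derivatives grow at most polynomially in the strip 0 < Re s < 1/4 (`Tempered`). The
inversion integral is taken on Re s = 1/v and made convergent by a Gaussian mollifier of scale l =
v^(-A). Integrating by parts n times trades s^α for s^(α-n) and produces the ratio Γ(n-α)/Γ(-α);
after that V may be replaced by V₀ and Hankel's formula applies (`hankelInt_asymptotic`,
`hankelInt_natCast_decay`). Mollification itself is harmless since W is Lipschitz with a constant
polynomial in v (`SumBound.norm_hankelInt_sub_le`).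

Temperedness of V needs two inputs. For powers of ζ(1+s) it is the classical bound for 1/ζ near the
line Re = 1 from the 3-4-1 inequality (`polyBound_inv_xiFun`). For exp(-∑ (h(p)-k)/p^(1+s)) it is
Abel's inequality, which carries the hypotheses on the sums with p^(1+it) into the strip. -/

open Filter Topology Set MeasureTheory

/-! ### Functions of polynomial growth, with all derivatives, on the strip 0 < Re s < 1/4. -/

namespace ArithSeq

/-- The vertical strip `0 < Re s < 1/4`. -/
def strip : Set ℂ := {s | 0 < s.re ∧ s.re < 1 / 4}

lemma isOpen_strip : IsOpen strip :=
  (isOpen_lt continuous_const Complex.continuous_re).inter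
    (isOpen_lt Complex.continuous_re continuous_const)

/-- `f` grows at most like `|Im s| ^ (c + ε)` on the strip. -/
def PolyBound (c : ℝ) (f : ℂ → ℂ) : Prop :=
  ∀ ε : ℝ, 0 < ε → ∃ C : ℝ, 0 ≤ C ∧ ∀ s ∈ strip, ‖f s‖ ≤ C * (|s.im| + 2) ^ (c + ε)

/-- `f` is holomorphic on the strip and its derivatives up to order `n` grow at most like
`|Im s| ^ (c + ε)`. -/
def TemperedUpTo : ℕ → ℝ → (ℂ → ℂ) → Prop
  | 0, c, f => DifferentiableOn ℂ f strip ∧ PolyBound c f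
  | n + 1, c, f => (DifferentiableOn ℂ f strip ∧ PolyBound c f) ∧ TemperedUpTo n c (deriv f)

/-- `f` is holomorphic on the strip and all its derivatives grow at most like
`|Im s| ^ (c + ε)`. -/
def Tempered (c : ℝ) (f : ℂ → ℂ) : Prop := ∀ n, TemperedUpTo n c f

lemma one_le_abs_add_two (t : ℝ) : 1 ≤ |t| + 2 := by linarith [abs_nonneg t]

lemma PolyBound.congr {c : ℝ} {f g : ℂ → ℂ} (hf : PolyBound c f) (h : EqOn f g strip) :
    PolyBound c g := by
  intro ε hε
  obtain ⟨C, hC, H⟩ := hf ε hε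
  exact ⟨C, hC, fun s hs => by rw [← h hs]; exact H s hs⟩

lemma PolyBound.mono {c d : ℝ} {f : ℂ → ℂ} (hf : PolyBound c f) (h : c ≤ d) :
    PolyBound d f := by
  intro ε hε
  obtain ⟨C, hC, H⟩ := hf ε hε
  refine ⟨C, hC, fun s hs => (H s hs).trans ?_⟩
  gcongr
  exact one_le_abs_add_two _

lemma PolyBound.add {c : ℝ} {f g : ℂ → ℂ} (hf : PolyBound c f) (hg : PolyBound c g) :
    PolyBound c (fun s => f s + g s) := by
  intro ε hε
  obtain ⟨C, hC, H⟩ := hf ε hε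
  obtain ⟨C', hC', H'⟩ := hg ε hε
  refine ⟨C + C', by positivity, fun s hs => (norm_add_le _ _).trans ?_⟩
  rw [add_mul]
  exact add_le_add (H s hs) (H' s hs)

lemma PolyBound.mul {c d : ℝ} {f g : ℂ → ℂ} (hf : PolyBound c f) (hg : PolyBound d g) :
    PolyBound (c + d) (fun s => f s * g s) := by
  intro ε hε
  obtain ⟨C, hC, H⟩ := hf (ε / 2) (by positivity)
  obtain ⟨C', hC', H'⟩ := hg (ε / 2) (by positivity)
  refine ⟨C * C', by positivity, fun s hs => ?_⟩
  rw [norm_mul]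
  have h0 : 0 < |s.im| + 2 := by positivity
  calc ‖f s‖ * ‖g s‖ ≤ (C * (|s.im| + 2) ^ (c + ε / 2)) * (C' * (|s.im| + 2) ^ (d + ε / 2)) :=
        mul_le_mul (H s hs) (H' s hs) (norm_nonneg _) (by positivity)
    _ = C * C' * ((|s.im| + 2) ^ (c + ε / 2) * (|s.im| + 2) ^ (d + ε / 2)) := by ring
    _ = _ := by rw [← Real.rpow_add h0]; congr 2; ring

lemma polyBound_of_bounded {f : ℂ → ℂ} {C : ℝ} (h : ∀ s ∈ strip, ‖f s‖ ≤ C) :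
    PolyBound 0 f := by
  intro ε hε
  refine ⟨|C|, abs_nonneg _, fun s hs => (h s hs).trans ((le_abs_self C).trans ?_)⟩
  exact le_mul_of_one_le_right (abs_nonneg _)
    (Real.one_le_rpow (one_le_abs_add_two _) (by linarith))

lemma TemperedUpTo.of_succ {n : ℕ} : ∀ {c : ℝ} {f : ℂ → ℂ}, TemperedUpTo (n + 1) c f →
    TemperedUpTo n c f := by
  induction n with
  | zero => intro c f h; exact h.1
  | succ n ih => intro c f h; exact ⟨h.1, ih h.2⟩

lemma deriv_eqOn_strip {f g : ℂ → ℂ} (h : EqOn f g strip) : EqOn (deriv f) (deriv g) strip := by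
  intro s hs
  exact Filter.EventuallyEq.deriv_eq
    (Filter.eventuallyEq_of_mem (isOpen_strip.mem_nhds hs) h)

lemma TemperedUpTo.congr {n : ℕ} : ∀ {c : ℝ} {f g : ℂ → ℂ}, TemperedUpTo n c f →
    EqOn f g strip → TemperedUpTo n c g := by
  induction n with
  | zero => intro c f g hf h; exact ⟨hf.1.congr h.symm, hf.2.congr h⟩
  | succ n ih =>
    intro c f g hf h
    exact ⟨⟨hf.1.1.congr h.symm, hf.1.2.congr h⟩, ih hf.2 (deriv_eqOn_strip h)⟩

lemma TemperedUpTo.mono {n : ℕ} : ∀ {c d : ℝ} {f : ℂ → ℂ}, TemperedUpTo n c f → c ≤ d →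
    TemperedUpTo n d f := by
  induction n with
  | zero => intro c d f hf h; exact ⟨hf.1, hf.2.mono h⟩
  | succ n ih => intro c d f hf h; exact ⟨⟨hf.1.1, hf.1.2.mono h⟩, ih hf.2 h⟩

lemma differentiableAt_of_strip {f : ℂ → ℂ} (hf : DifferentiableOn ℂ f strip) {s : ℂ}
    (hs : s ∈ strip) : DifferentiableAt ℂ f s :=
  hf.differentiableAt (isOpen_strip.mem_nhds hs)

lemma TemperedUpTo.add {n : ℕ} : ∀ {c : ℝ} {f g : ℂ → ℂ}, TemperedUpTo n c f →
    TemperedUpTo n c g → TemperedUpTo n c (fun s => f s + g s) := by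
  induction n with
  | zero => intro c f g hf hg; exact ⟨hf.1.add hg.1, hf.2.add hg.2⟩
  | succ n ih =>
    intro c f g hf hg
    refine ⟨⟨hf.1.1.add hg.1.1, hf.1.2.add hg.1.2⟩, (ih hf.2 hg.2).congr ?_⟩
    intro s hs
    exact (deriv_fun_add (differentiableAt_of_strip hf.1.1 hs)
      (differentiableAt_of_strip hg.1.1 hs)).symm

lemma TemperedUpTo.mul {n : ℕ} : ∀ {c d : ℝ} {f g : ℂ → ℂ}, TemperedUpTo n c f →
    TemperedUpTo n d g → TemperedUpTo n (c + d) (fun s => f s * g s) := by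
  induction n with
  | zero => intro c d f g hf hg; exact ⟨hf.1.mul hg.1, hf.2.mul hg.2⟩
  | succ n ih =>
    intro c d f g hf hg
    refine ⟨⟨hf.1.1.mul hg.1.1, hf.1.2.mul hg.1.2⟩,
      ((ih hf.2 hg.of_succ).add (ih hf.of_succ hg.2)).congr ?_⟩
    intro s hs
    exact (deriv_fun_mul (differentiableAt_of_strip hf.1.1 hs)
      (differentiableAt_of_strip hg.1.1 hs)).symm

lemma temperedUpTo_zero_fun (n : ℕ) (c : ℝ) : TemperedUpTo n c (fun _ => 0) := by
  have h0 : PolyBound c (fun _ : ℂ => (0 : ℂ)) := fun ε _ => ⟨0, le_rfl, fun s _ => by simp⟩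
  induction n with
  | zero => exact ⟨differentiableOn_const _, h0⟩
  | succ n ih =>
    refine ⟨⟨differentiableOn_const _, h0⟩, ?_⟩
    simpa using ih

namespace Tempered

variable {c d : ℝ} {f g : ℂ → ℂ}

lemma differentiableOn (h : Tempered c f) : DifferentiableOn ℂ f strip := (h 0).1

lemma polyBound (h : Tempered c f) : PolyBound c f := (h 0).2

lemma deriv (h : Tempered c f) : Tempered c (deriv f) := fun n => (h (n + 1)).2

lemma congr (h : Tempered c f) (h' : EqOn f g strip) : Tempered c g := fun n => (h n).congr h'

lemma mono (h : Tempered c f) (h' : c ≤ d) : Tempered d f := fun n => (h n).mono h'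

lemma add (hf : Tempered c f) (hg : Tempered c g) : Tempered c (fun s => f s + g s) :=
  fun n => (hf n).add (hg n)

lemma mul (hf : Tempered c f) (hg : Tempered d g) : Tempered (c + d) (fun s => f s * g s) :=
  fun n => (hf n).mul (hg n)

end Tempered

lemma tempered_const (a : ℂ) : Tempered 0 (fun _ => a) := by
  intro n
  have h0 : DifferentiableOn ℂ (fun _ => a) strip ∧ PolyBound 0 (fun _ => a) :=
    ⟨differentiableOn_const _, polyBound_of_bounded (C := ‖a‖) fun _ _ => le_rfl⟩
  cases n with
  | zero => exact h0
  | succ n => exact ⟨h0, by simpa using temperedUpTo_zero_fun n 0⟩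

lemma Tempered.prod {ι : Type*} (S : Finset ι) {f : ι → ℂ → ℂ} (h : ∀ i ∈ S, Tempered 0 (f i)) :
    Tempered 0 (fun s => ∏ i ∈ S, f i s) := by
  classical
  induction S using Finset.induction_on with
  | empty => simpa using tempered_const 1
  | insert a S ha ih =>
    have := (h a (Finset.mem_insert_self _ _)).mul
      (ih fun i hi => h i (Finset.mem_insert_of_mem hi))
    simp only [Finset.prod_insert ha]
    simpa using this

/-- A function whose logarithmic derivative is tempered of exponent zero is tempered. -/
lemma tempered_of_deriv_eq_mul {c : ℝ} {f q : ℂ → ℂ} (hf : DifferentiableOn ℂ f strip)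
    (hb : PolyBound c f) (hq : Tempered 0 q) (h : ∀ s ∈ strip, deriv f s = q s * f s) :
    Tempered c f := by
  intro n
  induction n with
  | zero => exact ⟨hf, hb⟩
  | succ n ih =>
    refine ⟨⟨hf, hb⟩, ?_⟩
    have := (hq n).mul ih
    rw [zero_add] at this
    exact this.congr fun s hs => (h s hs).symm

/-- Since (1/f)' = -f' (1/f)(1/f), the derivatives of 1/f are controlled inductively. The only
genuine input is the lower bound for f expressed by `hb`. -/
lemma Tempered.inv {f : ℂ → ℂ} (hf : Tempered 0 f) (h0 : ∀ s ∈ strip, f s ≠ 0)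
    (hb : PolyBound 0 (fun s => (f s)⁻¹)) : Tempered 0 (fun s => (f s)⁻¹) := by
  have hd : DifferentiableOn ℂ (fun s => (f s)⁻¹) strip := hf.differentiableOn.inv h0
  intro n
  induction n with
  | zero => exact ⟨hd, hb⟩
  | succ n ih =>
    refine ⟨⟨hd, hb⟩, ?_⟩
    have := ((tempered_const (-1) n).mul (hf.deriv n)).mul (ih.mul ih)
    simp only [add_zero] at this
    refine this.congr fun s hs => ?_
    have := (differentiableAt_of_strip hf.differentiableOn hs).hasDerivAt.inv (h0 s hs)
    rw [show (fun s => (f s)⁻¹) = f⁻¹ from rfl, this.deriv]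
    field_simp

/-- Cauchy's estimates: a function holomorphic and of polynomial growth on a wider strip is
tempered. -/
lemma tempered_of_wide_strip {c r : ℝ} (hr : 0 < r) {f : ℂ → ℂ}
    (hf : DifferentiableOn ℂ f {s | -r < s.re ∧ s.re < 1 / 4 + r})
    (hb : ∀ ε : ℝ, 0 < ε → ∃ C : ℝ, 0 ≤ C ∧ ∀ s : ℂ, -r < s.re → s.re < 1 / 4 + r →
      ‖f s‖ ≤ C * (|s.im| + 2) ^ (c + ε)) :
    Tempered c f := by
  intro n
  induction n generalizing r f with
  | zero =>
    refine ⟨hf.mono fun s hs => ⟨by linarith [hs.1], by linarith [hs.2]⟩, fun ε hε => ?_⟩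
    obtain ⟨C, hC, H⟩ := hb ε hε
    exact ⟨C, hC, fun s hs => H s (by linarith [hs.1]) (by linarith [hs.2])⟩
  | succ n ih =>
    have hO : IsOpen {s : ℂ | -r < s.re ∧ s.re < 1 / 4 + r} :=
      (isOpen_lt continuous_const Complex.continuous_re).inter
        (isOpen_lt Complex.continuous_re continuous_const)
    refine ⟨⟨hf.mono fun s hs => ⟨by linarith [hs.1], by linarith [hs.2]⟩, fun ε hε => ?_⟩, ?_⟩
    · obtain ⟨C, hC, H⟩ := hb ε hε
      exact ⟨C, hC, fun s hs => H s (by linarith [hs.1]) (by linarith [hs.2])⟩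
    -- Each derivative gives up half of the remaining margin around the strip; only finitely many
    -- derivatives are asked for at a time.
    · refine ih (r := r / 2) (by positivity) ((hf.deriv hO).mono fun s hs =>
        ⟨by linarith [hs.1], by linarith [hs.2]⟩) fun ε hε => ?_
      obtain ⟨C, hC, H⟩ := hb ε hε
      -- A radius at most 1 changes |Im s| + 2 by a factor at most 2 in either direction, whence the
      -- constant 2^|c + ε|, whatever the sign of the exponent.
      set ρ := min (r / 4) 1 with hρ
      have hρ0 : 0 < ρ := by positivity
      have hρ1 : ρ ≤ 1 := min_le_right _ _
      have hρr : ρ ≤ r / 4 := min_le_left _ _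
      refine ⟨C * 2 ^ |c + ε| / ρ, by positivity, fun s h1 h2 => ?_⟩
      have key : ∀ z ∈ Metric.closedBall s ρ, |z.re - s.re| ≤ ρ ∧ |z.im - s.im| ≤ ρ := by
        intro z hz
        rw [Metric.mem_closedBall, dist_eq_norm] at hz
        exact ⟨by simpa using (Complex.abs_re_le_norm (z - s)).trans hz,
          by simpa using (Complex.abs_im_le_norm (z - s)).trans hz⟩
      have hsub : Metric.closedBall s ρ ⊆ {s : ℂ | -r < s.re ∧ s.re < 1 / 4 + r} := by
        intro z hz
        obtain ⟨h3, -⟩ := key z hz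
        rw [abs_le] at h3
        constructor <;> linarith [h3.1, h3.2]
      have hd : DiffContOnCl ℂ f (Metric.ball s ρ) := by
        refine DifferentiableOn.diffContOnCl (hf.mono ?_)
        rw [closure_ball s hρ0.ne']
        exact hsub
      have hpow : ∀ z ∈ Metric.sphere s ρ, ‖f z‖ ≤ C * 2 ^ |c + ε| * (|s.im| + 2) ^ (c + ε) := by
        intro z hz
        have hz' := Metric.sphere_subset_closedBall hz
        refine (H z (hsub hz').1 (hsub hz').2).trans ?_
        rw [mul_assoc]
        refine mul_le_mul_of_nonneg_left ?_ hC
        have h4 := (key z hz').2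
        have hA : 0 < |s.im| + 2 := by positivity
        have hB : 0 < |z.im| + 2 := by positivity
        have h5 : |z.im| ≤ |s.im| + 1 := by
          have := abs_sub_abs_le_abs_sub z.im s.im; linarith
        have h6 : |s.im| ≤ |z.im| + 1 := by
          have := abs_sub_abs_le_abs_sub s.im z.im; rw [abs_sub_comm] at this; linarith
        rcases le_total 0 (c + ε) with h | h
        · rw [abs_of_nonneg h, ← Real.mul_rpow (by norm_num) hA.le]
          exact Real.rpow_le_rpow hB.le (by linarith [abs_nonneg s.im]) h
        · rw [abs_of_nonpos h]
          have h7 : (|z.im| + 2) ^ (c + ε) ≤ ((|s.im| + 2) / 2) ^ (c + ε) :=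
            Real.rpow_le_rpow_of_nonpos (by positivity) (by linarith [abs_nonneg z.im]) h
          refine h7.trans (le_of_eq ?_)
          rw [Real.div_rpow hA.le (by norm_num), Real.rpow_neg (by norm_num)]
          field_simp
      have := Complex.norm_deriv_le_of_forall_mem_sphere_norm_le hρ0 hd hpow
      refine this.trans (le_of_eq ?_)
      ring

end ArithSeq

/-! ### The mollified inverse Laplace integral: absolute bounds and integration by parts. -/

namespace ArithSeq

/-- The point `1 / v + i t`. -/
noncomputable def linePt (v t : ℝ) : ℂ := (1 / v : ℝ) + t * Complex.I

@[simp] lemma linePt_re (v t : ℝ) : (linePt v t).re = 1 / v := by simp [linePt]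

@[simp] lemma linePt_im (v t : ℝ) : (linePt v t).im = t := by simp [linePt]

lemma linePt_mem_strip {v : ℝ} (hv : 4 < v) (t : ℝ) : linePt v t ∈ strip := by
  refine ⟨?_, ?_⟩
  · simp only [linePt_re]; positivity
  · simp only [linePt_re]
    exact one_div_lt_one_div_of_lt (by norm_num) hv

lemma linePt_ne_zero {v : ℝ} (hv : 0 < v) (t : ℝ) : linePt v t ≠ 0 := by
  intro h
  have := congrArg Complex.re h
  simp at this
  exact hv.ne' this

lemma continuous_linePt (v : ℝ) : Continuous (linePt v) := by
  unfold linePt; fun_prop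

lemma hasDerivAt_linePt (v t : ℝ) : HasDerivAt (linePt v) Complex.I t := by
  unfold linePt
  have := ((Complex.ofRealCLM.hasDerivAt (x := t)).mul_const Complex.I).const_add
    (((1 / v : ℝ)) : ℂ)
  simpa using this

/-- The integrand of the truncated inverse Laplace transform of `s ^ α V(s)`. -/
noncomputable def hankelIntegrand (α : ℝ) (V : ℂ → ℂ) (l v t : ℝ) : ℂ :=
  linePt v t ^ (α : ℂ) * V (linePt v t) *
    Complex.exp (l ^ 2 * linePt v t ^ 2 / 2 + linePt v t * v)

/-- The inverse Laplace transform (up to a factor `2π`) at `v` of `s ^ α V(s)`, mollified at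
scale `l` and taken over the line `Re s = 1 / v`. -/
noncomputable def hankelInt (α : ℝ) (V : ℂ → ℂ) (l v : ℝ) : ℂ :=
  ∫ t : ℝ, hankelIntegrand α V l v t

lemma norm_linePt_sq (v t : ℝ) : ‖linePt v t‖ ^ 2 = (1 / v) ^ 2 + t ^ 2 := by
  rw [Complex.sq_norm, Complex.normSq_apply]
  simp; ring

/-- On the line Re s = 1/v the factor e^(sv) has constant modulus e, and the mollifier has real part
l²(1/v² - t²)/2. This is why the line depends on v. -/
lemma norm_exp_line_le {l v : ℝ} (hl : 0 < l) (hl1 : l ≤ 1) (hv : 4 < v) (t : ℝ) :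
    ‖Complex.exp (l ^ 2 * linePt v t ^ 2 / 2 + linePt v t * v)‖
      ≤ Real.exp 2 * Real.exp (-(l ^ 2 * t ^ 2 / 2)) := by
  rw [Complex.norm_exp, ← Real.exp_add]
  apply Real.exp_le_exp.mpr
  have h1 : (((l : ℂ) ^ 2 * linePt v t ^ 2 / 2 + linePt v t * v)).re
      = l ^ 2 * ((1 / v) ^ 2 - t ^ 2) / 2 + 1 := by
    have h2 : ((l : ℂ) ^ 2 * linePt v t ^ 2 / 2 + linePt v t * v)
        = ((l ^ 2 / 2 : ℝ) : ℂ) * (linePt v t * linePt v t) + linePt v t * (v : ℝ) := by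
      push_cast; ring
    rw [h2, Complex.add_re, Complex.re_ofReal_mul, Complex.mul_re, Complex.mul_re]
    simp
    field_simp
  rw [h1]
  have h3 : (1 / v) ^ 2 ≤ 1 := by
    rw [sq_le_one_iff₀ (by positivity)]
    rw [div_le_one (by linarith)]; linarith
  have h4 : l ^ 2 ≤ 1 := by rwa [sq_le_one_iff₀ hl.le]
  nlinarith [sq_nonneg l, sq_nonneg (1 / v), sq_nonneg t]

lemma integrable_one_add_sq {r : ℝ} (hr : 1 < r) :
    Integrable (fun u : ℝ => (1 + u ^ 2) ^ (-r / 2)) := by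
  have := integrable_rpow_neg_one_add_norm_sq (E := ℝ) (μ := volume) (r := r) (by simpa using hr)
  simpa using this

lemma norm_linePt_rpow {v : ℝ} (hv : 0 < v) (g t : ℝ) :
    ‖linePt v t‖ ^ (-g) = v ^ g * (1 + (t * v) ^ 2) ^ (-g / 2) := by
  have h1 : ‖linePt v t‖ = (v ^ (-2 : ℝ) * (1 + (t * v) ^ 2)) ^ (1 / 2 : ℝ) := by
    rw [← Real.sqrt_eq_rpow, eq_comm, Real.sqrt_eq_iff_mul_self_eq (by positivity) (norm_nonneg _),
      ← sq, norm_linePt_sq, Real.rpow_neg hv.le, show ((2 : ℝ)) = ((2 : ℕ) : ℝ) by norm_num,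
      Real.rpow_natCast]
    field_simp
  rw [h1, ← Real.rpow_mul (by positivity), Real.mul_rpow (by positivity) (by positivity),
    ← Real.rpow_mul hv.le]
  congr 2 <;> ring

lemma integrable_norm_linePt {v g : ℝ} (hv : 0 < v) (hg : 1 < g) :
    Integrable (fun t : ℝ => ‖linePt v t‖ ^ (-g)) := by
  simp_rw [norm_linePt_rpow hv]
  exact ((integrable_one_add_sq hg).comp_mul_right' hv.ne').const_mul _

lemma integral_norm_linePt {v g : ℝ} (hv : 0 < v) :
    ∫ t : ℝ, ‖linePt v t‖ ^ (-g) = v ^ (g - 1) * ∫ u : ℝ, (1 + u ^ 2) ^ (-g / 2) := by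
  simp_rw [norm_linePt_rpow hv]
  rw [integral_const_mul, Measure.integral_comp_mul_right (fun u : ℝ => (1 + u ^ 2) ^ (-g / 2)),
    Real.rpow_sub_one hv.ne', abs_of_pos (by positivity)]
  simp only [smul_eq_mul]
  field_simp

lemma exists_rpow_mul_exp_le (q : ℝ) :
    ∃ C : ℝ, 0 ≤ C ∧ ∀ x : ℝ, 0 ≤ x → (x + 2) ^ q * Real.exp (-(x ^ 2 / 2)) ≤ C := by
  obtain ⟨n, hn⟩ := exists_nat_ge q
  refine ⟨n.factorial * Real.exp 3, by positivity, fun x hx => ?_⟩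
  have h1 : (x + 2) ^ q ≤ n.factorial * Real.exp (x + 2) := by
    calc (x + 2) ^ q ≤ (x + 2) ^ (n : ℝ) :=
          Real.rpow_le_rpow_of_exponent_le (by linarith) hn
      _ = (x + 2) ^ n := Real.rpow_natCast _ _
      _ ≤ _ := by
        have := Real.pow_div_factorial_le_exp (x + 2) (by linarith) n
        rwa [div_le_iff₀' (by positivity)] at this
  calc (x + 2) ^ q * Real.exp (-(x ^ 2 / 2))
      ≤ n.factorial * Real.exp (x + 2) * Real.exp (-(x ^ 2 / 2)) := by gcongr
    _ = n.factorial * Real.exp (x + 2 + -(x ^ 2 / 2)) := by rw [mul_assoc, ← Real.exp_add]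
    _ ≤ _ := by gcongr; nlinarith [sq_nonneg (x - 1)]

/-- The exponent of the loss `1 / l` in the estimates for mollified integrals. -/
noncomputable def lossExp (α : ℝ) (m : ℕ) : ℝ := m + max α 0 + 2

lemma lossExp_nonneg (α : ℝ) (m : ℕ) : 0 ≤ lossExp α m := by
  unfold lossExp; positivity

lemma lossExp_mono {α β : ℝ} (h : α ≤ β) (m : ℕ) : lossExp α m ≤ lossExp β m := by
  unfold lossExp; gcongr

lemma lossExp_add_one (α : ℝ) (m : ℕ) : lossExp (α + 1) m ≤ lossExp α m + 1 := by
  unfold lossExp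
  have : max (α + 1) 0 ≤ max α 0 + 1 :=
    max_le (by linarith [le_max_left α 0]) (by linarith [le_max_right α 0])
  linarith

/-- The size of a mollified inverse Laplace transform. -/
noncomputable def hankelSize (e : ℝ) (α : ℝ) (m : ℕ) (l v : ℝ) : ℝ :=
  v ^ max e (1 / 2) + l ^ (-lossExp α m)

lemma hankelSize_mono {e e' α β : ℝ} {m : ℕ} {l v : ℝ} (hl : 0 < l) (hl1 : l ≤ 1) (hv : 4 < v)
    (he : e ≤ e') (h : α ≤ β) : hankelSize e α m l v ≤ hankelSize e' β m l v := by
  unfold hankelSize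
  refine add_le_add ?_ ?_
  · exact Real.rpow_le_rpow_of_exponent_le (by linarith) (max_le_max he le_rfl)
  · exact Real.rpow_le_rpow_of_exponent_ge hl hl1 (neg_le_neg (lossExp_mono h m))

/-- The term in s^(α+1) arises from differentiating the mollifier and therefore carries l². This
more than pays for its loss exponent, which is larger by at most one. -/
lemma sq_mul_hankelSize_add_one {e e' α : ℝ} {m : ℕ} {l v : ℝ} (hl : 0 < l) (hl1 : l ≤ 1)
    (hv : 4 < v) (he : e ≤ e') :
    l ^ 2 * hankelSize e (α + 1) m l v ≤ hankelSize e' α m l v := by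
  unfold hankelSize
  have h2 : l ^ 2 ≤ 1 := by rwa [sq_le_one_iff₀ hl.le]
  rw [mul_add]
  refine add_le_add ?_ ?_
  · exact (mul_le_of_le_one_left (by positivity) h2).trans
      (Real.rpow_le_rpow_of_exponent_le (by linarith) (max_le_max he le_rfl))
  · rw [← Real.rpow_natCast l 2, ← Real.rpow_add hl]
    refine Real.rpow_le_rpow_of_exponent_ge hl hl1 ?_
    have := lossExp_add_one α m
    push_cast
    linarith

/-- Pointwise majorant for integrands of mollified inverse Laplace transforms. -/
lemma exists_majorant (α : ℝ) (m : ℕ) : ∃ C : ℝ, 0 ≤ C ∧ ∀ l v t : ℝ, 0 < l → l ≤ 1 → 4 < v →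
    ‖linePt v t‖ ^ α * (|t| + 2) ^ m * Real.exp (-(l ^ 2 * t ^ 2 / 2)) ≤
      C * (‖linePt v t‖ ^ (-max (-α) (3 / 2)) + l ^ (-lossExp α m) * (1 + t ^ 2) ^ (-2 / 2 : ℝ)) := by
  obtain ⟨C₁, hC₁, H₁⟩ := exists_rpow_mul_exp_le (lossExp α m)
  -- The exponent is at least 3/2 so that |s|^(-g) is integrable along the line. Its integral is a
  -- multiple of v^(g-1), the origin of `max e (1 / 2)` in `hankelSize`.
  set g := max (-α) (3 / 2) with hg
  have hga : 0 ≤ α + g := by linarith [le_max_left (-α) (3 / 2)]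
  refine ⟨2 ^ (α + g) * 3 ^ m + C₁, by positivity, fun l v t hl hl1 hv => ?_⟩
  have hv0 : 0 < v := by linarith
  have hs0 : 0 < ‖linePt v t‖ := norm_pos_iff.mpr (linePt_ne_zero hv0 t)
  have hv1 : 1 / v ≤ 1 := by rw [div_le_one hv0]; linarith
  have hsle : ‖linePt v t‖ ≤ |t| + 1 := by
    have := Complex.norm_le_abs_re_add_abs_im (linePt v t)
    simp only [linePt_re, linePt_im] at this
    rw [abs_of_pos (by positivity : 0 < 1 / v)] at this
    linarith
  have hX : 0 ≤ ‖linePt v t‖ ^ (-g) := by positivity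
  have hY : 0 ≤ l ^ (-lossExp α m) * (1 + t ^ 2) ^ (-2 / 2 : ℝ) := by positivity
  rcases le_total |t| 1 with ht | ht
  · have h1 : ‖linePt v t‖ ^ α ≤ 2 ^ (α + g) * ‖linePt v t‖ ^ (-g) := by
      have : ‖linePt v t‖ ^ α = ‖linePt v t‖ ^ (α + g) * ‖linePt v t‖ ^ (-g) := by
        rw [← Real.rpow_add hs0]; congr 1; ring
      rw [this]
      gcongr
      linarith
    have h2 : (|t| + 2) ^ m ≤ 3 ^ m := by gcongr; linarith
    have h3 : Real.exp (-(l ^ 2 * t ^ 2 / 2)) ≤ 1 := by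
      rw [Real.exp_le_one_iff]; have : 0 ≤ l ^ 2 * t ^ 2 := by positivity
      linarith
    calc ‖linePt v t‖ ^ α * (|t| + 2) ^ m * Real.exp (-(l ^ 2 * t ^ 2 / 2))
        ≤ (2 ^ (α + g) * ‖linePt v t‖ ^ (-g)) * 3 ^ m * 1 := by gcongr
      _ = (2 ^ (α + g) * 3 ^ m) * ‖linePt v t‖ ^ (-g) := by ring
      _ ≤ _ := by
        apply mul_le_mul _ _ hX (by positivity)
        · linarith
        · linarith
  -- Away from the real axis all powers of |t| + 2, together with two more that buy the integrable
  -- factor (1 + t²)⁻¹, are traded through the Gaussian for the same power of 1/l. Their total is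
  -- `lossExp α m`.
  · have hs1 : 1 ≤ ‖linePt v t‖ := by
      have := Complex.abs_im_le_norm (linePt v t)
      simp only [linePt_im] at this
      linarith
    have hT : 0 < |t| + 2 := by positivity
    have h1 : ‖linePt v t‖ ^ α ≤ (|t| + 2) ^ (max α 0) := by
      calc ‖linePt v t‖ ^ α ≤ ‖linePt v t‖ ^ (max α 0) :=
            Real.rpow_le_rpow_of_exponent_le hs1 (le_max_left _ _)
        _ ≤ _ := by gcongr; linarith
    have h2 : (|t| + 2) ^ (max α 0) * (|t| + 2) ^ m
        = (|t| + 2) ^ (lossExp α m) * (|t| + 2) ^ (-2 : ℝ) := by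
      rw [← Real.rpow_natCast, ← Real.rpow_add hT, ← Real.rpow_add hT]
      congr 1; unfold lossExp; ring
    have h3 : (|t| + 2) ^ (-2 : ℝ) ≤ (1 + t ^ 2) ^ (-2 / 2 : ℝ) := by
      rw [show (-2 / 2 : ℝ) = -1 by norm_num, Real.rpow_neg hT.le, Real.rpow_neg (by positivity),
        Real.rpow_one, show (2 : ℝ) = ((2 : ℕ) : ℝ) by norm_num, Real.rpow_natCast]
      apply inv_anti₀ (by positivity)
      push_cast
      nlinarith [abs_nonneg t, sq_abs t]
    have h4 : (|t| + 2) ^ (lossExp α m) * Real.exp (-(l ^ 2 * t ^ 2 / 2))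
        ≤ C₁ * l ^ (-lossExp α m) := by
      have h5 : (|t| + 2) ≤ l⁻¹ * (l * |t| + 2) := by
        rw [mul_add, ← mul_assoc, inv_mul_cancel₀ hl.ne', one_mul]
        have : 1 ≤ l⁻¹ := (one_le_inv₀ hl).mpr hl1
        linarith
      have h6 : (|t| + 2) ^ (lossExp α m) ≤ l ^ (-lossExp α m) * (l * |t| + 2) ^ (lossExp α m) := by
        rw [Real.rpow_neg hl.le, ← Real.inv_rpow hl.le, ← Real.mul_rpow (by positivity) (by positivity)]
        exact Real.rpow_le_rpow hT.le h5 (lossExp_nonneg α m)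
      have h7 := H₁ (l * |t|) (by positivity)
      rw [mul_pow, sq_abs] at h7
      calc (|t| + 2) ^ (lossExp α m) * Real.exp (-(l ^ 2 * t ^ 2 / 2))
          ≤ l ^ (-lossExp α m) * (l * |t| + 2) ^ (lossExp α m)
            * Real.exp (-(l ^ 2 * t ^ 2 / 2)) := by gcongr
        _ = l ^ (-lossExp α m) * ((l * |t| + 2) ^ (lossExp α m)
            * Real.exp (-(l ^ 2 * t ^ 2 / 2))) := by ring
        _ ≤ l ^ (-lossExp α m) * C₁ := by gcongr
        _ = _ := mul_comm _ _
    calc ‖linePt v t‖ ^ α * (|t| + 2) ^ m * Real.exp (-(l ^ 2 * t ^ 2 / 2))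
        ≤ (|t| + 2) ^ (max α 0) * (|t| + 2) ^ m * Real.exp (-(l ^ 2 * t ^ 2 / 2)) := by gcongr
      _ = ((|t| + 2) ^ (lossExp α m) * Real.exp (-(l ^ 2 * t ^ 2 / 2)))
          * (|t| + 2) ^ (-2 : ℝ) := by rw [h2]; ring
      _ ≤ (C₁ * l ^ (-lossExp α m)) * (1 + t ^ 2) ^ (-2 / 2 : ℝ) := by gcongr
      _ = C₁ * (l ^ (-lossExp α m) * (1 + t ^ 2) ^ (-2 / 2 : ℝ)) := by ring
      _ ≤ _ := by
        apply mul_le_mul _ _ hY (by positivity)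
        · have : (0:ℝ) ≤ 2 ^ (α + g) * 3 ^ m := by positivity
          linarith
        · linarith

/-- Absolute bound for an integral dominated by `|s| ^ α (|t| + 2) ^ m exp (-l² t² / 2)`. -/
lemma exists_integral_bound (α : ℝ) (m : ℕ) : ∃ C : ℝ, 0 ≤ C ∧ ∀ (l v B : ℝ) (f : ℝ → ℂ),
    0 < l → l ≤ 1 → 4 < v → 0 ≤ B → AEStronglyMeasurable f →
    (∀ t, ‖f t‖ ≤ B * (‖linePt v t‖ ^ α * (|t| + 2) ^ m * Real.exp (-(l ^ 2 * t ^ 2 / 2)))) →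
    Integrable f ∧ ‖∫ t, f t‖ ≤ B * C * hankelSize (-α - 1) α m l v := by
  obtain ⟨C, hC, H⟩ := exists_majorant α m
  set g := max (-α) (3 / 2) with hg
  have hg1 : 1 < g := lt_of_lt_of_le (by norm_num) (le_max_right _ _)
  set A := ∫ u : ℝ, (1 + u ^ 2) ^ (-g / 2) with hA
  set A' := ∫ u : ℝ, (1 + u ^ 2) ^ (-2 / 2 : ℝ) with hA'
  have hA0 : 0 ≤ A := integral_nonneg fun u => by positivity
  have hA'0 : 0 ≤ A' := integral_nonneg fun u => by positivity
  refine ⟨C * (A + A'), by positivity, fun l v B f hl hl1 hv hB hf hb => ?_⟩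
  have hv0 : 0 < v := by linarith
  have hint : Integrable (fun t : ℝ => B * (C * (‖linePt v t‖ ^ (-g)
      + l ^ (-lossExp α m) * (1 + t ^ 2) ^ (-2 / 2 : ℝ)))) :=
    (((integrable_norm_linePt hv0 hg1).add
      ((integrable_one_add_sq (r := 2) (by norm_num)).const_mul _)).const_mul _).const_mul _
  have hle : ∀ t, ‖f t‖ ≤ B * (C * (‖linePt v t‖ ^ (-g)
      + l ^ (-lossExp α m) * (1 + t ^ 2) ^ (-2 / 2 : ℝ))) := fun t =>
    (hb t).trans (mul_le_mul_of_nonneg_left (H l v t hl hl1 hv) hB)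
  refine ⟨hint.mono' hf (Eventually.of_forall hle), ?_⟩
  refine (norm_integral_le_of_norm_le hint (Eventually.of_forall hle)).trans ?_
  rw [integral_const_mul, integral_const_mul, integral_add (integrable_norm_linePt hv0 hg1)
    ((integrable_one_add_sq (r := 2) (by norm_num)).const_mul _), integral_norm_linePt hv0,
    integral_const_mul, ← hA, ← hA', mul_assoc B, mul_assoc C]
  refine mul_le_mul_of_nonneg_left (mul_le_mul_of_nonneg_left ?_ hC) hB
  have hge : g - 1 = max (-α - 1) (1 / 2) := by
    rw [hg, ← max_sub_sub_right]; norm_num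
  unfold hankelSize
  rw [hge]
  have h1 : 0 ≤ v ^ max (-α - 1) (1 / 2) := by positivity
  have h2 : 0 ≤ l ^ (-lossExp α m) := by positivity
  nlinarith [mul_nonneg h1 hA'0, mul_nonneg h2 hA0]

lemma Tempered.exists_bound {c : ℝ} {m : ℕ} {V : ℂ → ℂ} (hV : Tempered c V) (hm : c + 1 ≤ m) :
    ∃ B : ℝ, 0 ≤ B ∧ ∀ s ∈ strip, ‖V s‖ ≤ B * (|s.im| + 2) ^ m := by
  obtain ⟨B, hB, H⟩ := hV.polyBound 1 one_pos
  refine ⟨B, hB, fun s hs => (H s hs).trans ?_⟩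
  rw [← Real.rpow_natCast]
  gcongr
  exact one_le_abs_add_two _

lemma continuous_comp_linePt {V : ℂ → ℂ} (hV : DifferentiableOn ℂ V strip) {v : ℝ} (hv : 4 < v) :
    Continuous (fun t => V (linePt v t)) :=
  hV.continuousOn.comp_continuous (continuous_linePt v) fun t => linePt_mem_strip hv t

lemma continuous_linePt_cpow {v : ℝ} (hv : 4 < v) (α : ℝ) :
    Continuous (fun t => linePt v t ^ (α : ℂ)) := by
  refine (continuous_linePt v).cpow continuous_const fun t => Or.inl ?_
  rw [linePt_re]
  exact one_div_pos.mpr (by linarith)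

lemma norm_linePt_cpow {v : ℝ} (hv : 4 < v) (α t : ℝ) :
    ‖linePt v t ^ (α : ℂ)‖ = ‖linePt v t‖ ^ α :=
  Complex.norm_cpow_of_ne_zero (linePt_ne_zero (by linarith) t) _ |>.trans (by simp)

lemma continuous_hankelIntegrand {α l v : ℝ} {V : ℂ → ℂ} (hV : DifferentiableOn ℂ V strip)
    (hv : 4 < v) : Continuous (hankelIntegrand α V l v) := by
  unfold hankelIntegrand
  refine ((continuous_linePt_cpow hv α).mul (continuous_comp_linePt hV hv)).mul ?_
  have := continuous_linePt v
  fun_prop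

lemma norm_hankelIntegrand_le {α l v B : ℝ} {m : ℕ} {V : ℂ → ℂ} (hl : 0 < l) (hl1 : l ≤ 1)
    (hv : 4 < v) (hB : ∀ s ∈ strip, ‖V s‖ ≤ B * (|s.im| + 2) ^ m) (t : ℝ) :
    ‖hankelIntegrand α V l v t‖ ≤ (B * Real.exp 2) *
      (‖linePt v t‖ ^ α * (|t| + 2) ^ m * Real.exp (-(l ^ 2 * t ^ 2 / 2))) := by
  unfold hankelIntegrand
  rw [norm_mul, norm_mul, norm_linePt_cpow hv]
  have h1 := hB _ (linePt_mem_strip hv t)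
  rw [linePt_im] at h1
  calc ‖linePt v t‖ ^ α * ‖V (linePt v t)‖ * _
      ≤ ‖linePt v t‖ ^ α * (B * (|t| + 2) ^ m) *
        (Real.exp 2 * Real.exp (-(l ^ 2 * t ^ 2 / 2))) := by
        have := norm_exp_line_le hl hl1 hv t
        have h0 : 0 ≤ B * (|t| + 2) ^ m := (norm_nonneg _).trans h1
        gcongr
    _ = _ := by ring

lemma hankelInt_bound {c : ℝ} {m : ℕ} (hm : c + 1 ≤ m) (α : ℝ) {V : ℂ → ℂ} (hV : Tempered c V) :
    ∃ C : ℝ, 0 ≤ C ∧ ∀ l v : ℝ, 0 < l → l ≤ 1 → 4 < v → Integrable (hankelIntegrand α V l v) ∧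
      ‖hankelInt α V l v‖ ≤ C * hankelSize (-α - 1) α m l v := by
  obtain ⟨B, hB, H⟩ := hV.exists_bound hm
  obtain ⟨C, hC, H'⟩ := exists_integral_bound α m
  refine ⟨(B * Real.exp 2) * C, by positivity, fun l v hl hl1 hv => ?_⟩
  exact H' l v (B * Real.exp 2) _ hl hl1 hv (by positivity)
    (continuous_hankelIntegrand hV.differentiableOn hv).aestronglyMeasurable
    (norm_hankelIntegrand_le hl hl1 hv H)

/-- The four terms come in order from s^α, from V, from the mollifier and from e^(sv). Integrated
over the line they sum to zero, which expresses v times the integral through the other three. -/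
lemma hasDerivAt_hankelIntegrand {α l v : ℝ} {V : ℂ → ℂ} (hV : DifferentiableOn ℂ V strip)
    (hv : 4 < v) (t : ℝ) :
    HasDerivAt (hankelIntegrand α V l v)
      (Complex.I * (α * hankelIntegrand (α - 1) V l v t + hankelIntegrand α (deriv V) l v t
        + l ^ 2 * hankelIntegrand (α + 1) V l v t + v * hankelIntegrand α V l v t)) t := by
  have hs := linePt_mem_strip hv t
  have h0 := linePt_ne_zero (by linarith : 0 < v) t
  have hslit : linePt v t ∈ Complex.slitPlane := Or.inl hs.1
  have h1 : HasDerivAt (fun s : ℂ => s ^ (α : ℂ)) (α * linePt v t ^ ((α : ℂ) - 1)) (linePt v t) := by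
    simpa using (hasDerivAt_id (linePt v t)).cpow_const (c := (α : ℂ)) hslit
  have h2 := (differentiableAt_of_strip hV hs).hasDerivAt
  have h3 : HasDerivAt (fun s : ℂ => Complex.exp (l ^ 2 * s ^ 2 / 2 + s * v))
      (Complex.exp (l ^ 2 * linePt v t ^ 2 / 2 + linePt v t * v) *
        (l ^ 2 * linePt v t + v)) (linePt v t) := by
    apply HasDerivAt.cexp
    have := ((((hasDerivAt_id (linePt v t)).pow 2).const_mul ((l : ℂ) ^ 2)).div_const 2).add
      ((hasDerivAt_id (linePt v t)).mul_const (v : ℂ))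
    refine this.congr_deriv ?_
    simp
    ring
  have h4 := ((h1.mul h2).mul h3).comp t (hasDerivAt_linePt v t)
  refine h4.congr_deriv ?_
  unfold hankelIntegrand
  have e1 : linePt v t ^ (((α + 1 : ℝ)) : ℂ) = linePt v t ^ (α : ℂ) * linePt v t := by
    push_cast
    rw [Complex.cpow_add _ _ h0, Complex.cpow_one]
  have e2 : (((α - 1 : ℝ)) : ℂ) = (α : ℂ) - 1 := by push_cast; ring
  rw [e1, e2]
  simp only [Pi.mul_apply]
  ring

/-- Integration by parts. -/
lemma hankelInt_by_parts {c : ℝ} (α : ℝ) {V : ℂ → ℂ} (hV : Tempered c V) {l v : ℝ} (hl : 0 < l)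
    (hl1 : l ≤ 1) (hv : 4 < v) :
    v * hankelInt α V l v = -α * hankelInt (α - 1) V l v - hankelInt α (deriv V) l v
      - l ^ 2 * hankelInt (α + 1) V l v := by
  obtain ⟨m, hm⟩ := exists_nat_ge (c + 1)
  have i0 := ((hankelInt_bound hm α hV).choose_spec.2 l v hl hl1 hv).1
  have i1 := ((hankelInt_bound hm (α - 1) hV).choose_spec.2 l v hl hl1 hv).1
  have i2 := ((hankelInt_bound hm α hV.deriv).choose_spec.2 l v hl hl1 hv).1
  have i3 := ((hankelInt_bound hm (α + 1) hV).choose_spec.2 l v hl hl1 hv).1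
  have k1 : Integrable (fun t => (α : ℂ) * hankelIntegrand (α - 1) V l v t) := i1.const_mul _
  have k2 : Integrable (fun t => (α : ℂ) * hankelIntegrand (α - 1) V l v t
      + hankelIntegrand α (deriv V) l v t) := k1.add i2
  have k3 : Integrable (fun t => (l : ℂ) ^ 2 * hankelIntegrand (α + 1) V l v t) := i3.const_mul _
  have k4 : Integrable (fun t => (α : ℂ) * hankelIntegrand (α - 1) V l v t
      + hankelIntegrand α (deriv V) l v t + (l : ℂ) ^ 2 * hankelIntegrand (α + 1) V l v t) :=
    k2.add k3
  have k5 : Integrable (fun t => (v : ℂ) * hankelIntegrand α V l v t) := i0.const_mul _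
  have j := integral_eq_zero_of_hasDerivAt_of_integrable
    (hasDerivAt_hankelIntegrand (α := α) (l := l) hV.differentiableOn hv)
    ((k4.add k5).const_mul Complex.I) i0
  rw [integral_const_mul, integral_add k4 k5, integral_add k2 k3, integral_add k1 i2,
    integral_const_mul, integral_const_mul, integral_const_mul] at j
  have := (mul_eq_zero.mp j).resolve_left Complex.I_ne_zero
  unfold hankelInt
  linear_combination this

end ArithSeq

/-! ### Repeated integration by parts. -/

namespace ArithSeq

lemma norm_hankelInt_by_parts {c : ℝ} (α : ℝ) {V : ℂ → ℂ} (hV : Tempered c V) {l v : ℝ}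
    (hl : 0 < l) (hl1 : l ≤ 1) (hv : 4 < v) :
    v * ‖hankelInt α V l v‖ ≤ |α| * ‖hankelInt (α - 1) V l v‖ + ‖hankelInt α (deriv V) l v‖
      + l ^ 2 * ‖hankelInt (α + 1) V l v‖ := by
  have h := congrArg norm (hankelInt_by_parts α hV hl hl1 hv)
  rw [norm_mul, Complex.norm_real, Real.norm_of_nonneg (by linarith : 0 ≤ v)] at h
  rw [h]
  refine (norm_sub_le _ _).trans (add_le_add ((norm_sub_le _ _).trans (add_le_add ?_ le_rfl)) ?_)
  · simp
  · simp

/-- Repeated integration by parts, absolute values. -/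
lemma pow_mul_norm_hankelInt_le {c : ℝ} {m : ℕ} (hm : c + 1 ≤ m) (n : ℕ) :
    ∀ (α : ℝ) {V : ℂ → ℂ}, Tempered c V → ∃ C : ℝ, 0 ≤ C ∧ ∀ l v : ℝ, 0 < l → l ≤ 1 → 4 < v →
      v ^ n * ‖hankelInt α V l v‖ ≤ C * hankelSize (n - α - 1) α m l v := by
  induction n with
  | zero =>
    intro α V hV
    obtain ⟨C, hC, H⟩ := hankelInt_bound hm α hV
    refine ⟨C, hC, fun l v hl hl1 hv => ?_⟩
    simpa using (H l v hl hl1 hv).2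
  | succ n ih =>
    intro α V hV
    obtain ⟨C₁, h₁, H₁⟩ := ih (α - 1) hV
    obtain ⟨C₂, h₂, H₂⟩ := ih α hV.deriv
    obtain ⟨C₃, h₃, H₃⟩ := ih (α + 1) hV
    refine ⟨|α| * C₁ + C₂ + C₃, by positivity, fun l v hl hl1 hv => ?_⟩
    have hv0 : 0 < v := by linarith
    -- All three terms fit one size: lowering α uses up the extra power of v, differentiating V
    -- leaves a power of v to spare, and l² pays for raising α.
    have e1 : hankelSize (n - (α - 1) - 1) (α - 1) m l v
        ≤ hankelSize ((n + 1 : ℕ) - α - 1) α m l v :=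
      hankelSize_mono hl hl1 hv (by push_cast; linarith) (by linarith)
    have e2 : hankelSize (n - α - 1) α m l v ≤ hankelSize ((n + 1 : ℕ) - α - 1) α m l v :=
      hankelSize_mono hl hl1 hv (by push_cast; linarith) le_rfl
    have e3 : l ^ 2 * hankelSize (n - (α + 1) - 1) (α + 1) m l v
        ≤ hankelSize ((n + 1 : ℕ) - α - 1) α m l v :=
      sq_mul_hankelSize_add_one hl hl1 hv (by push_cast; linarith)
    calc v ^ (n + 1) * ‖hankelInt α V l v‖ = v ^ n * (v * ‖hankelInt α V l v‖) := by ring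
      _ ≤ v ^ n * (|α| * ‖hankelInt (α - 1) V l v‖ + ‖hankelInt α (deriv V) l v‖
          + l ^ 2 * ‖hankelInt (α + 1) V l v‖) :=
          mul_le_mul_of_nonneg_left (norm_hankelInt_by_parts α hV hl hl1 hv) (by positivity)
      _ = |α| * (v ^ n * ‖hankelInt (α - 1) V l v‖) + v ^ n * ‖hankelInt α (deriv V) l v‖
          + l ^ 2 * (v ^ n * ‖hankelInt (α + 1) V l v‖) := by ring
      _ ≤ |α| * (C₁ * hankelSize (n - (α - 1) - 1) (α - 1) m l v)
          + C₂ * hankelSize (n - α - 1) α m l v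
          + l ^ 2 * (C₃ * hankelSize (n - (α + 1) - 1) (α + 1) m l v) := by
          have := H₁ l v hl hl1 hv
          have := H₂ l v hl hl1 hv
          have := H₃ l v hl hl1 hv
          gcongr
      _ = |α| * (C₁ * hankelSize (n - (α - 1) - 1) (α - 1) m l v)
          + C₂ * hankelSize (n - α - 1) α m l v
          + C₃ * (l ^ 2 * hankelSize (n - (α + 1) - 1) (α + 1) m l v) := by ring
      _ ≤ |α| * (C₁ * hankelSize ((n + 1 : ℕ) - α - 1) α m l v)
          + C₂ * hankelSize ((n + 1 : ℕ) - α - 1) α m l v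
          + C₃ * hankelSize ((n + 1 : ℕ) - α - 1) α m l v := by gcongr
      _ = _ := by ring

/-- Repeated integration by parts with the main term isolated. -/
lemma pow_mul_hankelInt_sub_le {c : ℝ} {m : ℕ} (hm : c + 1 ≤ m) (n : ℕ) :
    ∀ (α : ℝ) {V : ℂ → ℂ}, Tempered c V → ∃ C : ℝ, 0 ≤ C ∧ ∀ l v : ℝ, 0 < l → l ≤ 1 → 4 < v →
      ‖(v : ℂ) ^ n * hankelInt α V l v
        - ((∏ j ∈ Finset.range n, ((j : ℝ) - α) : ℝ) : ℂ) * hankelInt (α - n) V l v‖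
        ≤ C * hankelSize (n - α - 2) α m l v := by
  induction n with
  | zero =>
    intro α V hV
    refine ⟨0, le_rfl, fun l v hl hl1 hv => ?_⟩
    simp
  | succ n ih =>
    intro α V hV
    obtain ⟨C₁, h₁, H₁⟩ := ih (α - 1) hV
    -- The terms with V' and with l² s^(α+1) are lower by one power of v, so absolute values suffice
    -- for them. Only the term in s^(α-1) is iterated, and its coefficients build up the product.
    obtain ⟨C₂, h₂, H₂⟩ := pow_mul_norm_hankelInt_le hm n α hV.deriv
    obtain ⟨C₃, h₃, H₃⟩ := pow_mul_norm_hankelInt_le hm n (α + 1) hV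
    refine ⟨|α| * C₁ + C₂ + C₃, by positivity, fun l v hl hl1 hv => ?_⟩
    have hv0 : 0 < v := by linarith
    have e1 : hankelSize (n - (α - 1) - 2) (α - 1) m l v
        ≤ hankelSize ((n + 1 : ℕ) - α - 2) α m l v :=
      hankelSize_mono hl hl1 hv (by push_cast; linarith) (by linarith)
    have e2 : hankelSize (n - α - 1) α m l v ≤ hankelSize ((n + 1 : ℕ) - α - 2) α m l v :=
      hankelSize_mono hl hl1 hv (by push_cast; linarith) le_rfl
    have e3 : l ^ 2 * hankelSize (n - (α + 1) - 1) (α + 1) m l v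
        ≤ hankelSize ((n + 1 : ℕ) - α - 2) α m l v :=
      sq_mul_hankelSize_add_one hl hl1 hv (by push_cast; linarith)
    have hp : ∏ j ∈ Finset.range (n + 1), ((j : ℝ) - α)
        = -α * ∏ j ∈ Finset.range n, ((j : ℝ) - (α - 1)) := by
      rw [Finset.prod_range_succ', mul_comm]
      congr 1
      · simp
      · refine Finset.prod_congr rfl fun j _ => ?_
        push_cast; ring
    have key : (v : ℂ) ^ (n + 1) * hankelInt α V l v
        - ((∏ j ∈ Finset.range (n + 1), ((j : ℝ) - α) : ℝ) : ℂ)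
          * hankelInt (α - (n + 1 : ℕ)) V l v
        = -α * ((v : ℂ) ^ n * hankelInt (α - 1) V l v
          - ((∏ j ∈ Finset.range n, ((j : ℝ) - (α - 1)) : ℝ) : ℂ) * hankelInt (α - 1 - n) V l v)
          - (v : ℂ) ^ n * hankelInt α (deriv V) l v
          - l ^ 2 * ((v : ℂ) ^ n * hankelInt (α + 1) V l v) := by
      rw [hp, show α - ((n + 1 : ℕ) : ℝ) = α - 1 - n by push_cast; ring, pow_succ, mul_assoc,
        hankelInt_by_parts α hV hl hl1 hv]
      push_cast
      ring
    rw [key]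
    have n1 : ∀ z : ℂ, ‖(v : ℂ) ^ n * z‖ = v ^ n * ‖z‖ := fun z => by
      rw [norm_mul, norm_pow, Complex.norm_real, Real.norm_of_nonneg hv0.le]
    calc _ ≤ |α| * ‖(v : ℂ) ^ n * hankelInt (α - 1) V l v
          - ((∏ j ∈ Finset.range n, ((j : ℝ) - (α - 1)) : ℝ) : ℂ) * hankelInt (α - 1 - n) V l v‖
          + v ^ n * ‖hankelInt α (deriv V) l v‖
          + l ^ 2 * (v ^ n * ‖hankelInt (α + 1) V l v‖) := by
          refine (norm_sub_le _ _).trans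
            (add_le_add ((norm_sub_le _ _).trans (add_le_add ?_ ?_)) ?_)
          · rw [norm_mul]; simp
          · rw [n1]
          · rw [norm_mul, n1]; simp
      _ ≤ |α| * (C₁ * hankelSize (n - (α - 1) - 2) (α - 1) m l v)
          + C₂ * hankelSize (n - α - 1) α m l v
          + l ^ 2 * (C₃ * hankelSize (n - (α + 1) - 1) (α + 1) m l v) := by
          have := H₁ l v hl hl1 hv
          have := H₂ l v hl hl1 hv
          have := H₃ l v hl hl1 hv
          gcongr
      _ = |α| * (C₁ * hankelSize (n - (α - 1) - 2) (α - 1) m l v)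
          + C₂ * hankelSize (n - α - 1) α m l v
          + C₃ * (l ^ 2 * hankelSize (n - (α + 1) - 1) (α + 1) m l v) := by ring
      _ ≤ |α| * (C₁ * hankelSize ((n + 1 : ℕ) - α - 2) α m l v)
          + C₂ * hankelSize ((n + 1 : ℕ) - α - 2) α m l v
          + C₃ * hankelSize ((n + 1 : ℕ) - α - 2) α m l v := by gcongr
      _ = _ := by ring

/-- Repeated integration by parts when `s ^ α` is a polynomial. -/
lemma pow_mul_norm_hankelInt_natCast_le {c : ℝ} {m : ℕ} (hm : c + 1 ≤ m) (n : ℕ) :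
    ∀ (a : ℕ) {V : ℂ → ℂ}, Tempered c V → ∃ C : ℝ, 0 ≤ C ∧ ∀ l v : ℝ, 0 < l → l ≤ 1 → 4 < v →
      v ^ n * ‖hankelInt a V l v‖ ≤ C * hankelSize 0 a m l v := by
  induction n with
  | zero =>
    intro a V hV
    obtain ⟨C, hC, H⟩ := hankelInt_bound hm a hV
    refine ⟨C, hC, fun l v hl hl1 hv => ?_⟩
    simp only [pow_zero, one_mul]
    refine (H l v hl hl1 hv).2.trans (mul_le_mul_of_nonneg_left ?_ hC)
    exact hankelSize_mono hl hl1 hv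
      (by have : (0 : ℝ) ≤ a := Nat.cast_nonneg a
          linarith) le_rfl
  | succ n ih =>
    intro a V hV
    obtain ⟨C₁, h₁, H₁⟩ := ih (a - 1) hV
    obtain ⟨C₂, h₂, H₂⟩ := ih a hV.deriv
    obtain ⟨C₃, h₃, H₃⟩ := ih (a + 1) hV
    refine ⟨a * C₁ + C₂ + C₃, by positivity, fun l v hl hl1 hv => ?_⟩
    have hv0 : 0 < v := by linarith
    have e1 : hankelSize 0 ((a - 1 : ℕ) : ℝ) m l v ≤ hankelSize 0 a m l v :=
      hankelSize_mono hl hl1 hv le_rfl (by exact_mod_cast Nat.sub_le a 1)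
    have e3 : l ^ 2 * hankelSize 0 ((a + 1 : ℕ) : ℝ) m l v ≤ hankelSize 0 a m l v := by
      push_cast
      exact sq_mul_hankelSize_add_one hl hl1 hv le_rfl
    -- For a = 0 the factor a kills the term in s^(-1), so the truncated subtraction is harmless and
    -- no negative power of s ever appears. This keeps the power of v at v^(1/2) for every number of
    -- integrations by parts.
    have e4 : |(a : ℝ)| * ‖hankelInt (a - 1) V l v‖
        = a * ‖hankelInt ((a - 1 : ℕ) : ℝ) V l v‖ := by
      rw [abs_of_nonneg (Nat.cast_nonneg a)]
      rcases Nat.eq_zero_or_pos a with rfl | ha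
      · simp
      · rw [Nat.cast_sub ha, Nat.cast_one]
    have e5 := norm_hankelInt_by_parts a hV hl hl1 hv
    rw [e4] at e5
    calc v ^ (n + 1) * ‖hankelInt a V l v‖ = v ^ n * (v * ‖hankelInt a V l v‖) := by ring
      _ ≤ v ^ n * (a * ‖hankelInt ((a - 1 : ℕ) : ℝ) V l v‖ + ‖hankelInt a (deriv V) l v‖
          + l ^ 2 * ‖hankelInt (a + 1) V l v‖) :=
          mul_le_mul_of_nonneg_left e5 (by positivity)
      _ = a * (v ^ n * ‖hankelInt ((a - 1 : ℕ) : ℝ) V l v‖) + v ^ n * ‖hankelInt a (deriv V) l v‖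
          + l ^ 2 * (v ^ n * ‖hankelInt ((a + 1 : ℕ) : ℝ) V l v‖) := by push_cast; ring
      _ ≤ a * (C₁ * hankelSize 0 ((a - 1 : ℕ) : ℝ) m l v)
          + C₂ * hankelSize 0 a m l v
          + l ^ 2 * (C₃ * hankelSize 0 ((a + 1 : ℕ) : ℝ) m l v) := by
          have := H₁ l v hl hl1 hv
          have := H₂ l v hl hl1 hv
          have := H₃ l v hl hl1 hv
          gcongr
      _ = a * (C₁ * hankelSize 0 ((a - 1 : ℕ) : ℝ) m l v)
          + C₂ * hankelSize 0 a m l v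
          + C₃ * (l ^ 2 * hankelSize 0 ((a + 1 : ℕ) : ℝ) m l v) := by ring
      _ ≤ a * (C₁ * hankelSize 0 a m l v) + C₂ * hankelSize 0 a m l v
          + C₃ * hankelSize 0 a m l v := by gcongr
      _ = _ := by ring

/-- A tempered function is Lipschitz near its boundary value at the origin. -/
lemma Tempered.norm_sub_le {c : ℝ} {m : ℕ} (hm : c + 1 ≤ m) {V : ℂ → ℂ} (hV : Tempered c V)
    {V₀ : ℂ} (h0 : Tendsto (fun x : ℝ => V x) (𝓝[>] 0) (𝓝 V₀)) :
    ∃ B : ℝ, 0 ≤ B ∧ ∀ s ∈ strip, ‖V s - V₀‖ ≤ B * ‖s‖ * (|s.im| + 2) ^ m := by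
  obtain ⟨B, hB, H⟩ := hV.deriv.exists_bound hm
  refine ⟨B, hB, fun s hs => ?_⟩
  -- The mean value inequality is used on a convex set that contains s and the small positive reals
  -- and on which the bound for V' is governed by `s.im`. Then the real point tends to 0.
  have hconv : Convex ℝ (strip ∩ {z : ℂ | |z.im| ≤ |s.im|}) := by
    refine Convex.inter ?_ ?_
    · exact (convex_halfSpace_re_gt 0).inter (convex_halfSpace_re_lt (1 / 4))
    · have : {z : ℂ | |z.im| ≤ |s.im|} = Complex.imLm ⁻¹' (Icc (-|s.im|) |s.im|) := by
        ext z; simp [abs_le]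
      rw [this]
      exact (convex_Icc _ _).linear_preimage _
  have key : ∀ᶠ x : ℝ in 𝓝[>] 0, ‖V s - V x‖ ≤ B * (|s.im| + 2) ^ m * ‖s - x‖ := by
    filter_upwards [Ioo_mem_nhdsGT (show (0 : ℝ) < 1 / 4 by norm_num)] with x hx
    refine hconv.norm_image_sub_le_of_norm_deriv_le (f := V) (fun z hz => ?_) (fun z hz => ?_) ?_ ?_
    · exact differentiableAt_of_strip hV.differentiableOn hz.1
    · refine (H z hz.1).trans ?_
      have : |z.im| ≤ |s.im| := hz.2
      gcongr
    · exact ⟨⟨by simpa using hx.1, by simpa using hx.2⟩, by simp⟩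
    · exact ⟨hs, le_refl |s.im|⟩
  have l1 : Tendsto (fun x : ℝ => ‖V s - V x‖) (𝓝[>] 0) (𝓝 ‖V s - V₀‖) :=
    (tendsto_const_nhds.sub h0).norm
  have l2 : Tendsto (fun x : ℝ => B * (|s.im| + 2) ^ m * ‖s - x‖) (𝓝[>] 0)
      (𝓝 (B * (|s.im| + 2) ^ m * ‖s - (0 : ℝ)‖)) := by
    have : Continuous (fun x : ℝ => B * (|s.im| + 2) ^ m * ‖s - x‖) := by fun_prop
    exact (this.tendsto 0).mono_left nhdsWithin_le_nhds
  have := le_of_tendsto_of_tendsto l1 l2 key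
  simp only [Complex.ofReal_zero, sub_zero] at this
  linarith

end ArithSeq

/-! ### Laplace transforms of powers and Hankel's formula. -/

namespace ArithSeq

/-- A bilateral Laplace transform is holomorphic inside its strip of absolute convergence. -/
lemma differentiableOn_laplace {f : ℝ → ℂ} {a b : ℝ} (hf : AEStronglyMeasurable f)
    (hint : ∀ σ ∈ Ioo a b, Integrable (fun x => ‖f x‖ * Real.exp (-(σ * x)))) :
    DifferentiableOn ℂ (fun s => ∫ x : ℝ, f x * Complex.exp (-(s * x)))
      {s | a < s.re ∧ s.re < b} := by
  intro s hs
  refine DifferentiableAt.differentiableWithinAt ?_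
  obtain ⟨ε, hε, h1, h2⟩ : ∃ ε : ℝ, 0 < ε ∧ a < s.re - 2 * ε ∧ s.re + 2 * ε < b := by
    refine ⟨min ((s.re - a) / 4) ((b - s.re) / 4), ?_, ?_, ?_⟩
    · have := hs.1; have := hs.2
      apply lt_min <;> linarith
    · have := min_le_left ((s.re - a) / 4) ((b - s.re) / 4); linarith [hs.1]
    · have := min_le_right ((s.re - a) / 4) ((b - s.re) / 4); linarith [hs.2]
  have hmeas : ∀ z : ℂ, AEStronglyMeasurable (fun x : ℝ => f x * Complex.exp (-(z * x))) := by
    intro z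
    exact hf.mul (by fun_prop : Continuous fun x : ℝ => Complex.exp (-(z * x))).aestronglyMeasurable
  have hnorm : ∀ (z : ℂ) (x : ℝ), ‖Complex.exp (-(z * x))‖ = Real.exp (-(z.re * x)) := by
    intro z x; rw [Complex.norm_exp]; simp
  have key := hasDerivAt_integral_of_dominated_loc_of_deriv_le (𝕜 := ℂ) (μ := volume)
    (F := fun (z : ℂ) (x : ℝ) => f x * Complex.exp (-(z * x)))
    (F' := fun (z : ℂ) (x : ℝ) => f x * (Complex.exp (-(z * x)) * (-x)))
    (x₀ := s) (s := Metric.ball s ε)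
    (bound := fun x => ε⁻¹ * (‖f x‖ * Real.exp (-((s.re - 2 * ε) * x)))
      + ε⁻¹ * (‖f x‖ * Real.exp (-((s.re + 2 * ε) * x))))
    (Metric.ball_mem_nhds s hε) (Eventually.of_forall fun z => hmeas z) ?_ ?_ ?_ ?_ ?_
  · exact key.2.differentiableAt
  · refine (hint s.re hs).mono' (hmeas s) (Eventually.of_forall fun x => ?_)
    rw [norm_mul, hnorm]
  · exact hf.mul (by fun_prop : Continuous fun x : ℝ =>
      Complex.exp (-(s * x)) * (-(x : ℂ))).aestronglyMeasurable
  · refine Eventually.of_forall fun x z hz => ?_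
    have hz' : |z.re - s.re| ≤ ε := by
      rw [Metric.mem_ball, dist_eq_norm] at hz
      simpa using (Complex.abs_re_le_norm (z - s)).trans hz.le
    rw [norm_mul, norm_mul, hnorm, norm_neg, Complex.norm_real, Real.norm_eq_abs]
    -- The factor |x| from differentiation and the variation of Re z over the ball each cost
    -- e^(ε|x|), hence the two abscissae Re s ± 2ε in the majorant.
    have h3 : |x| ≤ ε⁻¹ * Real.exp (ε * |x|) := by
      have := Real.add_one_le_exp (ε * |x|)
      rw [inv_mul_eq_div, le_div_iff₀ hε]; linarith
    have h4 : Real.exp (-(z.re * x)) * Real.exp (ε * |x|)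
        ≤ Real.exp (-((s.re - 2 * ε) * x)) + Real.exp (-((s.re + 2 * ε) * x)) := by
      rw [← Real.exp_add]
      rw [abs_le] at hz'
      rcases le_total 0 x with hx | hx
      · rw [abs_of_nonneg hx]
        refine le_add_of_le_of_nonneg (Real.exp_le_exp.mpr ?_) (Real.exp_pos _).le
        nlinarith
      · rw [abs_of_nonpos hx]
        refine le_add_of_nonneg_of_le (Real.exp_pos _).le (Real.exp_le_exp.mpr ?_)
        nlinarith
    have h5 : Real.exp (-(z.re * x)) * |x| ≤ ε⁻¹ * (Real.exp (-((s.re - 2 * ε) * x))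
        + Real.exp (-((s.re + 2 * ε) * x))) := by
      calc Real.exp (-(z.re * x)) * |x|
          ≤ Real.exp (-(z.re * x)) * (ε⁻¹ * Real.exp (ε * |x|)) := by gcongr
        _ = ε⁻¹ * (Real.exp (-(z.re * x)) * Real.exp (ε * |x|)) := by ring
        _ ≤ _ := by gcongr
    calc _ ≤ ‖f x‖ * (ε⁻¹ * (Real.exp (-((s.re - 2 * ε) * x))
        + Real.exp (-((s.re + 2 * ε) * x)))) := mul_le_mul_of_nonneg_left h5 (norm_nonneg _)
      _ = _ := by ring
  · exact ((hint _ ⟨h1, by linarith⟩).const_mul _).add ((hint _ ⟨by linarith, h2⟩).const_mul _)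
  · refine Eventually.of_forall fun x z _ => ?_
    have : HasDerivAt (fun z : ℂ => -(z * x)) (-(x : ℂ)) z := by
      simpa using ((hasDerivAt_id' z).mul_const (x : ℂ)).fun_neg
    exact this.cexp.const_mul _

/-- The continuous function `x₊ ^ (β - 1)`. -/
noncomputable def posPow (β x : ℝ) : ℝ := max x 0 ^ (β - 1)

lemma continuous_posPow {β : ℝ} (hβ : 1 < β) : Continuous (posPow β) :=
  (continuous_id.max continuous_const).rpow_const fun _ => Or.inr (by linarith)

lemma posPow_of_nonpos {β x : ℝ} (hβ : 1 < β) (hx : x ≤ 0) : posPow β x = 0 := by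
  rw [posPow, max_eq_right hx, Real.zero_rpow (by linarith)]

lemma posPow_of_pos {β x : ℝ} (hx : 0 < x) : posPow β x = x ^ (β - 1) := by
  rw [posPow, max_eq_left hx.le]

lemma posPow_nonneg (β x : ℝ) : 0 ≤ posPow β x := by unfold posPow; positivity

lemma integrable_posPow_mul_exp {β σ : ℝ} (hβ : 1 < β) (hσ : 0 < σ) :
    Integrable (fun x => posPow β x * Real.exp (-(σ * x))) := by
  rw [← integrableOn_univ, ← Iic_union_Ioi (a := (0 : ℝ))]
  refine IntegrableOn.union ?_ ?_
  · refine (integrableOn_zero (μ := volume)).congr_fun (fun x hx => ?_) measurableSet_Iic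
    rw [posPow_of_nonpos hβ hx, zero_mul]
  · have := integrableOn_rpow_mul_exp_neg_mul_rpow (p := 1) (s := β - 1) (b := σ) (by linarith)
      one_pos hσ
    refine this.congr_fun (fun x hx => ?_) measurableSet_Ioi
    simp only [Real.rpow_one, posPow_of_pos hx, neg_mul]

/-- The Laplace transform of a power. -/
lemma laplace_posPow {β : ℝ} (hβ : 1 < β) {s : ℂ} (hs : 0 < s.re) :
    ∫ x : ℝ, (posPow β x : ℂ) * Complex.exp (-(s * x)) = Real.Gamma β * s ^ (-β : ℂ) := by
  have hpre : IsPreconnected {z : ℂ | 0 < z.re} := (convex_halfSpace_re_gt 0).isPreconnected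
  have hopen : IsOpen {z : ℂ | 0 < z.re} := isOpen_lt continuous_const Complex.continuous_re
  have hd : DifferentiableOn ℂ (fun s : ℂ => ∫ x : ℝ, (posPow β x : ℂ) * Complex.exp (-(s * x)))
      {z : ℂ | 0 < z.re} := by
    intro z hz
    have := differentiableOn_laplace (f := fun x => (posPow β x : ℂ)) (a := 0) (b := z.re + 1)
      (Complex.continuous_ofReal.comp (continuous_posPow hβ)).aestronglyMeasurable
      (fun σ hσ => by
        simpa [abs_of_nonneg (posPow_nonneg β _)] using integrable_posPow_mul_exp hβ hσ.1)
    refine ((this z ⟨hz, by linarith⟩).differentiableAt ?_).differentiableWithinAt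
    exact ((isOpen_lt continuous_const Complex.continuous_re).inter
      (isOpen_lt Complex.continuous_re continuous_const)).mem_nhds ⟨hz, by simp⟩
  have hd2 : DifferentiableOn ℂ (fun s : ℂ => (Real.Gamma β : ℂ) * s ^ (-β : ℂ))
      {z : ℂ | 0 < z.re} := by
    intro z hz
    exact ((differentiableAt_id.cpow_const (Or.inl hz)).const_mul _).differentiableWithinAt
  have hreal : ∀ r : ℝ, 0 < r → ∫ x : ℝ, (posPow β x : ℂ) * Complex.exp (-((r : ℂ) * x))
      = Real.Gamma β * (r : ℂ) ^ (-β : ℂ) := by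
    intro r hr
    have h1 : ∀ x : ℝ, (posPow β x : ℂ) * Complex.exp (-((r : ℂ) * x))
        = ((posPow β x * Real.exp (-(r * x)) : ℝ) : ℂ) := by intro x; push_cast; rfl
    simp_rw [h1]
    rw [integral_complex_ofReal]
    have h2 : ∫ x : ℝ, posPow β x * Real.exp (-(r * x))
        = ∫ x in Ioi (0 : ℝ), x ^ (β - 1) * Real.exp (-(r * x)) := by
      rw [← setIntegral_eq_integral_of_forall_compl_eq_zero (s := Ioi (0 : ℝ))]
      · exact setIntegral_congr_fun measurableSet_Ioi fun x hx => by simp only [posPow_of_pos hx]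
      · intro x hx
        rw [posPow_of_nonpos hβ (not_lt.mp hx), zero_mul]
    rw [h2, Real.integral_rpow_mul_exp_neg_mul_Ioi (by linarith) hr]
    push_cast
    rw [mul_comm, one_div, ← Complex.ofReal_neg, ← Complex.ofReal_cpow hr.le,
      Real.rpow_neg hr.le, ← Real.inv_rpow hr.le]
  -- Both sides are holomorphic on the right half-plane and agree at the real points to the right of
  -- 1, which accumulate there.
  have := (hd.analyticOnNhd hopen).eqOn_of_preconnected_of_frequently_eq
    (hd2.analyticOnNhd hopen) hpre (z₀ := 1) (by simp) ?_
  · exact this hs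
  · have ht : Tendsto (fun r : ℝ => (r : ℂ)) (𝓝[>] 1) (𝓝[≠] 1) := by
      refine tendsto_nhdsWithin_of_tendsto_nhds_of_eventually_within _ ?_ ?_
      · exact (Complex.continuous_ofReal.tendsto' 1 1 (by simp)).mono_left nhdsWithin_le_nhds
      · filter_upwards [self_mem_nhdsWithin] with r hr
        have : (r : ℝ) ≠ 1 := ne_of_gt hr
        simpa using this
    refine ht.frequently (Eventually.frequently ?_)
    filter_upwards [self_mem_nhdsWithin] with r hr
    exact hreal r (lt_trans one_pos hr)

/-- Hankel's formula over a vertical line. -/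
lemma integral_linePt_cpow_mul_exp {β v : ℝ} (hβ : 1 < β) (hv : 4 < v) :
    ∫ t : ℝ, linePt v t ^ ((-β : ℝ) : ℂ) * Complex.exp (linePt v t * v)
      = ((2 * Real.pi * v ^ (β - 1) / Real.Gamma β : ℝ) : ℂ) := by
  have hv0 : 0 < v := by linarith
  have hG : Real.Gamma β ≠ 0 := (Real.Gamma_pos_of_pos (by linarith)).ne'
  -- Fourier inversion at v for x₊^(β-1) e^(-x/v), whose transform is Γ(β) s^(-β) along the line.
  -- The condition β > 1 makes the function continuous and the transform integrable.
  set f : ℝ → ℂ := fun x => (posPow β x : ℂ) * Complex.exp (-(((1 / v : ℝ) : ℂ) * x)) with hf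
  have hfc : Continuous f := by
    have := continuous_posPow hβ
    fun_prop
  have hfi : Integrable f := by
    refine (integrable_posPow_mul_exp hβ (show 0 < 1 / v by positivity)).mono'
      hfc.aestronglyMeasurable (Eventually.of_forall fun x => le_of_eq ?_)
    rw [hf, norm_mul, Complex.norm_exp, Complex.norm_real, Real.norm_of_nonneg (posPow_nonneg _ _)]
    congr 2
    rw [Complex.neg_re, Complex.re_ofReal_mul]; simp
  have hF : FourierTransform.fourier f
      = fun w : ℝ => (Real.Gamma β : ℂ) * linePt v (2 * Real.pi * w) ^ (-β : ℂ) := by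
    ext w
    rw [Real.fourier_real_eq_integral_exp_smul, ← laplace_posPow hβ (s := linePt v (2 * Real.pi * w))
      (by simp only [linePt_re]; positivity)]
    refine integral_congr_ae (Eventually.of_forall fun x => ?_)
    simp only [hf, smul_eq_mul]
    rw [mul_left_comm, ← Complex.exp_add]
    congr 2
    simp only [linePt]
    push_cast
    ring
  have hFi : Integrable (FourierTransform.fourier f) := by
    rw [hF]
    refine Integrable.const_mul ?_ _
    have h1 : Integrable (fun t : ℝ => linePt v t ^ ((-β : ℝ) : ℂ)) := by
      refine (integrable_norm_linePt hv0 hβ).mono'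
        (continuous_linePt_cpow hv _).aestronglyMeasurable (Eventually.of_forall fun t => le_of_eq ?_)
      rw [norm_linePt_cpow hv]
    have := h1.comp_mul_left' (R := 2 * Real.pi) (by positivity)
    simpa using this
  have hinv := congrFun (hfc.fourierInv_fourier_eq hfi hFi) v
  rw [hF, Real.fourierInv_eq'] at hinv
  set g : ℝ → ℂ := fun t => linePt v t ^ ((-β : ℝ) : ℂ) * Complex.exp (linePt v t * v) with hg
  have h2 : ∀ w : ℝ, Complex.exp ((↑(2 * Real.pi * inner ℝ w v) * Complex.I)) •
      ((Real.Gamma β : ℂ) * linePt v (2 * Real.pi * w) ^ (-β : ℂ))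
      = (Real.Gamma β : ℂ) * Complex.exp (-1) * g (2 * Real.pi * w) := by
    intro w
    simp only [hg, smul_eq_mul]
    have : Complex.exp ((↑(2 * Real.pi * inner ℝ w v) * Complex.I))
        = Complex.exp (-1) * Complex.exp (linePt v (2 * Real.pi * w) * v) := by
      rw [← Complex.exp_add]
      congr 1
      simp only [linePt]
      have : ((1 / v : ℝ) : ℂ) * v = 1 := by
        rw [← Complex.ofReal_mul, one_div, inv_mul_cancel₀ hv0.ne', Complex.ofReal_one]
      rw [add_mul, this]
      simp
      ring
    rw [this]
    push_cast
    ring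
  simp_rw [h2] at hinv
  rw [integral_const_mul, Measure.integral_comp_mul_left g (2 * Real.pi), hf] at hinv
  simp only [posPow_of_pos hv0] at hinv
  have h3 : ((1 / v : ℝ) : ℂ) * v = 1 := by
    rw [← Complex.ofReal_mul, one_div, inv_mul_cancel₀ hv0.ne', Complex.ofReal_one]
  rw [h3, abs_of_pos (by positivity)] at hinv
  have hGc : (Real.Gamma β : ℂ) ≠ 0 := by exact_mod_cast hG
  have hpi : (Real.pi : ℂ) ≠ 0 := by exact_mod_cast Real.pi_ne_zero
  push_cast
  rw [eq_div_iff hGc]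
  rw [Complex.real_smul] at hinv
  push_cast at hinv
  have he : Complex.exp (-1) ≠ 0 := Complex.exp_ne_zero _
  field_simp at hinv
  linear_combination hinv

end ArithSeq

/-! ### Asymptotics of the mollified inverse Laplace integral. -/

namespace ArithSeq

lemma norm_exp_sub_one_le_four {w : ℂ} (hw : w.re ≤ 1) : ‖Complex.exp w - 1‖ ≤ 4 * ‖w‖ := by
  rcases le_total ‖w‖ 1 with h | h
  · have := Complex.norm_exp_sub_one_le h
    linarith [norm_nonneg w]
  · have h1 : ‖Complex.exp w‖ ≤ 3 := by
      rw [Complex.norm_exp]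
      exact (Real.exp_le_exp.mpr hw).trans (by linarith [Real.exp_one_lt_d9])
    have := norm_sub_le (Complex.exp w) 1
    rw [norm_one] at this
    linarith

lemma linePt_mul_self_re {v : ℝ} (hv : 0 < v) (t : ℝ) : (linePt v t * v).re = 1 := by
  rw [Complex.re_mul_ofReal, linePt_re, one_div, inv_mul_cancel₀ hv.ne']

lemma re_mollifier_le {l v : ℝ} (hl : 0 < l) (hl1 : l ≤ 1) (hv : 4 < v) (t : ℝ) :
    ((l : ℂ) ^ 2 * linePt v t ^ 2 / 2).re ≤ 1 := by
  have h := norm_exp_line_le hl hl1 hv t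
  rw [Complex.norm_exp, ← Real.exp_add, Real.exp_le_exp, Complex.add_re,
    linePt_mul_self_re (by linarith)] at h
  have : 0 ≤ l ^ 2 * t ^ 2 := by positivity
  linarith

/-- The leading term of the mollified inverse Laplace transform of `s ^ (-β) V(s)`. -/
lemma hankelInt_neg_sub_le {c : ℝ} {m : ℕ} (hm : c + 1 ≤ m) {V : ℂ → ℂ} (hV : Tempered c V)
    {V₀ : ℂ} (h0 : Tendsto (fun x : ℝ => V x) (𝓝[>] 0) (𝓝 V₀)) {β : ℝ} (hβ : 3 < β) :
    ∃ C : ℝ, 0 ≤ C ∧ ∀ l v : ℝ, 0 < l → l ≤ 1 → 4 < v →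
      ‖hankelInt (-β) V l v - V₀ * ((2 * Real.pi * v ^ (β - 1) / Real.Gamma β : ℝ) : ℂ)‖
        ≤ C * hankelSize (β - 2) (1 - β) m l v := by
  obtain ⟨B, hB, HB⟩ := hV.norm_sub_le hm h0
  obtain ⟨C₁, hC₁, H₁⟩ := exists_integral_bound (1 - β) m
  obtain ⟨C₂, hC₂, H₂⟩ := hankelInt_bound hm (-β) hV
  set A := ∫ u : ℝ, (1 + u ^ 2) ^ (-(β - 2) / 2) with hA
  have hA0 : 0 ≤ A := integral_nonneg fun u => by positivity
  refine ⟨B * Real.exp 2 * C₁ + ‖V₀‖ * (2 * Real.exp 1 * A), by positivity,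
    fun l v hl hl1 hv => ?_⟩
  have hv0 : 0 < v := by linarith
  -- The integrand splits as f₁ + V₀(f₂ + f₃). In f₁ the difference V - V₀ = O(|s|) saves a power of
  -- v, f₂ is Hankel's integral, and f₃ carries the mollifier minus 1, which is O(|s|²).
  -- Integrability of f₃ is what requires β > 3.
  set f₁ : ℝ → ℂ := hankelIntegrand (-β) (fun s => V s - V₀) l v with hf₁
  set f₂ : ℝ → ℂ := fun t => linePt v t ^ ((-β : ℝ) : ℂ) * Complex.exp (linePt v t * v) with hf₂
  set f₃ : ℝ → ℂ := fun t => linePt v t ^ ((-β : ℝ) : ℂ) *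
    (Complex.exp (l ^ 2 * linePt v t ^ 2 / 2) - 1) * Complex.exp (linePt v t * v) with hf₃
  have hVd : DifferentiableOn ℂ (fun s => V s - V₀) strip := hV.differentiableOn.sub_const _
  have hi₁ := H₁ l v (B * Real.exp 2) f₁ hl hl1 hv (by positivity)
    (continuous_hankelIntegrand hVd hv).aestronglyMeasurable (fun t => by
      have hs0 : 0 < ‖linePt v t‖ := norm_pos_iff.mpr (linePt_ne_zero hv0 t)
      simp only [hf₁, hankelIntegrand]
      rw [norm_mul, norm_mul, norm_linePt_cpow hv]
      have h1 := HB _ (linePt_mem_strip hv t)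
      rw [linePt_im] at h1
      have h2 := norm_exp_line_le hl hl1 hv t
      calc _ ≤ ‖linePt v t‖ ^ (-β) * (B * ‖linePt v t‖ * (|t| + 2) ^ m) *
            (Real.exp 2 * Real.exp (-(l ^ 2 * t ^ 2 / 2))) := by gcongr
        _ = B * Real.exp 2 * ((‖linePt v t‖ ^ (-β) * ‖linePt v t‖) * (|t| + 2) ^ m *
            Real.exp (-(l ^ 2 * t ^ 2 / 2))) := by ring
        _ = _ := by rw [← Real.rpow_add_one hs0.ne', neg_add_eq_sub])
  have hc₂ : Continuous f₂ := by
    have := continuous_linePt_cpow hv (-β)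
    have := continuous_linePt v
    fun_prop
  have hc₃ : Continuous f₃ := by
    have := continuous_linePt_cpow hv (-β)
    have := continuous_linePt v
    fun_prop
  have hexp : ∀ t, ‖Complex.exp (linePt v t * v)‖ = Real.exp 1 := fun t => by
    rw [Complex.norm_exp, linePt_mul_self_re hv0]
  have hi₂ : Integrable f₂ := by
    refine ((integrable_norm_linePt hv0 (by linarith : 1 < β)).mul_const (Real.exp 1)).mono'
      hc₂.aestronglyMeasurable (Eventually.of_forall fun t => le_of_eq ?_)
    rw [hf₂, norm_mul, norm_linePt_cpow hv, hexp]
  have hle₃ : ∀ t, ‖f₃ t‖ ≤ 2 * Real.exp 1 * ‖linePt v t‖ ^ (-(β - 2)) := by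
    intro t
    have hs0 : 0 < ‖linePt v t‖ := norm_pos_iff.mpr (linePt_ne_zero hv0 t)
    rw [hf₃, norm_mul, norm_mul, norm_linePt_cpow hv, hexp]
    have h1 := norm_exp_sub_one_le_four (re_mollifier_le hl hl1 hv t)
    have h2 : ‖(l : ℂ) ^ 2 * linePt v t ^ 2 / 2‖ ≤ ‖linePt v t‖ ^ 2 / 2 := by
      rw [norm_div, norm_mul, norm_pow, norm_pow, Complex.norm_real, Real.norm_of_nonneg hl.le]
      simp only [Complex.norm_ofNat]
      gcongr
      exact mul_le_of_le_one_left (by positivity) (by rwa [sq_le_one_iff₀ hl.le])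
    have h3 : ‖linePt v t‖ ^ (-(β - 2)) = ‖linePt v t‖ ^ (-β) * ‖linePt v t‖ ^ 2 := by
      rw [← Real.rpow_natCast ‖linePt v t‖ 2, ← Real.rpow_add hs0]; congr 1; push_cast; ring
    rw [h3]
    calc _ ≤ ‖linePt v t‖ ^ (-β) * (4 * (‖linePt v t‖ ^ 2 / 2)) * Real.exp 1 := by
          gcongr; exact h1.trans (by gcongr)
      _ = _ := by ring
  have hint₃ := (integrable_norm_linePt hv0 (by linarith : 1 < β - 2)).const_mul (2 * Real.exp 1)
  have hi₃ : Integrable f₃ := hint₃.mono' hc₃.aestronglyMeasurable (Eventually.of_forall hle₃)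
  have hb₃ : ‖∫ t, f₃ t‖ ≤ 2 * Real.exp 1 * A * hankelSize (β - 2) (1 - β) m l v := by
    refine (norm_integral_le_of_norm_le hint₃ (Eventually.of_forall hle₃)).trans ?_
    rw [integral_const_mul, integral_norm_linePt hv0, ← hA, mul_comm _ A, ← mul_assoc]
    refine mul_le_mul_of_nonneg_left ?_ (by positivity)
    unfold hankelSize
    have h1 : v ^ (β - 2 - 1) ≤ v ^ max (β - 2) (1 / 2) :=
      Real.rpow_le_rpow_of_exponent_le (by linarith)
        (by linarith [le_max_left (β - 2) (1 / 2)])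
    have : 0 ≤ l ^ (-lossExp (1 - β) m) := by positivity
    linarith
  have heq : hankelInt (-β) V l v = (∫ t, f₁ t) + V₀ * ((∫ t, f₂ t) + ∫ t, f₃ t) := by
    have hi₄ : Integrable (fun t => V₀ * (f₂ t + f₃ t)) := (hi₂.add hi₃).const_mul V₀
    rw [← integral_add hi₂ hi₃, ← integral_const_mul, ← integral_add hi₁.1 hi₄]
    unfold hankelInt
    congr 1
    ext t
    simp only [hf₁, hf₂, hf₃, hankelIntegrand, Complex.exp_add]
    ring
  rw [heq, integral_linePt_cpow_mul_exp (by linarith) hv]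
  have h5 : ∀ X Y Z : ℂ, X + V₀ * (Y + Z) - V₀ * Y = X + V₀ * Z := fun X Y Z => by ring
  rw [h5]
  refine (norm_add_le _ _).trans ?_
  rw [add_mul, norm_mul, mul_assoc ‖V₀‖]
  have hi₁' := hi₁.2
  rw [show -(1 - β) - 1 = β - 2 by ring] at hi₁'
  exact add_le_add hi₁' (mul_le_mul_of_nonneg_left hb₃ (norm_nonneg _))

lemma Gamma_add_nat_eq_prod {x : ℝ} (hx : ∀ n : ℕ, x ≠ -n) (n : ℕ) :
    Real.Gamma (n + x) = (∏ j ∈ Finset.range n, ((j : ℝ) + x)) * Real.Gamma x := by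
  induction n with
  | zero => simp
  | succ n ih =>
    have : (n : ℝ) + x ≠ 0 := fun h => hx n (by linarith)
    rw [Finset.prod_range_succ, show ((n + 1 : ℕ) : ℝ) + x = (n + x) + 1 by push_cast; ring,
      Real.Gamma_add_one this, ih]
    ring

lemma rpow_neg_scale {v A q : ℝ} (hv : 4 < v) : (v ^ (-A)) ^ (-q) = v ^ (A * q) := by
  rw [← Real.rpow_mul (by linarith)]; congr 1; ring

/-- Asymptotics of the inverse Laplace transform of `s ^ α V(s)`, when `s ^ α` is not a
polynomial. -/
theorem hankelInt_asymptotic {c : ℝ} {V : ℂ → ℂ} (hV : Tempered c V) {V₀ : ℂ}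
    (h0 : Tendsto (fun x : ℝ => V x) (𝓝[>] 0) (𝓝 V₀)) {α : ℝ} (hα : ∀ n : ℕ, α ≠ n) {A : ℝ}
    (hA : 0 ≤ A) :
    ∃ C : ℝ, 0 ≤ C ∧ ∀ v : ℝ, 4 < v →
      ‖hankelInt α V (v ^ (-A)) v
        - V₀ * ((2 * Real.pi * v ^ (-α - 1) / Real.Gamma (-α) : ℝ) : ℂ)‖ ≤ C * v ^ (-α - 2) := by
  obtain ⟨m, hm⟩ := exists_nat_ge (c + 1)
  -- The first condition gives n - α > 3, as needed for the leading term. The second makes the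
  -- mollification loss l^(-lossExp) = v^(A·lossExp) at most v^(n-α-2).
  obtain ⟨n, hn⟩ := exists_nat_ge (max (α + 3 + 1) (max (α + 2 + A * lossExp α m) 1))
  have hn1 : α + 4 ≤ n := by linarith [le_max_left (α + 3 + 1) (max (α + 2 + A * lossExp α m) 1)]
  have hn2 : α + 2 + A * lossExp α m ≤ n :=
    (le_max_left _ _).trans ((le_max_right _ _).trans hn)
  have hn3 : (1 : ℝ) ≤ n := (le_max_right _ _).trans ((le_max_right _ _).trans hn)
  obtain ⟨C₁, hC₁, H₁⟩ := pow_mul_hankelInt_sub_le hm n α hV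
  obtain ⟨C₂, hC₂, H₂⟩ := hankelInt_neg_sub_le hm hV h0 (β := n - α) (by linarith)
  set P : ℝ := ∏ j ∈ Finset.range n, ((j : ℝ) - α) with hP
  refine ⟨2 * (C₁ + |P| * C₂), by positivity, fun v hv => ?_⟩
  have hv0 : 0 < v := by linarith
  have hv1 : 1 ≤ v := by linarith
  have hl : 0 < v ^ (-A) := by positivity
  have hl1 : v ^ (-A) ≤ 1 := Real.rpow_le_one_of_one_le_of_nonpos hv1 (by linarith)
  have hsize : hankelSize (n - α - 2) α m (v ^ (-A)) v ≤ 2 * v ^ (n - α - 2) := by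
    unfold hankelSize
    rw [rpow_neg_scale hv, max_eq_left (by linarith)]
    have : v ^ (A * lossExp α m) ≤ v ^ (n - α - 2) :=
      Real.rpow_le_rpow_of_exponent_le hv1 (by linarith)
    linarith
  have hsize' : hankelSize (n - α - 2) (1 - (n - α)) m (v ^ (-A)) v ≤ 2 * v ^ (n - α - 2) :=
    (hankelSize_mono hl hl1 hv le_rfl (by linarith)).trans hsize
  have h1 := (H₁ _ v hl hl1 hv).trans (mul_le_mul_of_nonneg_left hsize hC₁)
  have h2 := (H₂ _ v hl hl1 hv).trans (mul_le_mul_of_nonneg_left hsize' hC₂)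
  -- The product left by the integrations by parts is exactly Γ(n-α)/Γ(-α), so the Gamma factor of
  -- Hankel's formula becomes Γ(-α).
  have hG : Real.Gamma (n - α) = P * Real.Gamma (-α) := by
    have := Gamma_add_nat_eq_prod (x := -α) (fun k h => hα k (by linarith)) n
    simpa only [hP, sub_eq_add_neg] using this
  have hG1 : 0 < Real.Gamma (n - α) := Real.Gamma_pos_of_pos (by linarith)
  have hP0 : P ≠ 0 := fun h => by rw [h, zero_mul] at hG; exact hG1.ne' hG
  have hG0 : Real.Gamma (-α) ≠ 0 := fun h => by rw [h, mul_zero] at hG; exact hG1.ne' hG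
  have hmain : P * (2 * Real.pi * v ^ ((n : ℝ) - α - 1) / Real.Gamma (n - α))
      = v ^ n * (2 * Real.pi * v ^ (-α - 1) / Real.Gamma (-α)) := by
    rw [hG, show (n : ℝ) - α - 1 = n + (-α - 1) by ring, Real.rpow_add hv0, Real.rpow_natCast]
    field_simp
  have hmainC : (P : ℂ) * (V₀ * ((2 * Real.pi * v ^ ((n : ℝ) - α - 1) / Real.Gamma (n - α) : ℝ) : ℂ))
      = (v : ℂ) ^ n * (V₀ * ((2 * Real.pi * v ^ (-α - 1) / Real.Gamma (-α) : ℝ) : ℂ)) := by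
    rw [mul_left_comm, ← Complex.ofReal_mul, hmain, mul_left_comm]
    push_cast
    ring
  have hkey : (v : ℂ) ^ n * (hankelInt α V (v ^ (-A)) v
        - V₀ * ((2 * Real.pi * v ^ (-α - 1) / Real.Gamma (-α) : ℝ) : ℂ))
      = ((v : ℂ) ^ n * hankelInt α V (v ^ (-A)) v - (P : ℂ) * hankelInt (α - n) V (v ^ (-A)) v)
        + P * (hankelInt (-(n - α)) V (v ^ (-A)) v
          - V₀ * ((2 * Real.pi * v ^ ((n : ℝ) - α - 1) / Real.Gamma (n - α) : ℝ) : ℂ)) := by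
    rw [mul_sub, ← hmainC, neg_sub]
    ring
  have hfin : v ^ n * ‖hankelInt α V (v ^ (-A)) v
        - V₀ * ((2 * Real.pi * v ^ (-α - 1) / Real.Gamma (-α) : ℝ) : ℂ)‖
      ≤ v ^ n * (2 * (C₁ + |P| * C₂) * v ^ (-α - 2)) := by
    have e : v ^ n * (2 * (C₁ + |P| * C₂) * v ^ (-α - 2))
        = C₁ * (2 * v ^ (n - α - 2)) + |P| * (C₂ * (2 * v ^ (n - α - 2))) := by
      rw [show (n : ℝ) - α - 2 = n + (-α - 2) by ring, Real.rpow_add hv0, Real.rpow_natCast]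
      ring
    have e2 : ∀ z : ℂ, ‖(v : ℂ) ^ n * z‖ = v ^ n * ‖z‖ := fun z => by
      rw [norm_mul, norm_pow, Complex.norm_real, Real.norm_of_nonneg hv0.le]
    rw [e, ← e2, hkey]
    refine (norm_add_le _ _).trans (add_le_add h1 ?_)
    rw [norm_mul, Complex.norm_real, Real.norm_eq_abs]
    exact mul_le_mul_of_nonneg_left h2 (abs_nonneg _)
  exact le_of_mul_le_mul_left hfin (by positivity)

/-- Rapid decay of the inverse Laplace transform of `s ^ a V(s)`, when `s ^ a` is a polynomial. -/
theorem hankelInt_natCast_decay {c : ℝ} {V : ℂ → ℂ} (hV : Tempered c V) (a : ℕ) {A : ℝ}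
    (hA : 0 ≤ A) (B : ℝ) :
    ∃ C : ℝ, 0 ≤ C ∧ ∀ v : ℝ, 4 < v → ‖hankelInt a V (v ^ (-A)) v‖ ≤ C * v ^ (-B) := by
  obtain ⟨m, hm⟩ := exists_nat_ge (c + 1)
  -- After n integrations by parts the bound is v^(-n) times v^(1/2) + v^(A·lossExp); this n brings
  -- it below v^(-B).
  obtain ⟨n, hn⟩ := exists_nat_ge (B + max (1 / 2) (A * lossExp a m))
  obtain ⟨C, hC, H⟩ := pow_mul_norm_hankelInt_natCast_le hm n a hV
  refine ⟨2 * C, by positivity, fun v hv => ?_⟩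
  have hv0 : 0 < v := by linarith
  have hv1 : 1 ≤ v := by linarith
  have hl : 0 < v ^ (-A) := by positivity
  have hl1 : v ^ (-A) ≤ 1 := Real.rpow_le_one_of_one_le_of_nonpos hv1 (by linarith)
  have hsize : hankelSize 0 a m (v ^ (-A)) v ≤ 2 * (v ^ n * v ^ (-B)) := by
    unfold hankelSize
    rw [rpow_neg_scale hv, max_eq_right (by norm_num : (0 : ℝ) ≤ 1 / 2), ← Real.rpow_natCast,
      ← Real.rpow_add hv0]
    have h1 : v ^ (A * lossExp a m) ≤ v ^ (n + -B) :=
      Real.rpow_le_rpow_of_exponent_le hv1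
        (by linarith [le_max_right (1 / 2) (A * lossExp a m)])
    have h2 : v ^ (1 / 2 : ℝ) ≤ v ^ (n + -B) :=
      Real.rpow_le_rpow_of_exponent_le hv1
        (by linarith [le_max_left (1 / 2) (A * lossExp a m)])
    linarith
  have h := (H _ v hl hl1 hv).trans (mul_le_mul_of_nonneg_left hsize hC)
  refine le_of_mul_le_mul_left (h.trans (le_of_eq ?_)) (pow_pos hv0 n)
  ring

end ArithSeq

/-! ### The harmonic kernel and its limit 1/2. -/

namespace ArithSeq

local notation "γ₀" => Real.eulerMascheroniConstant

/-- The error in the approximation of the harmonic sum up to `u` by `log u + γ`. -/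
noncomputable def harmErr (u : ℝ) : ℝ := (harmonic ⌊u⌋₊ : ℝ) - Real.log u - γ₀

/-- The oscillating part of `∑_{m ≤ y} (y / m - 1)`, as a function of `x = log y`. -/
noncomputable def kern (x : ℝ) : ℝ :=
  Real.exp x * harmonic ⌊Real.exp x⌋₊ - ⌊Real.exp x⌋₊ - Real.exp x * (x + γ₀ - 1)

lemma gamma_pos : 0 < γ₀ := lt_trans (by norm_num) Real.one_half_lt_eulerMascheroniConstant

lemma gamma_lt_one : γ₀ < 1 := lt_trans Real.eulerMascheroniConstant_lt_two_thirds (by norm_num)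

lemma harmonic_succ_real (n : ℕ) : (harmonic (n + 1) : ℝ) = harmonic n + 1 / ((n : ℝ) + 1) := by
  rw [harmonic_succ]; push_cast; rw [one_div]

lemma harmonic_sub_log_add_one_lt (n : ℕ) : (harmonic n : ℝ) - Real.log (n + 1) < γ₀ :=
  Real.eulerMascheroniSeq_lt_eulerMascheroniConstant n

lemma lt_harmonic_sub_log {n : ℕ} (hn : 1 ≤ n) : γ₀ < (harmonic n : ℝ) - Real.log n := by
  have := Real.eulerMascheroniConstant_lt_eulerMascheroniSeq' n
  rwa [Real.eulerMascheroniSeq', if_neg (by omega)] at this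

lemma abs_harmErr_le_of_one_le {u : ℝ} (hu : 1 ≤ u) : |harmErr u| ≤ 2 / u := by
  have hn : 1 ≤ ⌊u⌋₊ := Nat.one_le_floor_iff _ |>.mpr hu
  set n := ⌊u⌋₊ with hnd
  have hn0 : (1 : ℝ) ≤ n := by exact_mod_cast hn
  have h1 := harmonic_sub_log_add_one_lt n
  have h2 := lt_harmonic_sub_log hn
  have hlo : (n : ℝ) ≤ u := Nat.floor_le (by linarith)
  have hhi : u < n + 1 := Nat.lt_floor_add_one u
  have l1 : Real.log n ≤ Real.log u := Real.log_le_log (by linarith) hlo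
  have l2 : Real.log u ≤ Real.log (n + 1) := Real.log_le_log (by linarith) hhi.le
  have l3 : Real.log (n + 1) - Real.log n ≤ 1 / n := by
    rw [← Real.log_div (by linarith) (by linarith)]
    refine (Real.log_le_sub_one_of_pos (by positivity)).trans (le_of_eq ?_)
    field_simp; ring
  have l4 : 1 / (n : ℝ) ≤ 2 / u := by
    rw [div_le_div_iff₀ (by linarith) (by linarith)]; linarith
  unfold harmErr
  rw [← hnd, abs_le]
  constructor <;> linarith

lemma harmErr_of_lt_one {u : ℝ} (hu : u < 1) : harmErr u = -(Real.log u + γ₀) := by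
  unfold harmErr
  rw [Nat.floor_eq_zero.mpr hu]
  simp; ring

/-- The function `∑_{m ≤ y} (y / m - 1)` is continuous. -/
lemma continuous_ramp : Continuous (fun x : ℝ =>
    Real.exp x * harmonic ⌊Real.exp x⌋₊ - (⌊Real.exp x⌋₊ : ℝ)) := by
  -- For y < N the function is a fixed finite sum of the ramps max(y/m - 1, 0): each new term enters
  -- with value zero, so the jumps of floor and harmonic sum cancel.
  have key : ∀ (N : ℕ) (y : ℝ), 0 ≤ y → y < N → y * harmonic ⌊y⌋₊ - (⌊y⌋₊ : ℝ)
      = ∑ i ∈ Finset.range N, max (y / (i + 1) - 1) 0 := by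
    intro N y hy hyN
    have hle : ⌊y⌋₊ ≤ N := Nat.floor_le_of_le hyN.le
    rw [← Finset.sum_range_add_sum_Ico _ hle]
    have h2 : ∑ i ∈ Finset.Ico ⌊y⌋₊ N, max (y / ((i : ℝ) + 1) - 1) 0 = 0 := by
      refine Finset.sum_eq_zero fun i hi => max_eq_right ?_
      have h3 : ⌊y⌋₊ ≤ i := (Finset.mem_Ico.mp hi).1
      have h4 : y < (i : ℝ) + 1 := (Nat.lt_floor_add_one y).trans_le (by exact_mod_cast Nat.succ_le_succ h3)
      have : y / ((i : ℝ) + 1) ≤ 1 := by rw [div_le_one (by positivity)]; exact h4.le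
      linarith
    have h1 : ∑ i ∈ Finset.range ⌊y⌋₊, max (y / ((i : ℝ) + 1) - 1) 0
        = ∑ i ∈ Finset.range ⌊y⌋₊, (y * (((i : ℝ) + 1))⁻¹ - 1) := by
      refine Finset.sum_congr rfl fun i hi => ?_
      rw [max_eq_left, div_eq_mul_inv]
      have h3 : i + 1 ≤ ⌊y⌋₊ := Finset.mem_range.mp hi
      have h4 : ((i : ℝ) + 1) ≤ y := by
        have := (Nat.le_floor_iff hy).mp h3
        exact_mod_cast this
      have : 1 ≤ y / ((i : ℝ) + 1) := by rwa [le_div_iff₀ (by positivity), one_mul]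
      linarith
    rw [h1, h2, Finset.sum_sub_distrib, ← Finset.mul_sum]
    simp [harmonic]
  rw [continuous_iff_continuousAt]
  intro x
  obtain ⟨N, hN⟩ := exists_nat_gt (Real.exp x)
  have hev : ∀ᶠ z in 𝓝 x, Real.exp z < N :=
    Real.continuous_exp.continuousAt.eventually_lt continuousAt_const hN
  have hc : Continuous (fun z : ℝ => ∑ i ∈ Finset.range N, max (Real.exp z / (i + 1) - 1) 0) := by
    refine continuous_finsetSum _ fun i _ => ?_
    exact ((Real.continuous_exp.div_const _).sub continuous_const).max continuous_const
  refine hc.continuousAt.congr ?_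
  filter_upwards [hev] with z hz
  exact (key N _ (Real.exp_pos z).le hz).symm

lemma continuous_kern : Continuous kern := by
  unfold kern
  exact continuous_ramp.sub (by fun_prop)

/-- The floor is constant immediately to the right of x. The kernel has kinks at logarithms of
integers, but it is continuous, so a right derivative suffices for the mean value inequality in
`abs_kern_sub_le`. -/
lemma hasDerivWithinAt_kern (x : ℝ) :
    HasDerivWithinAt kern (Real.exp x * harmErr (Real.exp x)) (Ici x) x := by
  set n := ⌊Real.exp x⌋₊ with hn
  have h1 : HasDerivAt (fun z : ℝ => Real.exp z * (harmonic n : ℝ) - n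
      - Real.exp z * (z + γ₀ - 1)) (Real.exp x * harmErr (Real.exp x)) x := by
    have := (((Real.hasDerivAt_exp x).mul_const (harmonic n : ℝ)).sub_const (n : ℝ)).sub
      ((Real.hasDerivAt_exp x).mul (((hasDerivAt_id x).add_const γ₀).sub_const 1))
    refine this.congr_deriv ?_
    simp only [harmErr, Real.log_exp, id, ← hn]
    ring
  refine h1.hasDerivWithinAt.congr_of_eventuallyEq ?_ (by simp only [kern, hn])
  have hlt : Real.exp x < n + 1 := Nat.lt_floor_add_one _
  have hev : ∀ᶠ z in 𝓝 x, Real.exp z < n + 1 :=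
    Real.continuous_exp.continuousAt.eventually_lt continuousAt_const hlt
  filter_upwards [mem_nhdsWithin_of_mem_nhds hev, self_mem_nhdsWithin] with z hz hz2
  have : ⌊Real.exp z⌋₊ = n := by
    rw [Nat.floor_eq_iff (Real.exp_pos z).le]
    exact ⟨(Nat.floor_le (Real.exp_pos x).le).trans (Real.exp_le_exp.mpr hz2), hz⟩
  simp only [kern, this]

lemma exp_mul_one_sub_le {x : ℝ} : Real.exp x * (1 - x) ≤ 4 * Real.exp (x / 2) := by
  have h : 1 - x ≤ 4 * Real.exp (-(x / 2)) := by
    have h1 := Real.add_one_le_exp (-(x / 2))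
    have h2 := Real.exp_pos (-(x / 2))
    rcases le_total x 1 with hx | hx <;> linarith
  calc Real.exp x * (1 - x) ≤ Real.exp x * (4 * Real.exp (-(x / 2))) := by gcongr
    _ = 4 * (Real.exp x * Real.exp (-(x / 2))) := by ring
    _ = _ := by rw [← Real.exp_add]; congr 2; ring

/-- The quantity is bounded for x ≥ 0 and O(e^(x/2)) for x < 0, so every rate σ in [0, 1/2] works on
both sides. This freedom matches the weights d^(-σ) of the Dirichlet series later on. -/
lemma abs_kern_deriv_le {σ : ℝ} (h0 : 0 ≤ σ) (h1 : σ ≤ 1 / 2) (x : ℝ) :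
    |Real.exp x * harmErr (Real.exp x)| ≤ 4 * Real.exp (σ * x) := by
  rw [abs_mul, abs_of_pos (Real.exp_pos x)]
  rcases le_or_gt 0 x with hx | hx
  · have h2 := abs_harmErr_le_of_one_le (Real.one_le_exp hx)
    have h3 : 1 ≤ Real.exp (σ * x) := Real.one_le_exp (by positivity)
    calc Real.exp x * |harmErr (Real.exp x)| ≤ Real.exp x * (2 / Real.exp x) := by gcongr
      _ = 2 := by field_simp
      _ ≤ _ := by linarith
  · rw [harmErr_of_lt_one (Real.exp_lt_one_iff.mpr hx), Real.log_exp, abs_neg]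
    have h2 : |x + γ₀| ≤ 1 - x := by
      have := gamma_pos; have := gamma_lt_one
      rw [abs_le]; constructor <;> linarith
    calc Real.exp x * |x + γ₀| ≤ Real.exp x * (1 - x) := by gcongr
      _ ≤ 4 * Real.exp (x / 2) := exp_mul_one_sub_le
      _ ≤ _ := by gcongr; nlinarith

lemma abs_kern_sub_le {σ : ℝ} (h0 : 0 ≤ σ) (h1 : σ ≤ 1 / 2) {x y : ℝ} (hxy : x ≤ y) :
    |kern y - kern x| ≤ 4 * Real.exp (σ * y) * (y - x) := by
  refine norm_image_sub_le_of_norm_deriv_right_le_segment (f := kern)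
    (f' := fun x => Real.exp x * harmErr (Real.exp x)) (a := x) (b := y)
    continuous_kern.continuousOn (fun z _ => hasDerivWithinAt_kern z) (fun z hz => ?_) y
    ⟨hxy, le_rfl⟩
  refine (abs_kern_deriv_le h0 h1 z).trans ?_
  have := hz.2
  gcongr

lemma kern_of_neg {x : ℝ} (hx : x < 0) : kern x = -(Real.exp x * (x + γ₀ - 1)) := by
  unfold kern
  rw [Nat.floor_eq_zero.mpr (Real.exp_lt_one_iff.mpr hx)]
  simp

lemma abs_kern_of_neg {x : ℝ} (hx : x < 0) : |kern x| ≤ 4 * Real.exp (x / 2) := by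
  rw [kern_of_neg hx, abs_neg, abs_mul, abs_of_pos (Real.exp_pos x)]
  have h2 : |x + γ₀ - 1| ≤ 1 - x := by
    have := gamma_pos; have := gamma_lt_one
    rw [abs_le]; constructor <;> linarith
  exact (mul_le_mul_of_nonneg_left h2 (Real.exp_pos x).le).trans exp_mul_one_sub_le

lemma two_mul_log_le {t : ℝ} (ht : 1 ≤ t) : 2 * Real.log t ≤ t - t⁻¹ := by
  have := Real.self_le_sinh_iff.mpr (Real.log_nonneg ht)
  rw [Real.sinh_log (by linarith)] at this
  linarith

/-- `H_n ≤ log n + γ + 1 / (2n)`. -/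
lemma harmonic_le_log_add {n : ℕ} (hn : 1 ≤ n) :
    (harmonic n : ℝ) ≤ Real.log n + γ₀ + 1 / (2 * n) := by
  -- H_n - log n - 1/(2n) increases to γ; the increment is nonnegative by 2 log t ≤ t - 1/t at t =
  -- (k+2)/(k+1).
  have hmono : Monotone (fun k : ℕ => (harmonic (k + 1) : ℝ) - Real.log ((k + 1 : ℕ) : ℝ)
      - 1 / (2 * ((k + 1 : ℕ) : ℝ))) := by
    refine monotone_nat_of_le_succ fun k => ?_
    have hk : (0 : ℝ) < (k : ℝ) + 1 := by positivity
    have h1 := two_mul_log_le (t := ((k : ℝ) + 1 + 1) / (k + 1))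
      (by rw [le_div_iff₀ hk]; linarith)
    rw [Real.log_div (by positivity) (by positivity)] at h1
    have h2 := harmonic_succ_real (k + 1)
    push_cast at h2 ⊢
    rw [h2]
    have h3 : ((k : ℝ) + 1 + 1) / (k + 1) - (((k : ℝ) + 1 + 1) / (k + 1))⁻¹
        = 2 * (1 / (2 * ((k : ℝ) + 1)) + 1 / ((k : ℝ) + 1 + 1) - 1 / (2 * ((k : ℝ) + 1 + 1))) := by
      field_simp; ring
    linarith
  have ht : Tendsto (fun k : ℕ => (harmonic (k + 1) : ℝ) - Real.log ((k + 1 : ℕ) : ℝ)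
      - 1 / (2 * ((k + 1 : ℕ) : ℝ))) atTop (𝓝 (γ₀ - 0)) := by
    have h1 := Real.tendsto_harmonic_sub_log.sub
      ((tendsto_one_div_atTop_nhds_zero_nat (𝕜 := ℝ)).const_mul (1 / 2))
    have h2 := (tendsto_add_atTop_iff_nat 1).mpr h1
    simp only [mul_zero] at h2
    refine h2.congr fun k => ?_
    congr 1
    field_simp
  have := hmono.ge_of_tendsto ht (n - 1)
  rw [sub_zero] at this
  simp only [Nat.sub_add_cancel hn] at this
  linarith

/-- `log (n + 1/2) + γ ≤ H_n`. -/
lemma log_add_half_le_harmonic (n : ℕ) :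
    Real.log (n + 1 / 2) + γ₀ ≤ (harmonic n : ℝ) := by
  -- H_k - log(k + 1/2) decreases to γ, because log(1 + x) ≥ 2x/(x + 2) at x = 1/(k + 1/2) gives
  -- exactly 1/(k+1).
  have hanti : Antitone (fun k : ℕ => (harmonic k : ℝ) - Real.log ((k : ℝ) + 1 / 2)) := by
    refine antitone_nat_of_succ_le fun k => ?_
    have hk : (0 : ℝ) < (k : ℝ) + 1 / 2 := by positivity
    have h1 := Real.le_log_one_add_of_nonneg (x := 1 / ((k : ℝ) + 1 / 2)) (by positivity)
    have h2 : 1 + 1 / ((k : ℝ) + 1 / 2) = ((k : ℝ) + 1 + 1 / 2) / (k + 1 / 2) := by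
      field_simp; ring
    have h3 : 2 * (1 / ((k : ℝ) + 1 / 2)) / (1 / ((k : ℝ) + 1 / 2) + 2) = 1 / ((k : ℝ) + 1) := by
      field_simp; ring
    rw [h2, h3, Real.log_div (by positivity) (by positivity)] at h1
    rw [harmonic_succ_real]
    push_cast
    linarith
  have ht : Tendsto (fun k : ℕ => (harmonic k : ℝ) - Real.log ((k : ℝ) + 1 / 2)) atTop (𝓝 γ₀) := by
    refine tendsto_of_tendsto_of_tendsto_of_le_of_le' Real.tendsto_harmonic_sub_log_add_one
      Real.tendsto_harmonic_sub_log ?_ ?_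
    · filter_upwards with k
      have : Real.log ((k : ℝ) + 1 / 2) ≤ Real.log (k + 1) :=
        Real.log_le_log (by positivity) (by linarith)
      linarith
    · filter_upwards [eventually_ge_atTop 1] with k hk
      have hk' : (1 : ℝ) ≤ k := by exact_mod_cast hk
      have : Real.log k ≤ Real.log ((k : ℝ) + 1 / 2) :=
        Real.log_le_log (by positivity) (by linarith)
      linarith
  have := hanti.le_of_tendsto ht n
  linarith

/-- Write y = e^x = N + θ with N the integer part. To first order H_N - log y - γ is 1/(2N) - θ/N,
so the kernel is y(1/(2N) - θ/N) + θ = 1/2 + O(1/y). The rate is then weakened to e^(-x/2) to match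
the decay on the negative axis. -/
lemma abs_kern_sub_half_le {x : ℝ} (hx : 0 ≤ x) : |kern x - 1 / 2| ≤ 10 * Real.exp (-(x / 2)) := by
  set y := Real.exp x with hy
  have hy1 : 1 ≤ y := Real.one_le_exp hx
  have hn : 1 ≤ ⌊y⌋₊ := Nat.one_le_floor_iff _ |>.mpr hy1
  have hfl : (⌊y⌋₊ : ℝ) ≤ y := Nat.floor_le (by linarith)
  have hfl2 : y < ⌊y⌋₊ + 1 := Nat.lt_floor_add_one y
  have hxl : x = Real.log y := (Real.log_exp x).symm
  have hk : kern x = y * harmonic ⌊y⌋₊ - ⌊y⌋₊ - y * (x + γ₀ - 1) := rfl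
  set n := ⌊y⌋₊ with hnd
  have hN : (1 : ℝ) ≤ n := by exact_mod_cast hn
  set N : ℝ := (n : ℝ) with hNd
  set θ := y - N with hθ
  have hθ0 : 0 ≤ θ := by linarith
  have hθ1 : θ ≤ 1 := by linarith
  have hyN : y = N + θ := by rw [hθ]; ring
  have u1 := harmonic_le_log_add hn
  have u2 := log_add_half_le_harmonic n
  rw [← hNd] at u1 u2
  have u3 : Real.log N + 2 / (1 + 4 * N) ≤ Real.log (N + 1 / 2) := by
    have h1 := Real.le_log_one_add_of_nonneg (x := 1 / (2 * N)) (by positivity)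
    have h2 : 1 + 1 / (2 * N) = (N + 1 / 2) / N := by field_simp
    have h3 : 2 * (1 / (2 * N)) / (1 / (2 * N) + 2) = 2 / (1 + 4 * N) := by field_simp; try ring
    rw [h2, h3, Real.log_div (by positivity) (by positivity)] at h1
    linarith
  have h4 : 1 + θ / N = y / N := by rw [hyN]; field_simp
  have u4 : Real.log y - Real.log N ≤ θ / N := by
    rw [← Real.log_div (by linarith) (by linarith), ← h4]
    have := Real.log_le_sub_one_of_pos (x := 1 + θ / N) (by positivity)
    linarith
  have u5 : 2 * θ / (θ + 2 * N) ≤ Real.log y - Real.log N := by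
    rw [← Real.log_div (by linarith) (by linarith), ← h4]
    have := Real.le_log_one_add_of_nonneg (x := θ / N) (by positivity)
    refine le_trans (le_of_eq ?_) this
    field_simp
  have up : kern x - 1 / 2 ≤ 10 / y := by
    rw [hk]
    have e1 : y * harmonic n - N - y * (x + γ₀ - 1) - 1 / 2
        ≤ y * (1 / (2 * N) - 2 * θ / (θ + 2 * N)) + θ - 1 / 2 := by
      have : (harmonic n : ℝ) - x - γ₀ ≤ 1 / (2 * N) - 2 * θ / (θ + 2 * N) := by
        rw [hxl]; linarith
      have := mul_le_mul_of_nonneg_left this (by linarith : 0 ≤ y)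
      nlinarith
    refine e1.trans ?_
    have e2 : y * (1 / (2 * N) - 2 * θ / (θ + 2 * N)) + θ - 1 / 2
        = θ / (2 * N) - θ ^ 2 / (θ + 2 * N) := by
      rw [hyN]; field_simp; ring
    rw [e2]
    have e3 : θ / (2 * N) ≤ 10 / y := by
      rw [div_le_div_iff₀ (by positivity) (by positivity)]
      nlinarith
    have e4 : 0 ≤ θ ^ 2 / (θ + 2 * N) := by positivity
    linarith
  have lo : -(10 / y) ≤ kern x - 1 / 2 := by
    rw [hk]
    have e1 : y * (2 / (1 + 4 * N) - θ / N) + θ - 1 / 2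
        ≤ y * harmonic n - N - y * (x + γ₀ - 1) - 1 / 2 := by
      have : 2 / (1 + 4 * N) - θ / N ≤ (harmonic n : ℝ) - x - γ₀ := by
        rw [hxl]; linarith
      have := mul_le_mul_of_nonneg_left this (by linarith : 0 ≤ y)
      nlinarith
    refine le_trans ?_ e1
    have e2 : y * (2 / (1 + 4 * N) - θ / N) + θ - 1 / 2
        = (2 * θ - 1 / 2) / (1 + 4 * N) - θ ^ 2 / N := by
      rw [hyN]; field_simp; ring
    have e3 : -(1 / (2 * N)) ≤ (2 * θ - 1 / 2) / (1 + 4 * N) := by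
      rw [neg_le, ← neg_div, div_le_div_iff₀ (by positivity) (by positivity)]
      nlinarith
    have e4 : θ ^ 2 / N ≤ 1 / N := by
      gcongr
      exact pow_le_one₀ hθ0 hθ1
    have e5 : 1 / (2 * N) + 1 / N ≤ 10 / y := by
      have : 1 / (2 * N) + 1 / N = 3 / (2 * N) := by field_simp; ring
      rw [this, div_le_div_iff₀ (by positivity) (by positivity)]
      linarith
    rw [e2]
    linarith
  have hfin : 10 / y ≤ 10 * Real.exp (-(x / 2)) := by
    rw [hy, div_eq_mul_inv, ← Real.exp_neg]
    gcongr
    linarith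
  rw [abs_le]
  constructor <;> linarith

lemma abs_kern_le {σ : ℝ} (h0 : 0 ≤ σ) (h1 : σ ≤ 1 / 2) (x : ℝ) :
    |kern x| ≤ 11 * Real.exp (σ * x) := by
  rcases le_or_gt 0 x with hx | hx
  · have h2 := abs_kern_sub_half_le hx
    have h3 : Real.exp (-(x / 2)) ≤ 1 := Real.exp_le_one_iff.mpr (by linarith)
    have h4 : 1 ≤ Real.exp (σ * x) := Real.one_le_exp (by positivity)
    rw [abs_le] at h2 ⊢
    constructor <;> linarith
  · refine (abs_kern_of_neg hx).trans ?_
    have : Real.exp (x / 2) ≤ Real.exp (σ * x) := Real.exp_le_exp.mpr (by nlinarith)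
    linarith [Real.exp_pos (σ * x)]

end ArithSeq

/-! ### The Laplace transform of the kernel. -/

namespace ArithSeq

/-- The kernel minus its limit `1 / 2` at infinity. -/
noncomputable def kernRem (x : ℝ) : ℝ := kern x - if 0 ≤ x then 1 / 2 else 0

lemma abs_kernRem_le (x : ℝ) : |kernRem x| ≤ 10 * Real.exp (-(|x| / 2)) := by
  unfold kernRem
  rcases le_or_gt 0 x with hx | hx
  · rw [if_pos hx, abs_of_nonneg hx]
    exact abs_kern_sub_half_le hx
  · rw [if_neg (not_le.mpr hx), sub_zero, abs_of_neg hx, neg_div, neg_neg]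
    exact (abs_kern_of_neg hx).trans (by linarith [Real.exp_pos (x / 2)])

lemma measurable_kernRem : Measurable kernRem :=
  continuous_kern.measurable.sub (Measurable.ite measurableSet_Ici measurable_const measurable_const)

lemma integrable_exp_neg_mul_abs {a : ℝ} (ha : 0 < a) :
    Integrable (fun x : ℝ => Real.exp (-(a * |x|))) := by
  rw [← integrableOn_univ, ← Iic_union_Ioi (a := (0 : ℝ))]
  refine IntegrableOn.union ?_ ?_
  · have := integrableOn_exp_mul_Iic (a := a) ha 0
    refine this.congr_fun (fun x hx => ?_) measurableSet_Iic
    simp only [abs_of_nonpos (show x ≤ 0 from hx)]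
    congr 1; ring
  · have := integrableOn_exp_mul_Ioi (a := -a) (by linarith) 0
    refine this.congr_fun (fun x hx => ?_) measurableSet_Ioi
    simp only [abs_of_pos (show 0 < x from hx)]
    congr 1; ring

lemma kernRem_mul_exp_le {σ : ℝ} (h : |σ| ≤ 3 / 8) (x : ℝ) :
    |kernRem x| * Real.exp (-(σ * x)) ≤ 10 * Real.exp (-(1 / 8 * |x|)) := by
  have h1 : -(σ * x) ≤ 3 / 8 * |x| := by
    have := neg_abs_le (σ * x)
    rw [abs_mul] at this
    have := mul_le_mul_of_nonneg_right h (abs_nonneg x)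
    linarith
  calc |kernRem x| * Real.exp (-(σ * x))
      ≤ 10 * Real.exp (-(|x| / 2)) * Real.exp (3 / 8 * |x|) := by
        have := abs_kernRem_le x
        gcongr
    _ = 10 * Real.exp (-(1 / 8 * |x|)) := by
        rw [mul_assoc, ← Real.exp_add]; congr 2; ring

lemma integrable_kernRem_mul_exp {σ : ℝ} (h : |σ| ≤ 3 / 8) :
    Integrable (fun x => ‖(kernRem x : ℂ)‖ * Real.exp (-(σ * x))) := by
  simp only [Complex.norm_real, Real.norm_eq_abs]
  refine ((integrable_exp_neg_mul_abs (a := 1 / 8) (by norm_num)).const_mul 10).mono' ?_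
    (Eventually.of_forall fun x => ?_)
  · have := measurable_kernRem
    exact (by fun_prop : Measurable fun x => |kernRem x| * Real.exp (-(σ * x))).aestronglyMeasurable
  · rw [Real.norm_of_nonneg (by positivity)]
    exact kernRem_mul_exp_le h x

/-- The Laplace transform of `kernRem`. -/
noncomputable def kernRemLaplace (s : ℂ) : ℂ := ∫ x : ℝ, (kernRem x : ℂ) * Complex.exp (-(s * x))

lemma norm_cexp_neg_mul (s : ℂ) (x : ℝ) : ‖Complex.exp (-(s * x))‖ = Real.exp (-(s.re * x)) := by
  rw [Complex.norm_exp]; simp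

/-- `kernRem` decays like e^(-|x|/2) on both sides, so its transform is holomorphic and bounded for
|Re s| < 3/8. This is a neighbourhood of the closed strip, and Cauchy's estimates handle the
derivatives. -/
lemma tempered_kernRemLaplace : Tempered 0 kernRemLaplace := by
  refine tempered_of_wide_strip (r := 1 / 8) (by norm_num) ?_ ?_
  · refine (differentiableOn_laplace (a := -(3 / 8)) (b := 3 / 8)
      (Complex.measurable_ofReal.comp measurable_kernRem).aestronglyMeasurable ?_).mono ?_
    · intro σ hσ
      exact integrable_kernRem_mul_exp (abs_le.mpr ⟨hσ.1.le, hσ.2.le⟩)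
    · intro s hs
      exact ⟨by linarith [hs.1], by linarith [hs.2]⟩
  · intro ε hε
    set C := ∫ x : ℝ, 10 * Real.exp (-(1 / 8 * |x|)) with hC
    have hC0 : 0 ≤ C := integral_nonneg fun x => by positivity
    refine ⟨C, hC0, fun s h1 h2 => ?_⟩
    have hσ : |s.re| ≤ 3 / 8 := abs_le.mpr ⟨by linarith, by linarith⟩
    have : ‖kernRemLaplace s‖ ≤ C := by
      refine norm_integral_le_of_norm_le
        ((integrable_exp_neg_mul_abs (a := 1 / 8) (by norm_num)).const_mul 10)
        (Eventually.of_forall fun x => ?_)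
      rw [norm_mul, norm_cexp_neg_mul, Complex.norm_real, Real.norm_eq_abs]
      exact kernRem_mul_exp_le hσ x
    exact this.trans (le_mul_of_one_le_right hC0
      (Real.one_le_rpow (one_le_abs_add_two _) (by linarith)))

/-- The Laplace transform of the kernel, multiplied by `s`. -/
noncomputable def kernFactor (s : ℂ) : ℂ := 1 / 2 + s * kernRemLaplace s

lemma tempered_id : Tempered 1 (fun s => s) := by
  refine tempered_of_wide_strip (r := 1) one_pos differentiableOn_id fun ε hε => ⟨1, zero_le_one,
    fun s h1 h2 => ?_⟩
  have h3 := Complex.norm_le_abs_re_add_abs_im s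
  have h4 : |s.re| ≤ 2 := abs_le.mpr ⟨by linarith, by linarith⟩
  rw [one_mul]
  calc ‖s‖ ≤ (|s.im| + 2) ^ (1 : ℝ) := by rw [Real.rpow_one]; linarith
    _ ≤ _ := Real.rpow_le_rpow_of_exponent_le (one_le_abs_add_two _) (by linarith)

lemma tempered_kernFactor : Tempered 1 kernFactor := by
  have h1 := tempered_id.mul tempered_kernRemLaplace
  rw [add_zero] at h1
  exact ((tempered_const (1 / 2)).mono zero_le_one).add h1

/-- This value, the limit of the kernel at infinity, is the factor 1/2 in `muAverage`. -/
lemma tendsto_kernFactor : Tendsto (fun x : ℝ => kernFactor x) (𝓝[>] 0) (𝓝 (1 / 2)) := by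
  obtain ⟨C, hC, H⟩ := tempered_kernRemLaplace.exists_bound (m := 1) (by norm_num)
  have h1 : Tendsto (fun x : ℝ => (x : ℂ) * kernRemLaplace x) (𝓝[>] 0) (𝓝 0) := by
    rw [tendsto_zero_iff_norm_tendsto_zero]
    have h2 : Tendsto (fun x : ℝ => x * (C * 2)) (𝓝[>] 0) (𝓝 0) := by
      have : Continuous (fun x : ℝ => x * (C * 2)) := by fun_prop
      exact (this.tendsto' 0 0 (by simp)).mono_left nhdsWithin_le_nhds
    refine squeeze_zero' (Eventually.of_forall fun x => norm_nonneg _) ?_ h2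
    filter_upwards [Ioo_mem_nhdsGT (show (0 : ℝ) < 1 / 4 by norm_num)] with x hx
    have h3 := H x ⟨by simpa using hx.1, by simpa using hx.2⟩
    simp only [Complex.ofReal_im, abs_zero, zero_add, pow_one] at h3
    rw [norm_mul, Complex.norm_real, Real.norm_of_nonneg hx.1.le]
    have := hx.1
    gcongr
  simpa [kernFactor] using h1.const_add (1 / 2 : ℂ)

lemma integrable_kern_mul_exp {σ : ℝ} (h0 : 0 < σ) (h1 : σ < 1 / 2) :
    Integrable (fun x => |kern x| * Real.exp (-(σ * x))) := by
  set τ := min (σ / 2) ((1 / 2 - σ) / 2) with hτ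
  have hτ0 : 0 < τ := lt_min (by linarith) (by linarith)
  have hτ1 : τ ≤ σ / 2 := min_le_left _ _
  have hτ2 : τ ≤ (1 / 2 - σ) / 2 := min_le_right _ _
  refine ((integrable_exp_neg_mul_abs hτ0).const_mul 11).mono' ?_ (Eventually.of_forall fun x => ?_)
  · have := continuous_kern
    exact (by fun_prop : Continuous fun x => |kern x| * Real.exp (-(σ * x))).aestronglyMeasurable
  · rw [Real.norm_of_nonneg (by positivity)]
    have key : ∀ ρ : ℝ, 0 ≤ ρ → ρ ≤ 1 / 2 → (ρ - σ) * x ≤ -(τ * |x|) →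
        |kern x| * Real.exp (-(σ * x)) ≤ 11 * Real.exp (-(τ * |x|)) := by
      intro ρ h2 h3 h4
      calc |kern x| * Real.exp (-(σ * x)) ≤ 11 * Real.exp (ρ * x) * Real.exp (-(σ * x)) := by
            have := abs_kern_le h2 h3 x
            gcongr
        _ = 11 * Real.exp ((ρ - σ) * x) := by rw [mul_assoc, ← Real.exp_add]; congr 2; ring
        _ ≤ _ := by gcongr
    rcases le_total 0 x with hx | hx
    · refine key (σ - τ) (by linarith) (by linarith) (le_of_eq ?_)
      rw [abs_of_nonneg hx]; ring
    · refine key (σ + τ) (by linarith) (by linarith) (le_of_eq ?_)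
      rw [abs_of_nonpos hx]; ring

lemma laplace_kern {s : ℂ} (h0 : 0 < s.re) (h1 : s.re ≤ 3 / 8) :
    ∫ x : ℝ, (kern x : ℂ) * Complex.exp (-(s * x)) = kernFactor s / s := by
  have hs : s ≠ 0 := fun h => by rw [h] at h0; simp at h0
  have i1 : Integrable (fun x : ℝ => (kernRem x : ℂ) * Complex.exp (-(s * x))) := by
    refine (integrable_kernRem_mul_exp (σ := s.re)
      (abs_le.mpr ⟨by linarith, h1⟩)).mono' ?_ (Eventually.of_forall fun x => ?_)
    · have := Complex.measurable_ofReal.comp measurable_kernRem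
      exact (this.mul (by fun_prop : Measurable
        fun x : ℝ => Complex.exp (-(s * x)))).aestronglyMeasurable
    · rw [norm_mul, norm_cexp_neg_mul]
  have i2' : IntegrableOn (fun x : ℝ => (1 / 2 : ℂ) * Complex.exp (-s * x)) (Ioi 0) :=
    (integrableOn_exp_mul_complex_Ioi (a := -s) (by simpa using h0) 0).const_mul _
  have i2'' : IntegrableOn (fun x : ℝ => (1 / 2 : ℂ) * Complex.exp (-s * x)) (Ici 0) := by
    rwa [integrableOn_Ici_iff_integrableOn_Ioi]
  have hind : ∀ x : ℝ, (((if 0 ≤ x then 1 / 2 else 0 : ℝ)) : ℂ) * Complex.exp (-(s * x))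
      = (Ici (0 : ℝ)).indicator (fun x : ℝ => (1 / 2 : ℂ) * Complex.exp (-s * x)) x := by
    intro x
    by_cases hx : 0 ≤ x
    · rw [indicator_of_mem (show x ∈ Ici (0 : ℝ) from hx), if_pos hx]; push_cast; rw [neg_mul]
    · rw [indicator_of_notMem (show x ∉ Ici (0 : ℝ) from hx), if_neg hx]; simp
  have i2 : Integrable (fun x : ℝ => (((if 0 ≤ x then 1 / 2 else 0 : ℝ)) : ℂ)
      * Complex.exp (-(s * x))) := by
    simp_rw [hind]
    rwa [integrable_indicator_iff measurableSet_Ici]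
  have v2 : ∫ x : ℝ, (((if 0 ≤ x then 1 / 2 else 0 : ℝ)) : ℂ) * Complex.exp (-(s * x))
      = 1 / 2 * (1 / s) := by
    simp_rw [hind]
    rw [integral_indicator measurableSet_Ici, integral_Ici_eq_integral_Ioi, integral_const_mul,
      integral_exp_mul_complex_Ioi (by simpa using h0)]
    simp
  have hsplit : ∀ x : ℝ, (kern x : ℂ) * Complex.exp (-(s * x))
      = (((if 0 ≤ x then 1 / 2 else 0 : ℝ)) : ℂ) * Complex.exp (-(s * x))
        + (kernRem x : ℂ) * Complex.exp (-(s * x)) := by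
    intro x
    unfold kernRem
    push_cast
    ring
  simp_rw [hsplit]
  rw [integral_add i2 i1, v2]
  unfold kernFactor kernRemLaplace
  field_simp

end ArithSeq

/-! ### The oscillating sum: Lipschitz bounds and Laplace transform. -/

namespace ArithSeq

/-- The Dirichlet series of `|b|` at `σ` is at most `C₀ σ ^ (-C₁)` for `0 < σ ≤ 1 / 4`. -/
structure SumBound (b : ℕ → ℝ) (C₀ C₁ : ℝ) : Prop where
  zero : b 0 = 0
  nonneg : 0 ≤ C₀
  summable : ∀ σ : ℝ, 0 < σ → σ ≤ 1 / 4 → Summable (fun d : ℕ => |b d| * (d : ℝ) ^ (-σ))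
  le : ∀ σ : ℝ, 0 < σ → σ ≤ 1 / 4 → ∑' d : ℕ, |b d| * (d : ℝ) ^ (-σ) ≤ C₀ * σ ^ (-C₁)

/-- The sum of the kernel against the coefficients `b`. -/
noncomputable def oscSum (b : ℕ → ℝ) (v : ℝ) : ℝ := ∑' d : ℕ, b d * kern (v - Real.log d)

/-- The Dirichlet series of `b`. -/
noncomputable def dirSeries (b : ℕ → ℝ) (s : ℂ) : ℂ := ∑' d : ℕ, (b d : ℂ) * (d : ℂ) ^ (-s)

variable {b : ℕ → ℝ} {C₀ C₁ : ℝ}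

namespace SumBound

lemma exp_mul_sub_log {d : ℕ} (hd : d ≠ 0) (σ v : ℝ) :
    Real.exp (σ * (v - Real.log d)) = Real.exp (σ * v) * (d : ℝ) ^ (-σ) := by
  rw [Real.rpow_def_of_pos (by positivity), ← Real.exp_add]
  congr 1; ring

lemma abs_term_le (hb : SumBound b C₀ C₁) {σ : ℝ} (h0 : 0 < σ) (h1 : σ ≤ 1 / 4) (v : ℝ) (d : ℕ) :
    |b d * kern (v - Real.log d)| ≤ 11 * Real.exp (σ * v) * (|b d| * (d : ℝ) ^ (-σ)) := by
  rcases eq_or_ne d 0 with rfl | hd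
  · simp [hb.zero]
  · rw [abs_mul]
    have := abs_kern_le h0.le (by linarith) (v - Real.log d)
    rw [exp_mul_sub_log hd] at this
    calc |b d| * |kern (v - Real.log d)|
        ≤ |b d| * (11 * (Real.exp (σ * v) * (d : ℝ) ^ (-σ))) := by gcongr
      _ = _ := by ring

lemma summable_term (hb : SumBound b C₀ C₁) (v : ℝ) :
    Summable (fun d : ℕ => b d * kern (v - Real.log d)) :=
  Summable.of_norm_bounded ((hb.summable (1 / 4) (by norm_num) le_rfl).mul_left
    (11 * Real.exp (1 / 4 * v))) fun d => hb.abs_term_le (by norm_num) le_rfl v d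

lemma abs_oscSum_le (hb : SumBound b C₀ C₁) {σ : ℝ} (h0 : 0 < σ) (h1 : σ ≤ 1 / 4) (v : ℝ) :
    |oscSum b v| ≤ 11 * Real.exp (σ * v) * (C₀ * σ ^ (-C₁)) := by
  have hs := (hb.summable σ h0 h1).mul_left (11 * Real.exp (σ * v))
  have := tsum_of_norm_bounded (f := fun d : ℕ => b d * kern (v - Real.log d)) hs.hasSum
    fun d => hb.abs_term_le h0 h1 v d
  rw [tsum_mul_left] at this
  exact this.trans (mul_le_mul_of_nonneg_left (hb.le σ h0 h1) (by positivity))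

lemma abs_oscSum_sub_le (hb : SumBound b C₀ C₁) {σ : ℝ} (h0 : 0 < σ) (h1 : σ ≤ 1 / 4) {v w : ℝ}
    (hvw : v ≤ w) :
    |oscSum b w - oscSum b v| ≤ 4 * Real.exp (σ * w) * (w - v) * (C₀ * σ ^ (-C₁)) := by
  unfold oscSum
  rw [← (hb.summable_term w).tsum_sub (hb.summable_term v)]
  have hs := (hb.summable σ h0 h1).mul_left (4 * Real.exp (σ * w) * (w - v))
  have := tsum_of_norm_bounded (f := fun d : ℕ => b d * kern (w - Real.log d)
    - b d * kern (v - Real.log d)) hs.hasSum fun d => ?_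
  · rw [tsum_mul_left] at this
    refine this.trans (mul_le_mul_of_nonneg_left (hb.le σ h0 h1) ?_)
    have : 0 ≤ w - v := by linarith
    positivity
  · rcases eq_or_ne d 0 with rfl | hd
    · simp [hb.zero]
    · rw [← mul_sub, Real.norm_eq_abs, abs_mul]
      have := abs_kern_sub_le h0.le (by linarith)
        (show v - Real.log d ≤ w - Real.log d by linarith)
      rw [exp_mul_sub_log hd, show w - Real.log d - (v - Real.log d) = w - v by ring] at this
      calc |b d| * |kern (w - Real.log d) - kern (v - Real.log d)|
          ≤ |b d| * (4 * (Real.exp (σ * w) * (d : ℝ) ^ (-σ)) * (w - v)) := by gcongr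
        _ = _ := by ring

lemma continuous_oscSum (hb : SumBound b C₀ C₁) : Continuous (oscSum b) := by
  rw [continuous_iff_continuousAt]
  intro v
  set M := 4 * Real.exp (1 / 4 * (v + 1)) * (C₀ * (1 / 4 : ℝ) ^ (-C₁)) with hM
  have hM0 : 0 ≤ M := by have := hb.nonneg; positivity
  have key : ∀ x y : ℝ, x ≤ y → y ≤ v + 1 → |oscSum b y - oscSum b x| ≤ M * (y - x) := by
    intro x y hxy hy
    refine (hb.abs_oscSum_sub_le (by norm_num) le_rfl hxy).trans ?_
    have h1 : Real.exp (1 / 4 * y) ≤ Real.exp (1 / 4 * (v + 1)) := by gcongr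
    have h2 : 0 ≤ y - x := by linarith
    have h3 : 0 ≤ C₀ * (1 / 4 : ℝ) ^ (-C₁) := by have := hb.nonneg; positivity
    calc 4 * Real.exp (1 / 4 * y) * (y - x) * (C₀ * (1 / 4 : ℝ) ^ (-C₁))
        ≤ 4 * Real.exp (1 / 4 * (v + 1)) * (y - x) * (C₀ * (1 / 4 : ℝ) ^ (-C₁)) := by gcongr
      _ = _ := by rw [hM]; ring
  rw [ContinuousAt, tendsto_iff_norm_sub_tendsto_zero]
  have ht : Tendsto (fun x : ℝ => M * |x - v|) (𝓝 v) (𝓝 0) := by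
    have : Continuous (fun x : ℝ => M * |x - v|) := by fun_prop
    exact this.tendsto' v 0 (by simp)
  refine squeeze_zero' (Eventually.of_forall fun _ => norm_nonneg _) ?_ ht
  filter_upwards [Iio_mem_nhds (show v < v + 1 by linarith)] with x hx
  rw [Real.norm_eq_abs]
  rcases le_total v x with h | h
  · rw [abs_of_nonneg (by linarith : 0 ≤ x - v)]
    exact key v x h (le_of_lt hx)
  · rw [abs_sub_comm, abs_sub_comm x v, abs_of_nonneg (by linarith : 0 ≤ v - x)]
    exact key x v h (by linarith)

lemma integrable_oscSum_mul_exp (hb : SumBound b C₀ C₁) {σ : ℝ} (h0 : 0 < σ) (h1 : σ < 1 / 4) :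
    Integrable (fun u => |oscSum b u| * Real.exp (-(σ * u))) := by
  set τ := min (σ / 2) ((1 / 4 - σ) / 2) with hτ
  have hτ0 : 0 < τ := lt_min (by linarith) (by linarith)
  have hτ1 : τ ≤ σ / 2 := min_le_left _ _
  have hτ2 : τ ≤ (1 / 4 - σ) / 2 := min_le_right _ _
  set B := C₀ * (σ - τ) ^ (-C₁) + C₀ * (σ + τ) ^ (-C₁) with hB
  have hn1 : 0 ≤ C₀ * (σ - τ) ^ (-C₁) :=
    mul_nonneg hb.nonneg (Real.rpow_nonneg (by linarith) _)
  have hn2 : 0 ≤ C₀ * (σ + τ) ^ (-C₁) :=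
    mul_nonneg hb.nonneg (Real.rpow_nonneg (by linarith) _)
  refine ((integrable_exp_neg_mul_abs hτ0).const_mul (11 * B)).mono' ?_
    (Eventually.of_forall fun x => ?_)
  · have := hb.continuous_oscSum
    exact (by fun_prop : Continuous
      fun u => |oscSum b u| * Real.exp (-(σ * u))).aestronglyMeasurable
  · rw [Real.norm_of_nonneg (by positivity)]
    have key : ∀ ρ : ℝ, 0 < ρ → ρ ≤ 1 / 4 → C₀ * ρ ^ (-C₁) ≤ B → (ρ - σ) * x = -(τ * |x|) →
        |oscSum b x| * Real.exp (-(σ * x)) ≤ 11 * B * Real.exp (-(τ * |x|)) := by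
      intro ρ h2 h3 hB' h4
      calc |oscSum b x| * Real.exp (-(σ * x))
          ≤ 11 * Real.exp (ρ * x) * (C₀ * ρ ^ (-C₁)) * Real.exp (-(σ * x)) := by
            have := hb.abs_oscSum_le h2 h3 x
            gcongr
        _ ≤ 11 * Real.exp (ρ * x) * B * Real.exp (-(σ * x)) := by gcongr
        _ = 11 * B * (Real.exp (ρ * x) * Real.exp (-(σ * x))) := by ring
        _ = 11 * B * Real.exp (-(τ * |x|)) := by rw [← Real.exp_add, ← h4]; congr 2; ring
    rcases le_total 0 x with hx | hx
    · refine key (σ - τ) (by linarith) (by linarith) (by linarith) ?_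
      rw [abs_of_nonneg hx]; ring
    · refine key (σ + τ) (by linarith) (by linarith) (by linarith) ?_
      rw [abs_of_nonpos hx]; ring

/-- Translating the kernel by log d multiplies its transform by d^(-s). Sum and integral may be
exchanged because ∑ |b d| d^(-Re s) converges. -/
lemma laplace_oscSum (hb : SumBound b C₀ C₁) {s : ℂ} (hs : s ∈ strip) :
    ∫ u : ℝ, (oscSum b u : ℂ) * Complex.exp (-(s * u)) = dirSeries b s * (kernFactor s / s) := by
  set F : ℕ → ℝ → ℂ := fun d u => (b d : ℂ) * (kern (u - Real.log d) : ℂ)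
    * Complex.exp (-(s * u)) with hF
  have hcpow : ∀ d : ℕ, d ≠ 0 → (d : ℂ) ^ (-s) = Complex.exp (-(s * Real.log d)) := by
    intro d hd
    rw [Complex.cpow_def_of_ne_zero (by exact_mod_cast hd), Complex.ofReal_log (by positivity)]
    congr 1; push_cast; ring
  have hshift : ∀ (d : ℕ) (u : ℝ), F d u = (b d : ℂ) * Complex.exp (-(s * Real.log d)) *
      ((fun x : ℝ => (kern x : ℂ) * Complex.exp (-(s * x))) (u - Real.log d)) := by
    intro d u
    simp only [hF]
    have : Complex.exp (-(s * u)) = Complex.exp (-(s * Real.log d))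
        * Complex.exp (-(s * ((u - Real.log d : ℝ) : ℂ))) := by
      rw [← Complex.exp_add]; congr 1; push_cast; ring
    rw [this]; ring
  have hk : Integrable (fun x : ℝ => (kern x : ℂ) * Complex.exp (-(s * x))) := by
    refine (integrable_kern_mul_exp hs.1 (by linarith [hs.2])).mono' ?_
      (Eventually.of_forall fun x => ?_)
    · have := continuous_kern
      exact (by fun_prop : Continuous
        fun x : ℝ => (kern x : ℂ) * Complex.exp (-(s * x))).aestronglyMeasurable
    · rw [norm_mul, norm_cexp_neg_mul, Complex.norm_real, Real.norm_eq_abs]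
  have hFint : ∀ d, Integrable (F d) := by
    intro d
    have := (hk.comp_sub_right (Real.log d)).const_mul
      ((b d : ℂ) * Complex.exp (-(s * Real.log d)))
    exact this.congr (Eventually.of_forall fun u => (hshift d u).symm)
  have hnormF : ∀ d : ℕ, ∫ u, ‖F d u‖ = |b d| * (d : ℝ) ^ (-s.re) *
      ∫ x : ℝ, ‖(kern x : ℂ) * Complex.exp (-(s * x))‖ := by
    intro d
    rcases eq_or_ne d 0 with rfl | hd
    · simp [hF, hb.zero]
    · simp_rw [hshift, norm_mul (_ * _) ((fun x : ℝ => (kern x : ℂ) * Complex.exp (-(s * x))) _)]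
      rw [integral_const_mul, integral_sub_right_eq_self
        (fun x : ℝ => ‖(kern x : ℂ) * Complex.exp (-(s * x))‖), norm_mul, Complex.norm_real,
        norm_cexp_neg_mul, Real.rpow_def_of_pos (by positivity), Real.norm_eq_abs]
      congr 3; ring
  have hsum : Summable (fun d => ∫ u, ‖F d u‖) := by
    simp_rw [hnormF]
    exact (hb.summable s.re hs.1 hs.2.le).mul_right _
  have h := hasSum_integral_of_summable_integral_norm hFint hsum
  have hleft : ∀ u : ℝ, ∑' d, F d u = (oscSum b u : ℂ) * Complex.exp (-(s * u)) := by
    intro u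
    simp only [hF]
    rw [tsum_mul_right]
    congr 1
    unfold oscSum
    rw [Complex.ofReal_tsum]
    simp
  have hval : ∀ d : ℕ, ∫ u, F d u = (b d : ℂ) * (d : ℂ) ^ (-s) * (kernFactor s / s) := by
    intro d
    rcases eq_or_ne d 0 with rfl | hd
    · simp [hF, hb.zero]
    · simp_rw [hshift]
      rw [integral_const_mul, integral_sub_right_eq_self
        (fun x : ℝ => (kern x : ℂ) * Complex.exp (-(s * x))), laplace_kern hs.1
        (by linarith [hs.2]), hcpow d hd]
  simp_rw [hleft, hval] at h
  rw [← h.tsum_eq, tsum_mul_right]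
  rfl

end SumBound

/-! ### Gaussian mollification and inversion. -/

/-- The Gaussian mollifier obtained by inverting the Laplace transform. -/
lemma integral_gaussian_line {l v : ℝ} (hl : 0 < l) (x : ℝ) :
    ∫ t : ℝ, Complex.exp (l ^ 2 * linePt v t ^ 2 / 2 + linePt v t * x)
      = ((Real.sqrt (2 * Real.pi) / l * Real.exp (-(x ^ 2 / (2 * l ^ 2))) : ℝ) : ℂ) := by
  have hlc : (l : ℂ) ≠ 0 := by exact_mod_cast hl.ne'
  obtain ⟨σ, hσ⟩ : ∃ σ : ℝ, σ = 1 / v := ⟨_, rfl⟩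
  have hb : ((-(l ^ 2 / 2) : ℝ) : ℂ).re < 0 := by
    rw [Complex.ofReal_re]
    have : 0 < l ^ 2 := by positivity
    linarith
  have h := integral_cexp_quadratic hb (Complex.I * ((l ^ 2 * σ + x : ℝ) : ℂ))
    ((l ^ 2 * σ ^ 2 / 2 + σ * x : ℝ) : ℂ)
  have h1 : ∀ t : ℝ, Complex.exp (l ^ 2 * linePt v t ^ 2 / 2 + linePt v t * x)
      = Complex.exp (((-(l ^ 2 / 2) : ℝ) : ℂ) * t ^ 2
        + Complex.I * ((l ^ 2 * σ + x : ℝ) : ℂ) * t + ((l ^ 2 * σ ^ 2 / 2 + σ * x : ℝ) : ℂ)) := by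
    intro t
    congr 1
    simp only [linePt, ← hσ]
    push_cast
    ring_nf
    rw [Complex.I_sq]
    ring
  simp_rw [h1]
  rw [h]
  have h2 : ((Real.pi : ℂ) / -((-(l ^ 2 / 2) : ℝ) : ℂ)) ^ (1 / 2 : ℂ)
      = ((Real.sqrt (2 * Real.pi) / l : ℝ) : ℂ) := by
    have e1 : (Real.pi : ℂ) / -((-(l ^ 2 / 2) : ℝ) : ℂ) = ((2 * Real.pi / l ^ 2 : ℝ) : ℂ) := by
      push_cast; field_simp
    rw [e1, show (1 / 2 : ℂ) = ((1 / 2 : ℝ) : ℂ) by push_cast; rfl,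
      ← Complex.ofReal_cpow (by positivity), ← Real.sqrt_eq_rpow, Real.sqrt_div (by positivity),
      Real.sqrt_sq hl.le]
  rw [h2]
  have h3 : ((l ^ 2 * σ ^ 2 / 2 + σ * x : ℝ) : ℂ)
      - (Complex.I * ((l ^ 2 * σ + x : ℝ) : ℂ)) ^ 2 / (4 * ((-(l ^ 2 / 2) : ℝ) : ℂ))
      = ((-(x ^ 2 / (2 * l ^ 2)) : ℝ) : ℂ) := by
    rw [mul_pow, Complex.I_sq]
    push_cast
    field_simp
    ring
  rw [h3]
  push_cast
  rfl

lemma integral_gaussian_mollifier {l : ℝ} (hl : 0 < l) :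
    ∫ y : ℝ, Real.sqrt (2 * Real.pi) / l * Real.exp (-(y ^ 2 / (2 * l ^ 2))) = 2 * Real.pi := by
  have h := integral_gaussian (1 / (2 * l ^ 2))
  have h1 : ∀ y : ℝ, Real.exp (-(y ^ 2 / (2 * l ^ 2))) = Real.exp (-(1 / (2 * l ^ 2)) * y ^ 2) := by
    intro y; congr 1; ring
  rw [integral_const_mul]
  simp_rw [h1]
  rw [h, show Real.pi / (1 / (2 * l ^ 2)) = 2 * Real.pi * l ^ 2 by field_simp,
    Real.sqrt_mul (show 0 ≤ 2 * Real.pi by positivity) (l ^ 2), Real.sqrt_sq hl.le]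
  have := Real.mul_self_sqrt (show 0 ≤ 2 * Real.pi by positivity)
  field_simp
  linarith

lemma integrable_gaussian_mollifier {l : ℝ} (hl : 0 < l) :
    Integrable (fun y : ℝ => Real.sqrt (2 * Real.pi) / l * Real.exp (-(y ^ 2 / (2 * l ^ 2)))) := by
  refine Integrable.const_mul ?_ _
  have := integrable_exp_neg_mul_sq (b := 1 / (2 * l ^ 2)) (by positivity)
  refine this.congr (Eventually.of_forall fun y => ?_)
  simp only
  congr 1; ring

/-- The first absolute moment of the mollifier, with an exponential weight, is `O(l)`. -/
lemma exists_gaussian_moment_le : ∃ C : ℝ, 0 ≤ C ∧ ∀ l : ℝ, 0 < l → l ≤ 1 →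
    Integrable (fun y : ℝ => |y| * Real.exp |y| *
      (Real.sqrt (2 * Real.pi) / l * Real.exp (-(y ^ 2 / (2 * l ^ 2))))) ∧
    ∫ y : ℝ, |y| * Real.exp |y| *
      (Real.sqrt (2 * Real.pi) / l * Real.exp (-(y ^ 2 / (2 * l ^ 2)))) ≤ C * l := by
  set g : ℝ → ℝ := fun z => Real.sqrt (2 * Real.pi) * Real.exp 4 * Real.exp (-(1 / 4) * z ^ 2) with hg
  have hgi : Integrable g := (integrable_exp_neg_mul_sq (by norm_num)).const_mul _
  refine ⟨∫ z, g z, integral_nonneg fun z => by positivity, fun l hl hl1 => ?_⟩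
  have hle : ∀ y : ℝ, |y| * Real.exp |y| *
      (Real.sqrt (2 * Real.pi) / l * Real.exp (-(y ^ 2 / (2 * l ^ 2)))) ≤ g (y / l) := by
    intro y
    set z := y / l with hz
    have hy : y = l * z := by rw [hz]; field_simp
    have h1 : |y| = l * |z| := by rw [hy, abs_mul, abs_of_pos hl]
    have h2 : y ^ 2 / (2 * l ^ 2) = z ^ 2 / 2 := by rw [hy]; field_simp
    rw [h2, h1]
    have h3 : |z| ≤ Real.exp |z| := by linarith [Real.add_one_le_exp |z|]
    have h4 : Real.exp (l * |z|) ≤ Real.exp |z| :=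
      Real.exp_le_exp.mpr (mul_le_of_le_one_left (abs_nonneg z) hl1)
    calc l * |z| * Real.exp (l * |z|) * (Real.sqrt (2 * Real.pi) / l * Real.exp (-(z ^ 2 / 2)))
        = Real.sqrt (2 * Real.pi) * (|z| * Real.exp (l * |z|) * Real.exp (-(z ^ 2 / 2))) := by
          field_simp
      _ ≤ Real.sqrt (2 * Real.pi) * (Real.exp |z| * Real.exp |z| * Real.exp (-(z ^ 2 / 2))) := by
          gcongr
      _ = Real.sqrt (2 * Real.pi) * Real.exp (|z| + |z| + -(z ^ 2 / 2)) := by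
          rw [Real.exp_add, Real.exp_add]
      _ ≤ Real.sqrt (2 * Real.pi) * Real.exp (4 + -(1 / 4) * z ^ 2) := by
          refine mul_le_mul_of_nonneg_left (Real.exp_le_exp.mpr ?_) (Real.sqrt_nonneg _)
          nlinarith [sq_nonneg (|z| - 4), sq_abs z]
      _ = _ := by rw [Real.exp_add, hg]; ring
  have hgil : Integrable (fun y => g (y / l)) := hgi.comp_div hl.ne'
  have hint : Integrable (fun y : ℝ => |y| * Real.exp |y| *
      (Real.sqrt (2 * Real.pi) / l * Real.exp (-(y ^ 2 / (2 * l ^ 2))))) := by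
    refine hgil.mono' ?_ (Eventually.of_forall fun y => ?_)
    · exact (by fun_prop : Continuous fun y : ℝ => |y| * Real.exp |y| *
        (Real.sqrt (2 * Real.pi) / l * Real.exp (-(y ^ 2 / (2 * l ^ 2))))).aestronglyMeasurable
    · rw [Real.norm_of_nonneg (by positivity)]
      exact hle y
  refine ⟨hint, (integral_mono hint hgil hle).trans (le_of_eq ?_)⟩
  rw [Measure.integral_comp_div, abs_of_pos hl, smul_eq_mul, mul_comm]

/-- The sum `oscSum` is, up to the effect of mollification, the inverse Laplace transform of its
Laplace transform. -/
theorem SumBound.norm_hankelInt_sub_le (hb : SumBound b C₀ C₁) {α : ℝ} {V : ℂ → ℂ}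
    (hV : ∀ s ∈ strip, dirSeries b s * (kernFactor s / s) = s ^ (α : ℂ) * V s) :
    ∃ C : ℝ, 0 ≤ C ∧ ∀ l v : ℝ, 0 < l → l ≤ 1 → 4 < v →
      ‖hankelInt α V l v - ((2 * Real.pi * oscSum b v : ℝ) : ℂ)‖ ≤ C * l * v ^ C₁ := by
  obtain ⟨C, hC, H⟩ := exists_gaussian_moment_le
  refine ⟨4 * Real.exp 1 * C₀ * C, by have := hb.nonneg; positivity, fun l v hl hl1 hv => ?_⟩
  have hv0 : 0 < v := by linarith
  have hσ0 : 0 < 1 / v := by positivity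
  have hσ1 : 1 / v < 1 / 4 := one_div_lt_one_div_of_lt (by norm_num) hv
  set φ : ℝ → ℝ := fun y => Real.sqrt (2 * Real.pi) / l * Real.exp (-(y ^ 2 / (2 * l ^ 2))) with hφ
  have hWc := hb.continuous_oscSum
  -- Fubini for this double integral: integrating over u first gives the Laplace transform on the
  -- line, integrating over t first gives a Gaussian of width l centred at v.
  set G : ℝ → ℝ → ℂ := fun t u => (oscSum b u : ℂ) * Complex.exp (-(linePt v t * u)) *
    Complex.exp (l ^ 2 * linePt v t ^ 2 / 2 + linePt v t * v) with hG
  have hlin : Continuous (fun p : ℝ × ℝ => linePt v p.1) := (continuous_linePt v).comp continuous_fst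
  have hGc : Continuous (Function.uncurry G) := by
    simp only [hG, Function.uncurry_def]
    fun_prop
  have hGi : Integrable (Function.uncurry G) (volume.prod volume) := by
    have h1 : Integrable (fun t : ℝ => Real.exp 2 * Real.exp (-(l ^ 2 * t ^ 2 / 2))) := by
      refine Integrable.const_mul ?_ _
      refine (integrable_exp_neg_mul_sq (b := l ^ 2 / 2) (by positivity)).congr
        (Eventually.of_forall fun y => ?_)
      simp only
      congr 1; ring
    refine (h1.mul_prod (hb.integrable_oscSum_mul_exp hσ0 hσ1)).mono' hGc.aestronglyMeasurable
      (Eventually.of_forall fun p => ?_)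
    simp only [hG, Function.uncurry_def]
    rw [norm_mul, norm_mul, norm_cexp_neg_mul, linePt_re, Complex.norm_real, Real.norm_eq_abs,
      mul_comm]
    exact mul_le_mul_of_nonneg_right (norm_exp_line_le hl hl1 hv p.1) (by positivity)
  have hswap := integral_integral_swap hGi
  have hL : ∫ t, ∫ u, G t u = hankelInt α V l v := by
    unfold hankelInt
    congr 1
    ext t
    simp only [hG]
    rw [integral_mul_const, hb.laplace_oscSum (linePt_mem_strip hv t),
      hV _ (linePt_mem_strip hv t)]
    rfl
  have hR : ∀ u, ∫ t, G t u = ((oscSum b u * φ (v - u) : ℝ) : ℂ) := by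
    intro u
    have : ∀ t, G t u = (oscSum b u : ℂ) * Complex.exp (l ^ 2 * linePt v t ^ 2 / 2
        + linePt v t * ((v - u : ℝ) : ℂ)) := by
      intro t
      simp only [hG]
      rw [mul_assoc, ← Complex.exp_add]
      congr 2
      push_cast; ring
    simp_rw [this]
    rw [integral_const_mul, integral_gaussian_line hl]
    simp only [hφ]
    push_cast
    ring
  rw [hL] at hswap
  simp_rw [hR] at hswap
  rw [integral_complex_ofReal] at hswap
  have hWφ : Integrable (fun u => oscSum b u * φ (v - u)) := by
    have := hGi.integral_prod_right
    simp only [Function.uncurry_def] at this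
    simp_rw [hR] at this
    simpa using this.re
  have hφi : Integrable (fun u => φ (v - u)) := (integrable_gaussian_mollifier hl).comp_sub_left v
  have hφv : ∫ u, φ (v - u) = 2 * Real.pi := by
    rw [integral_sub_left_eq_self φ volume v]
    exact integral_gaussian_mollifier hl
  rw [hswap, ← hφv, ← Complex.ofReal_sub, Complex.norm_real, ← integral_mul_const,
    ← integral_sub hWφ (hφi.mul_const _)]
  set m : ℝ → ℝ := fun y => |y| * Real.exp |y| * φ y with hm
  have hmi : Integrable m := (H l hl hl1).1
  have hpt : ∀ u, ‖oscSum b u * φ (v - u) - φ (v - u) * oscSum b v‖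
      ≤ 4 * Real.exp 1 * (C₀ * v ^ C₁) * m (v - u) := by
    intro u
    have hφ0 : 0 ≤ φ (v - u) := by simp only [hφ]; positivity
    -- The Lipschitz bound is taken at σ = 1/v: then e^(σv) = e, the excess e^|v-u| is absorbed by
    -- the weight in the Gaussian moment, and σ^(-C₁) becomes v^C₁.
    have hdiff : |oscSum b u - oscSum b v|
        ≤ 4 * (Real.exp 1 * Real.exp |v - u|) * |v - u| * (C₀ * v ^ C₁) := by
      have hpow : (1 / v) ^ (-C₁) = v ^ C₁ := by
        rw [one_div, Real.inv_rpow hv0.le, Real.rpow_neg hv0.le, inv_inv]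
      have hexp : ∀ w : ℝ, w ≤ v + |v - u| →
          Real.exp (1 / v * w) ≤ Real.exp 1 * Real.exp |v - u| := by
        intro w hw
        rw [← Real.exp_add, Real.exp_le_exp]
        calc 1 / v * w ≤ 1 / v * (v + |v - u|) := by gcongr
          _ = 1 + 1 / v * |v - u| := by field_simp
          _ ≤ 1 + |v - u| := by
            have : 1 / v * |v - u| ≤ 1 * |v - u| := by gcongr; linarith
            linarith
      have hC0 : 0 ≤ C₀ * v ^ C₁ := by have := hb.nonneg; positivity
      rcases le_total u v with h | h
      · have h1 := hb.abs_oscSum_sub_le hσ0 hσ1.le h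
        rw [hpow] at h1
        rw [abs_sub_comm]
        refine h1.trans ?_
        have h2 : v - u = |v - u| := (abs_of_nonneg (by linarith)).symm
        rw [← h2]
        have h3 := hexp v (by linarith [abs_nonneg (v - u)])
        rw [← h2] at h3
        have h4 : 0 ≤ v - u := by linarith
        gcongr
      · have h1 := hb.abs_oscSum_sub_le hσ0 hσ1.le h
        rw [hpow] at h1
        refine h1.trans ?_
        have h2 : u - v = |v - u| := by rw [abs_sub_comm]; exact (abs_of_nonneg (by linarith)).symm
        rw [← h2]
        have h3 := hexp u (by linarith)
        rw [← h2] at h3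
        have h4 : 0 ≤ u - v := by linarith
        gcongr
    rw [show oscSum b u * φ (v - u) - φ (v - u) * oscSum b v
      = (oscSum b u - oscSum b v) * φ (v - u) by ring, Real.norm_eq_abs, abs_mul,
      abs_of_nonneg hφ0]
    calc _ ≤ 4 * (Real.exp 1 * Real.exp |v - u|) * |v - u| * (C₀ * v ^ C₁) * φ (v - u) := by gcongr
      _ = _ := by simp only [hm]; ring
  refine (norm_integral_le_of_norm_le ((hmi.comp_sub_left v).const_mul _)
    (Eventually.of_forall hpt)).trans ?_
  rw [integral_const_mul, integral_sub_left_eq_self m volume v]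
  calc 4 * Real.exp 1 * (C₀ * v ^ C₁) * ∫ x, m x
      ≤ 4 * Real.exp 1 * (C₀ * v ^ C₁) * (C * l) := by
        have := (H l hl hl1).2
        have := hb.nonneg
        gcongr
    _ = _ := by ring

end ArithSeq

/-! ### Asymptotics and decay of the oscillating sum. -/

namespace ArithSeq

variable {b : ℕ → ℝ} {C₀ C₁ : ℝ}

/-- Mollifying at scale l = v^(-A) costs l v^C₁ = v^(C₁-A). The choice of A makes this at most
v^(-B), and A ≥ 0 keeps l ≤ 1. -/
lemma SumBound.abs_oscSum_sub_le_of_hankel (hb : SumBound b C₀ C₁) {α : ℝ} {V : ℂ → ℂ}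
    (hV : ∀ s ∈ strip, dirSeries b s * (kernFactor s / s) = s ^ (α : ℂ) * V s) {B A : ℝ}
    (hA : A = max (C₁ + B) 0) :
    ∃ C : ℝ, 0 ≤ C ∧ ∀ v : ℝ, 4 < v →
      ‖hankelInt α V (v ^ (-A)) v - ((2 * Real.pi * oscSum b v : ℝ) : ℂ)‖ ≤ C * v ^ (-B) := by
  obtain ⟨C, hC, H⟩ := hb.norm_hankelInt_sub_le hV
  refine ⟨C, hC, fun v hv => ?_⟩
  have hv0 : 0 < v := by linarith
  have hv1 : 1 ≤ v := by linarith
  have hA0 : 0 ≤ A := by rw [hA]; exact le_max_right _ _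
  refine (H _ v (by positivity) (Real.rpow_le_one_of_one_le_of_nonpos hv1 (by linarith)) hv).trans ?_
  rw [mul_assoc, ← Real.rpow_add hv0]
  refine mul_le_mul_of_nonneg_left (Real.rpow_le_rpow_of_exponent_le hv1 ?_) hC
  have : C₁ + B ≤ A := by rw [hA]; exact le_max_left _ _
  linarith

/-- Asymptotics of `oscSum` when the Dirichlet series has a branch point at the origin. -/
theorem SumBound.oscSum_asymptotic (hb : SumBound b C₀ C₁) {α c : ℝ} {V : ℂ → ℂ}
    (hV : ∀ s ∈ strip, dirSeries b s * (kernFactor s / s) = s ^ (α : ℂ) * V s)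
    (hT : Tempered c V) {V₀ : ℝ} (h0 : Tendsto (fun x : ℝ => V x) (𝓝[>] 0) (𝓝 (V₀ : ℂ)))
    (hα : ∀ n : ℕ, α ≠ n) :
    ∃ C : ℝ, 0 ≤ C ∧ ∀ v : ℝ, 4 < v →
      |oscSum b v - V₀ * (v ^ (-α - 1) / Real.Gamma (-α))| ≤ C * v ^ (-α - 2) := by
  set A := max (C₁ + (α + 2)) 0 with hA
  obtain ⟨C, hC, H⟩ := hb.abs_oscSum_sub_le_of_hankel hV hA
  obtain ⟨C', hC', H'⟩ := hankelInt_asymptotic hT h0 hα (A := A) (le_max_right _ _)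
  refine ⟨C + C', by positivity, fun v hv => ?_⟩
  have h1 := H v hv
  have h2 := H' v hv
  rw [show -(α + 2) = -α - 2 by ring] at h1
  have h3 : (2 * Real.pi) * |oscSum b v - V₀ * (v ^ (-α - 1) / Real.Gamma (-α))|
      ≤ (C + C') * v ^ (-α - 2) := by
    rw [add_mul]
    refine le_trans (le_of_eq ?_) ((norm_sub_le_norm_sub_add_norm_sub _
      (hankelInt α V (v ^ (-A)) v) _).trans (add_le_add ((norm_sub_rev _ _).trans_le h1) h2))
    rw [← Complex.ofReal_mul, ← Complex.ofReal_sub, Complex.norm_real, Real.norm_eq_abs,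
      ← abs_of_pos (show 0 < 2 * Real.pi by positivity), ← abs_mul,
      abs_of_pos (show 0 < 2 * Real.pi by positivity)]
    congr 1; ring
  have h4 : 1 ≤ 2 * Real.pi := by linarith [Real.pi_gt_three]
  exact (le_mul_of_one_le_left (abs_nonneg _) h4).trans h3

/-- Rapid decay of `oscSum` when the Dirichlet series is smooth at the origin. -/
theorem SumBound.oscSum_decay (hb : SumBound b C₀ C₁) {c : ℝ} (a : ℕ) {V : ℂ → ℂ}
    (hV : ∀ s ∈ strip, dirSeries b s * (kernFactor s / s) = s ^ ((a : ℝ) : ℂ) * V s)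
    (hT : Tempered c V) (B : ℝ) :
    ∃ C : ℝ, 0 ≤ C ∧ ∀ v : ℝ, 4 < v → |oscSum b v| ≤ C * v ^ (-B) := by
  set A := max (C₁ + B) 0 with hA
  obtain ⟨C, hC, H⟩ := hb.abs_oscSum_sub_le_of_hankel hV hA
  obtain ⟨C', hC', H'⟩ := hankelInt_natCast_decay hT a (A := A) (le_max_right _ _) B
  refine ⟨C + C', by positivity, fun v hv => ?_⟩
  have h1 := H v hv
  have h2 := H' v hv
  have h3 : (2 * Real.pi) * |oscSum b v| ≤ (C + C') * v ^ (-B) := by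
    rw [add_mul]
    have h5 : ‖((2 * Real.pi * oscSum b v : ℝ) : ℂ)‖ = (2 * Real.pi) * |oscSum b v| := by
      rw [Complex.norm_real, Real.norm_eq_abs, abs_mul, abs_of_pos (by positivity)]
    rw [← h5]
    have h6 := norm_sub_norm_le ((2 * Real.pi * oscSum b v : ℝ) : ℂ) (hankelInt a V (v ^ (-A)) v)
    rw [norm_sub_rev] at h6
    linarith
  have h4 : 1 ≤ 2 * Real.pi := by linarith [Real.pi_gt_three]
  exact (le_mul_of_one_le_left (abs_nonneg _) h4).trans h3

end ArithSeq

/-! ### Bounds for ζ and 1/ζ near the line Re w = 1. -/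

namespace ArithSeq

/-- The growth condition already allows an arbitrarily small extra exponent, so half of it can
absorb the given one. -/
lemma Tempered.of_forall_pos {f : ℂ → ℂ} (h : ∀ ε : ℝ, 0 < ε → Tempered ε f) : Tempered 0 f := by
  intro n
  induction n generalizing f with
  | zero =>
    refine ⟨(h 1 one_pos).differentiableOn, fun ε hε => ?_⟩
    obtain ⟨C, hC, H⟩ := (h (ε / 2) (by positivity)).polyBound (ε / 2) (by positivity)
    refine ⟨C, hC, fun s hs => (H s hs).trans (le_of_eq ?_)⟩
    congr 2; ring
  | succ n ih =>
    refine ⟨⟨(h 1 one_pos).differentiableOn, fun ε hε => ?_⟩, ih fun ε hε => (h ε hε).deriv⟩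
    obtain ⟨C, hC, H⟩ := (h (ε / 2) (by positivity)).polyBound (ε / 2) (by positivity)
    refine ⟨C, hC, fun s hs => (H s hs).trans (le_of_eq ?_)⟩
    congr 2; ring

/-- The terms of the series for `(w - 1) ζ(w) - 1`. -/
noncomputable def zetaTerm (k : ℕ) (w : ℂ) : ℂ :=
  (w - 1) * ((k : ℂ) + 1) ^ (-w) - ((k : ℂ) + 1) ^ (1 - w) + ((k : ℂ) + 1 + 1) ^ (1 - w)

lemma hasDerivAt_ofReal_cpow_neg {x : ℝ} (hx : 0 < x) (w : ℂ) :
    HasDerivAt (fun y : ℝ => (y : ℂ) ^ w) (w * (x : ℂ) ^ (w - 1)) x := by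
  have h1 : HasDerivAt (fun z : ℂ => z ^ w) (w * (x : ℂ) ^ (w - 1)) (x : ℂ) := by
    have := (hasDerivAt_id (x : ℂ)).cpow_const (c := w) (Or.inl (by simpa using hx))
    simpa using this
  exact h1.comp_ofReal

lemma norm_cpow_sub_cpow_le {w : ℂ} (hw : 0 < w.re) {n x : ℝ} (hn : 0 < n) (hx : x ∈ Icc n (n + 1)) :
    ‖(x : ℂ) ^ (-w) - (n : ℂ) ^ (-w)‖ ≤ ‖w‖ * n ^ (-w.re - 1) := by
  have h := norm_image_sub_le_of_norm_deriv_le_segment' (f := fun y : ℝ => (y : ℂ) ^ (-w))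
    (f' := fun y : ℝ => -w * (y : ℂ) ^ (-w - 1)) (a := n) (b := n + 1)
    (C := ‖w‖ * n ^ (-w.re - 1))
    (fun y hy => (hasDerivAt_ofReal_cpow_neg (by linarith [hy.1]) (-w)).hasDerivWithinAt)
    (fun y hy => ?_) x hx
  · refine h.trans ?_
    have h1 : x - n ≤ 1 := by linarith [hx.2]
    exact mul_le_of_le_one_right (by positivity) h1
  · rw [norm_mul, norm_neg, Complex.norm_cpow_eq_rpow_re_of_pos (by linarith [hy.1])]
    refine mul_le_mul_of_nonneg_left ?_ (norm_nonneg _)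
    simp only [Complex.sub_re, Complex.neg_re, Complex.one_re]
    exact Real.rpow_le_rpow_of_nonpos hn hy.1 (by linarith)

/-- Interpolation between the trivial bound 2 n^(-Re w) and the mean value bound |w| n^(-Re w - 1),
through min(1, y) ≤ y^(2ε) with y = |w|/n. Only |w|^(2ε) is lost, and the gain n^(-2ε) makes the
series converge for Re w ≥ 1 - ε. -/
lemma norm_cpow_sub_cpow_le_min {w : ℂ} {ε : ℝ} (hε : 0 < ε) (hε1 : ε ≤ 1 / 2)
    (hw : 1 - ε ≤ w.re) {n x : ℝ} (hn : 1 ≤ n) (hx : x ∈ Icc n (n + 1)) :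
    ‖(x : ℂ) ^ (-w) - (n : ℂ) ^ (-w)‖ ≤ 2 * ‖w‖ ^ (2 * ε) * n ^ (-1 - ε) := by
  have hn0 : 0 < n := by linarith
  have hre : 0 < w.re := by linarith
  have h1 : ‖(x : ℂ) ^ (-w) - (n : ℂ) ^ (-w)‖ ≤ 2 * n ^ (-w.re) := by
    refine (norm_sub_le _ _).trans ?_
    rw [Complex.norm_cpow_eq_rpow_re_of_pos hn0, Complex.norm_cpow_eq_rpow_re_of_pos
      (by linarith [hx.1])]
    have : x ^ (-w).re ≤ n ^ (-w).re :=
      Real.rpow_le_rpow_of_nonpos hn0 hx.1 (by simp; linarith)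
    simp only [Complex.neg_re] at this ⊢
    linarith
  have h2 := norm_cpow_sub_cpow_le hre hn0 hx
  have h3 : n ^ (-w.re) ≤ n ^ (-1 + ε) := Real.rpow_le_rpow_of_exponent_le hn (by linarith)
  have hm : ‖(x : ℂ) ^ (-w) - (n : ℂ) ^ (-w)‖ ≤ 2 * (‖w‖ / n) ^ (2 * ε) * n ^ (-w.re) := by
    rcases le_total 1 (‖w‖ / n) with h | h
    · have : 1 ≤ (‖w‖ / n) ^ (2 * ε) := Real.one_le_rpow h (by positivity)
      refine h1.trans ?_
      have h5 : 0 ≤ n ^ (-w.re) := by positivity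
      nlinarith
    · have h4 : ‖w‖ / n ≤ (‖w‖ / n) ^ (2 * ε) := by
        rcases eq_or_lt_of_le (show 0 ≤ ‖w‖ / n by positivity) with h0 | h0
        · rw [← h0]; positivity
        · calc ‖w‖ / n = (‖w‖ / n) ^ (1 : ℝ) := (Real.rpow_one _).symm
            _ ≤ _ := Real.rpow_le_rpow_of_exponent_ge h0 h (by linarith)
      rw [Real.rpow_sub_one hn0.ne'] at h2
      have h5 : 0 ≤ n ^ (-w.re) := by positivity
      calc _ ≤ ‖w‖ * (n ^ (-w.re) / n) := h2
        _ = (‖w‖ / n) * n ^ (-w.re) := by ring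
        _ ≤ (‖w‖ / n) ^ (2 * ε) * n ^ (-w.re) := by gcongr
        _ ≤ _ := by
          have : 0 ≤ (‖w‖ / n) ^ (2 * ε) * n ^ (-w.re) := by positivity
          linarith
  refine hm.trans ?_
  calc 2 * (‖w‖ / n) ^ (2 * ε) * n ^ (-w.re) ≤ 2 * (‖w‖ / n) ^ (2 * ε) * n ^ (-1 + ε) := by gcongr
    _ = 2 * ‖w‖ ^ (2 * ε) * (n ^ (-(2 * ε)) * n ^ (-1 + ε)) := by
      rw [Real.div_rpow (norm_nonneg _) hn0.le, Real.rpow_neg hn0.le (2 * ε)]; ring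
    _ = _ := by rw [← Real.rpow_add hn0]; congr 2; ring

/-- With n = k + 1, the term is the increment over [n, n+1] of y^(1-w) + (w-1) n^(-w) y, whose
derivative is (1-w)(y^(-w) - n^(-w)). -/
lemma norm_zetaTerm_le {w : ℂ} {ε : ℝ} (hε : 0 < ε) (hε1 : ε ≤ 1 / 2) (hw : 1 - ε ≤ w.re) (k : ℕ) :
    ‖zetaTerm k w‖ ≤ ‖w - 1‖ * (2 * ‖w‖ ^ (2 * ε)) * ((k : ℝ) + 1) ^ (-1 - ε) := by
  set n : ℝ := (k : ℝ) + 1 with hn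
  have hn1 : 1 ≤ n := by rw [hn]; linarith [Nat.cast_nonneg (α := ℝ) k]
  have h := norm_image_sub_le_of_norm_deriv_le_segment'
    (f := fun y : ℝ => (y : ℂ) ^ (1 - w) + (w - 1) * (n : ℂ) ^ (-w) * y)
    (f' := fun y : ℝ => (1 - w) * ((y : ℂ) ^ (-w) - (n : ℂ) ^ (-w))) (a := n) (b := n + 1)
    (C := ‖w - 1‖ * (2 * ‖w‖ ^ (2 * ε)) * n ^ (-1 - ε)) (fun y hy => ?_)
    (fun y hy => ?_) (n + 1) ⟨by linarith, le_rfl⟩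
  · rw [show n + 1 - n = 1 by ring, mul_one] at h
    refine le_trans (le_of_eq ?_) h
    congr 1
    unfold zetaTerm
    rw [hn]; push_cast; ring
  · have h1 := hasDerivAt_ofReal_cpow_neg (x := y) (by linarith [hy.1]) (1 - w)
    have h2 : HasDerivAt (fun y : ℝ => (w - 1) * (n : ℂ) ^ (-w) * (y : ℂ))
        ((w - 1) * (n : ℂ) ^ (-w)) y := by
      simpa using (Complex.ofRealCLM.hasDerivAt (x := y)).const_mul ((w - 1) * (n : ℂ) ^ (-w))
    refine ((h1.add h2).congr_deriv ?_).hasDerivWithinAt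
    rw [show 1 - w - 1 = -w by ring]; ring
  · rw [norm_mul, norm_sub_rev 1 w, mul_assoc]
    exact mul_le_mul_of_nonneg_left
      (norm_cpow_sub_cpow_le_min hε hε1 hw hn1 ⟨hy.1, hy.2.le⟩) (norm_nonneg _)

lemma summable_shift_rpow {ε : ℝ} (hε : 0 < ε) :
    Summable (fun k : ℕ => ((k : ℝ) + 1) ^ (-1 - ε)) := by
  have := (summable_nat_add_iff 1).mpr (Real.summable_nat_rpow.mpr (show -1 - ε < -1 by linarith))
  simpa using this

/-- The analytic continuation of `(w - 1) ζ(w)` to `Re w > 1 / 2`. -/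
noncomputable def zetaReg (w : ℂ) : ℂ := 1 + ∑' k : ℕ, zetaTerm k w

lemma norm_zetaReg_le {w : ℂ} {ε : ℝ} (hε : 0 < ε) (hε1 : ε ≤ 1 / 2) (hw : 1 - ε ≤ w.re) :
    ‖zetaReg w‖ ≤ 1 + ‖w - 1‖ * (2 * ‖w‖ ^ (2 * ε)) * ∑' k : ℕ, ((k : ℝ) + 1) ^ (-1 - ε) := by
  unfold zetaReg
  refine (norm_add_le _ _).trans ?_
  rw [norm_one, ← tsum_mul_left]
  gcongr
  exact tsum_of_norm_bounded ((summable_shift_rpow hε).mul_left _).hasSum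
    fun k => norm_zetaTerm_le hε hε1 hw k

lemma differentiableOn_zetaReg : DifferentiableOn ℂ zetaReg {w | 1 / 2 < w.re} := by
  intro w₀ hw₀
  refine DifferentiableAt.differentiableWithinAt ?_
  set R : ℝ := ‖w₀‖ + 1 with hR
  have hO : IsOpen ({w : ℂ | 1 / 2 < w.re} ∩ {w : ℂ | ‖w‖ < R}) :=
    (isOpen_lt continuous_const Complex.continuous_re).inter
      (isOpen_lt continuous_norm continuous_const)
  have h := Complex.differentiableOn_tsum_of_summable_norm (F := fun k w => zetaTerm k w)
    (u := fun k : ℕ => (R + 1) * (2 * R ^ (2 * (1 / 2) : ℝ)) * ((k : ℝ) + 1) ^ (-1 - 1 / 2 : ℝ))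
    ((summable_shift_rpow (by norm_num)).mul_left _) (fun k => ?_) hO (fun k w hw => ?_)
  · exact ((h.differentiableAt (hO.mem_nhds ⟨hw₀, by simp [hR]⟩))).const_add 1
  · have h1 : ((k : ℂ) + 1) ≠ 0 := by exact_mod_cast Nat.succ_ne_zero k
    have h2 : ((k : ℂ) + 1 + 1) ≠ 0 := by exact_mod_cast Nat.succ_ne_zero (k + 1)
    unfold zetaTerm
    intro z _
    refine DifferentiableAt.differentiableWithinAt ?_
    refine ((DifferentiableAt.mul (by fun_prop) ?_).sub ?_).add ?_
    · exact (by fun_prop : DifferentiableAt ℂ (fun z : ℂ => -z) z).const_cpow (Or.inl h1)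
    · exact (by fun_prop : DifferentiableAt ℂ (fun z : ℂ => 1 - z) z).const_cpow (Or.inl h1)
    · exact (by fun_prop : DifferentiableAt ℂ (fun z : ℂ => 1 - z) z).const_cpow (Or.inl h2)
  · have h1 : ‖w‖ ≤ R := le_of_lt hw.2
    have h2 : ‖w - 1‖ ≤ R + 1 := (norm_sub_le _ _).trans (by rw [norm_one]; linarith)
    have h3 : (1 : ℝ) / 2 < w.re := hw.1
    refine (norm_zetaTerm_le (ε := 1 / 2) (by norm_num) le_rfl (by linarith) k).trans ?_
    gcongr

/-- Each `zetaTerm` differs from (w-1) n^(-w) by n^(1-w) - (n+1)^(1-w), and these differences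
telescope to 1. -/
lemma zetaReg_eq {w : ℂ} (hw : 1 < w.re) : zetaReg w = (w - 1) * riemannZeta w := by
  have hs1 : Summable (fun k : ℕ => zetaTerm k w) :=
    Summable.of_norm_bounded (((summable_shift_rpow (ε := 1 / 2) (by norm_num))).mul_left _)
      fun k => norm_zetaTerm_le (ε := 1 / 2) (by norm_num) le_rfl (by linarith) k
  have hs2 : Summable (fun k : ℕ => (w - 1) * ((k : ℂ) + 1) ^ (-w)) := by
    have h1 := Complex.summable_one_div_nat_cpow.mpr hw
    have h2 := ((summable_nat_add_iff 1).mpr h1).mul_left (w - 1)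
    refine h2.congr fun k => ?_
    rw [Complex.cpow_neg]; push_cast; ring
  have hs3 := hs2.sub hs1
  have htel : ∑' k : ℕ, ((w - 1) * ((k : ℂ) + 1) ^ (-w) - zetaTerm k w) = 1 := by
    have ht := hs3.hasSum.tendsto_sum_nat
    have h1 : ∀ N : ℕ, ∑ k ∈ Finset.range N, ((w - 1) * ((k : ℂ) + 1) ^ (-w) - zetaTerm k w)
        = 1 - ((N : ℂ) + 1) ^ (1 - w) := by
      intro N
      have := Finset.sum_range_sub' (fun k : ℕ => ((k : ℂ) + 1) ^ (1 - w)) N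
      simp only [Nat.cast_zero, zero_add, Complex.one_cpow] at this
      rw [← this]
      refine Finset.sum_congr rfl fun k _ => ?_
      unfold zetaTerm
      push_cast; ring
    have h2 : Tendsto (fun N : ℕ => 1 - ((N : ℂ) + 1) ^ (1 - w)) atTop (𝓝 (1 - 0)) := by
      refine tendsto_const_nhds.sub ?_
      rw [tendsto_zero_iff_norm_tendsto_zero]
      have h3 : ∀ N : ℕ, ‖((N : ℂ) + 1) ^ (1 - w)‖ = (((N + 1 : ℕ)) : ℝ) ^ (-(w.re - 1)) := by
        intro N
        have := Complex.norm_cpow_eq_rpow_re_of_pos (x := ((N + 1 : ℕ) : ℝ)) (by positivity) (1 - w)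
        push_cast at this ⊢
        rw [this]; simp
      simp_rw [h3]
      exact ((tendsto_rpow_neg_atTop (show 0 < w.re - 1 by linarith)).comp
        tendsto_natCast_atTop_atTop).comp (tendsto_add_atTop_nat 1)
    rw [sub_zero] at h2
    exact tendsto_nhds_unique ht (h2.congr fun N => (h1 N).symm)
  rw [hs2.tsum_sub hs1, tsum_mul_left] at htel
  rw [zeta_eq_tsum_one_div_nat_add_one_cpow hw]
  unfold zetaReg
  have : ∑' k : ℕ, 1 / ((k : ℂ) + 1) ^ w = ∑' k : ℕ, ((k : ℂ) + 1) ^ (-w) := by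
    congr 1; ext k; rw [Complex.cpow_neg, one_div]
  rw [this]
  linear_combination (-1 : ℂ) * htel

/-- The value at 1 is 1. Elsewhere this is the nonvanishing of ζ for Re w ≥ 1; on the line itself
the identity with (w-1)ζ(w) is reached by continuity from the right. -/
lemma zetaReg_ne_zero {w : ℂ} (hw : 1 ≤ w.re) : zetaReg w ≠ 0 := by
  rcases eq_or_ne w 1 with rfl | h1
  · have : ∀ k : ℕ, zetaTerm k 1 = 0 := fun k => by simp [zetaTerm]
    simp [zetaReg, this]
  rcases hw.lt_or_eq with h | h
  · rw [zetaReg_eq h]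
    exact mul_ne_zero (sub_ne_zero.mpr h1) (riemannZeta_ne_zero_of_one_le_re hw)
  · have c1 : ContinuousAt zetaReg w :=
      (differentiableOn_zetaReg.differentiableAt ((isOpen_lt continuous_const
        Complex.continuous_re).mem_nhds (show 1 / 2 < w.re by linarith))).continuousAt
    have c2 : ContinuousAt (fun z => (z - 1) * riemannZeta z) w :=
      (continuousAt_id.sub continuousAt_const).mul (differentiableAt_riemannZeta h1).continuousAt
    have ht : Tendsto (fun x : ℝ => w + x) (𝓝[>] 0) (𝓝 w) := by
      have : Continuous (fun x : ℝ => w + x) := by fun_prop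
      exact (this.tendsto' 0 w (by simp)).mono_left nhdsWithin_le_nhds
    have e : zetaReg w = (w - 1) * riemannZeta w := by
      refine tendsto_nhds_unique (c1.tendsto.comp ht) ((c2.tendsto.comp ht).congr' ?_)
      filter_upwards [self_mem_nhdsWithin] with x hx
      refine (zetaReg_eq ?_).symm
      have : (0 : ℝ) < x := hx
      simp; linarith
    rw [e]
    exact mul_ne_zero (sub_ne_zero.mpr h1) (riemannZeta_ne_zero_of_one_le_re hw)

/-- `s ζ(1 + s) / (1 + s)`. -/
noncomputable def xiFun (s : ℂ) : ℂ := zetaReg (1 + s) / (1 + s)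

lemma one_add_ne_zero_of_re {s : ℂ} (hs : -(1 / 2) < s.re) : 1 + s ≠ 0 := by
  intro h
  have := congrArg Complex.re h
  simp at this
  linarith

lemma xiFun_eq {s : ℂ} (hs : 0 < s.re) : xiFun s = s * riemannZeta (1 + s) / (1 + s) := by
  unfold xiFun
  rw [zetaReg_eq (by simpa using hs)]
  simp

lemma xiFun_ne_zero {s : ℂ} (hs : 0 ≤ s.re) : xiFun s ≠ 0 :=
  div_ne_zero (zetaReg_ne_zero (by simpa using hs)) (one_add_ne_zero_of_re (by linarith))

lemma xiFun_zero : xiFun 0 = 1 := by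
  have : ∀ k : ℕ, zetaTerm k 1 = 0 := fun k => by simp [zetaTerm]
  simp [xiFun, zetaReg, this]

lemma differentiableAt_xiFun {s : ℂ} (hs : -(1 / 2) < s.re) : DifferentiableAt ℂ xiFun s := by
  unfold xiFun
  refine DifferentiableAt.div ?_ (by fun_prop) (one_add_ne_zero_of_re hs)
  have : DifferentiableAt ℂ zetaReg (1 + s) :=
    differentiableOn_zetaReg.differentiableAt ((isOpen_lt continuous_const
        Complex.continuous_re).mem_nhds (show 1 / 2 < (1 + s).re by simp; linarith))
  exact this.comp s (by fun_prop)

/-- Division by 1 + s removes the linear growth of (w-1)ζ(w) and leaves |t|^(2ε) on a strip reaching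
ε to the left of Re s = 0. Cauchy's estimates apply there, and ε is arbitrary. -/
lemma tempered_xiFun : Tempered 0 xiFun := by
  refine Tempered.of_forall_pos fun δ hδ => ?_
  set ε := min (δ / 2) (1 / 4) with hε
  have hε0 : 0 < ε := by positivity
  have hε1 : ε ≤ 1 / 4 := min_le_right _ _
  have hε2 : ε ≤ δ / 2 := min_le_left _ _
  refine tempered_of_wide_strip hε0 (fun s hs => (differentiableAt_xiFun
    (by linarith [hs.1])).differentiableWithinAt) fun ε' hε' => ?_
  set S := ∑' k : ℕ, ((k : ℝ) + 1) ^ (-1 - ε) with hS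
  have hS0 : 0 ≤ S := tsum_nonneg fun k => by positivity
  refine ⟨2 + 6 * S, by positivity, fun s h1 h2 => ?_⟩
  have hs : -(1 / 2) < s.re := by linarith
  have hn : 1 / 2 ≤ ‖1 + s‖ := by
    have := Complex.abs_re_le_norm (1 + s)
    have h3 := le_abs_self (1 + s).re
    simp only [Complex.add_re, Complex.one_re] at this h3
    linarith
  have hn0 : 0 < ‖1 + s‖ := by linarith
  have hT : 1 ≤ |s.im| + 2 := one_le_abs_add_two _
  have hle : ‖1 + s‖ ≤ |s.im| + 2 := by
    have := Complex.norm_le_abs_re_add_abs_im (1 + s)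
    simp only [Complex.add_re, Complex.one_re, Complex.add_im, Complex.one_im, zero_add] at this
    have h4 : |1 + s.re| ≤ 2 := abs_le.mpr ⟨by linarith, by linarith⟩
    linarith
  have hsn : ‖s‖ ≤ 3 * ‖1 + s‖ := by
    have : ‖s‖ ≤ ‖1 + s‖ + 1 := by
      calc ‖s‖ = ‖(1 + s) - 1‖ := by congr 1; ring
        _ ≤ _ := (norm_sub_le _ _).trans (by rw [norm_one])
    linarith
  have h5 := norm_zetaReg_le (w := 1 + s) hε0 (by linarith) (by simp; linarith)
  rw [show (1 + s) - 1 = s by ring, ← hS] at h5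
  have hpow : ‖1 + s‖ ^ (2 * ε) ≤ (|s.im| + 2) ^ (δ + ε') :=
    (Real.rpow_le_rpow hn0.le hle (by positivity)).trans
      (Real.rpow_le_rpow_of_exponent_le hT (by linarith))
  have hone : 1 ≤ (|s.im| + 2) ^ (δ + ε') := Real.one_le_rpow hT (by positivity)
  unfold xiFun
  rw [norm_div, div_le_iff₀ hn0]
  refine h5.trans ?_
  set P := (|s.im| + 2) ^ (δ + ε')
  calc 1 + ‖s‖ * (2 * ‖1 + s‖ ^ (2 * ε)) * S ≤ 2 * ‖1 + s‖ * P + 3 * ‖1 + s‖ * (2 * P) * S := by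
        gcongr
        nlinarith
    _ = _ := by ring

lemma zeta_product_ge_one {x : ℝ} (hx : 0 < x) (y : ℝ) :
    1 ≤ ‖riemannZeta (1 + x)‖ ^ 3 * ‖riemannZeta (1 + x + Complex.I * y)‖ ^ 4 *
      ‖riemannZeta (1 + x + 2 * Complex.I * y)‖ := by
  have := DirichletCharacter.norm_LFunction_product_ge_one (1 : DirichletCharacter ℂ 1) hx y
  simpa [DirichletCharacter.LFunctionTrivChar, DirichletCharacter.LFunction_modOne_eq] using this

lemma riemannZeta_eq_xiFun {s : ℂ} (hs : 0 < s.re) :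
    riemannZeta (1 + s) = xiFun s * ((1 + s) / s) := by
  have h0 : s ≠ 0 := fun h => by rw [h] at hs; simp at hs
  have h1 := one_add_ne_zero_of_re (s := s) (by linarith)
  rw [xiFun_eq hs]; field_simp

lemma norm_one_add_div_le {s : ℂ} (hs : 1 ≤ ‖s‖) : ‖(1 + s) / s‖ ≤ 2 := by
  rw [norm_div, div_le_iff₀ (by linarith)]
  refine (norm_add_le _ _).trans ?_
  rw [norm_one]; linarith

/-- A consequence of the inequality `3 + 4 cos θ + cos 2θ ≥ 0`. -/
lemma exists_xiFun_pow_ge {ε : ℝ} (hε : 0 < ε) : ∃ c : ℝ, 0 < c ∧ ∀ s ∈ strip, 1 ≤ |s.im| →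
    c * s.re ^ 3 ≤ ‖xiFun s‖ ^ 4 * (|s.im| + 2) ^ ε := by
  obtain ⟨C, hC, H⟩ := tempered_xiFun.polyBound ε hε
  rw [zero_add] at H
  set C' := C + 1 with hC'
  have hC'0 : 0 < C' := by positivity
  have H' : ∀ s ∈ strip, ‖xiFun s‖ ≤ C' * (|s.im| + 2) ^ ε := fun s hs => by
    refine (H s hs).trans ?_
    gcongr
    linarith
  refine ⟨1 / ((C' * 2 ^ ε * 2) ^ 3 * 2 ^ 4 * (2 * C' * 2 ^ ε)), by positivity, fun s hs ht => ?_⟩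
  have hx : 0 < s.re := hs.1
  have hx1 : s.re < 1 / 4 := hs.2
  have key := zeta_product_ge_one hx s.im
  set T := (|s.im| + 2) ^ ε with hT
  have e1 : (1 : ℂ) + s.re + Complex.I * s.im = 1 + s := by
    rw [add_assoc, mul_comm, Complex.re_add_im]
  have e2 : (1 : ℂ) + s.re + 2 * Complex.I * s.im = 1 + (s.re + 2 * s.im * Complex.I) := by ring
  rw [e1, e2] at key
  -- The pole of ζ at 1 gives 1/Re s, whose cube appears in the 3-4-1 product; the factor at height
  -- 2t contributes only a small power of |t|.
  have b1 : ‖riemannZeta (1 + s.re)‖ ≤ C' * 2 ^ ε * 2 / s.re := by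
    rw [riemannZeta_eq_xiFun (by simpa using hx), norm_mul, norm_div, Complex.norm_real,
      Real.norm_of_nonneg hx.le, mul_div_assoc]
    have h1 := H' s.re ⟨by simpa using hx, by simpa using hx1⟩
    simp only [Complex.ofReal_im, abs_zero, zero_add] at h1
    have h2 : ‖(1 : ℂ) + s.re‖ ≤ 2 := by
      refine (norm_add_le _ _).trans ?_
      rw [norm_one, Complex.norm_real, Real.norm_of_nonneg hx.le]; linarith
    gcongr
  have b2 : ‖riemannZeta (1 + s)‖ ≤ ‖xiFun s‖ * 2 := by
    rw [riemannZeta_eq_xiFun hx, norm_mul]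
    gcongr
    exact norm_one_add_div_le (ht.trans (Complex.abs_im_le_norm s))
  set z : ℂ := s.re + 2 * s.im * Complex.I with hz
  have hzre : z.re = s.re := by simp [hz]
  have hzim : z.im = 2 * s.im := by simp [hz]
  have b3 : ‖riemannZeta (1 + z)‖ ≤ 2 * C' * 2 ^ ε * T := by
    rw [riemannZeta_eq_xiFun (by rw [hzre]; exact hx), norm_mul]
    have h1 := H' z ⟨by rw [hzre]; exact hx, by rw [hzre]; exact hx1⟩
    have h2 : ‖(1 + z) / z‖ ≤ 2 := by
      refine norm_one_add_div_le (le_trans ?_ (Complex.abs_im_le_norm z))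
      rw [hzim, abs_mul]; norm_num; linarith
    have h3 : (|z.im| + 2) ^ ε ≤ 2 ^ ε * T := by
      rw [hT, ← Real.mul_rpow (by norm_num) (by positivity), hzim, abs_mul, abs_two]
      exact Real.rpow_le_rpow (by positivity) (by linarith) hε.le
    calc ‖xiFun z‖ * ‖(1 + z) / z‖ ≤ (C' * (2 ^ ε * T)) * 2 := by
          gcongr
          exact h1.trans (by gcongr)
      _ = _ := by ring
  have h1 : 1 ≤ (C' * 2 ^ ε * 2 / s.re) ^ 3 * (‖xiFun s‖ * 2) ^ 4 * (2 * C' * 2 ^ ε * T) := by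
    refine key.trans ?_
    gcongr
  rw [div_mul_eq_mul_div, one_mul, div_le_iff₀ (by positivity)]
  have h2 : (C' * 2 ^ ε * 2 / s.re) ^ 3 * (‖xiFun s‖ * 2) ^ 4 * (2 * C' * 2 ^ ε * T) * s.re ^ 3
      = ‖xiFun s‖ ^ 4 * T * ((C' * 2 ^ ε * 2) ^ 3 * 2 ^ 4 * (2 * C' * 2 ^ ε)) := by
    field_simp
  rw [← h2]
  exact le_mul_of_one_le_left (by positivity) h1

/-- Compactness settles |t| ≤ 1. Otherwise put u = (|t|+2)^ε' and x₀ = η u^(-8). For Re s ≥ x₀ the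
3-4-1 inequality gives |ξ|⁴ ≫ u^(-25), in particular |ξ| ≫ u^(-25/4) at Re s = x₀. Moving left of x₀
changes ξ by at most C u x₀ = C η u^(-7), which is smaller because 25/4 < 7. In both ranges |ξ| ≫
u^(-25), and u^25 = (|t|+2)^ε. -/
lemma polyBound_inv_xiFun : PolyBound 0 (fun s => (xiFun s)⁻¹) := by
  intro ε hε
  rw [zero_add]
  set ε' := ε / 25 with hε'
  have hε'0 : 0 < ε' := by positivity
  obtain ⟨c, hc, Hc⟩ := exists_xiFun_pow_ge hε'0
  obtain ⟨D, hD, HD⟩ := tempered_xiFun.deriv.polyBound ε' hε'0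
  rw [zero_add] at HD
  set C := D + 1 with hC
  have hC0 : 0 < C := by positivity
  obtain ⟨m, hm, Hm⟩ : ∃ m : ℝ, 0 < m ∧ ∀ s ∈ strip, |s.im| ≤ 1 → m ≤ ‖xiFun s‖ := by
    have hK : IsCompact (Icc (0 : ℝ) (1 / 4) ×ℂ Icc (-1 : ℝ) 1) := isCompact_Icc.reProdIm isCompact_Icc
    have hne : (Icc (0 : ℝ) (1 / 4) ×ℂ Icc (-1 : ℝ) 1).Nonempty :=
      ⟨0, by simp [Complex.mem_reProdIm]⟩
    have hcont : ContinuousOn (fun s => ‖xiFun s‖) (Icc (0 : ℝ) (1 / 4) ×ℂ Icc (-1 : ℝ) 1) := by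
      intro s hs
      rw [Complex.mem_reProdIm] at hs
      exact (differentiableAt_xiFun (by linarith [hs.1.1])).continuousAt.norm.continuousWithinAt
    obtain ⟨s₀, hs₀, hmin⟩ := hK.exists_isMinOn hne hcont
    rw [Complex.mem_reProdIm] at hs₀
    refine ⟨‖xiFun s₀‖, norm_pos_iff.mpr (xiFun_ne_zero hs₀.1.1), fun s hs ht => ?_⟩
    refine hmin ?_
    rw [Complex.mem_reProdIm]
    exact ⟨⟨hs.1.le, hs.2.le⟩, abs_le.mp ht⟩
  -- If the lower bound failed left of x₀, the value at x₀ would force c ≤ 16 C⁴ η, whereas here 32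
  -- C⁴ η ≤ c. The cap 1/8 keeps x₀ inside the strip.
  set η := min (1 / 8) (c / (32 * C ^ 4)) with hη
  have hη0 : 0 < η := by positivity
  have hη1 : η ≤ 1 / 8 := min_le_left _ _
  have hη2 : η * (32 * C ^ 4) ≤ c := by
    rw [← le_div_iff₀ (by positivity)]; exact min_le_right _ _
  -- the lower bound away from the real axis
  have hfar : ∀ s ∈ strip, 1 ≤ |s.im| →
      min 1 (min (c * η ^ 3) (C * η)) ≤ ‖xiFun s‖ * ((|s.im| + 2) ^ ε') ^ 25 := by
    intro s hs ht
    set u := (|s.im| + 2) ^ ε' with hu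
    have hu1 : 1 ≤ u := Real.one_le_rpow (one_le_abs_add_two _) hε'0.le
    have hu0 : 0 < u := by linarith
    set x₀ := η / u ^ 8 with hx₀
    have hx₀0 : 0 < x₀ := by positivity
    have hx₀1 : x₀ < 1 / 4 := by
      have : x₀ ≤ η := div_le_self hη0.le (one_le_pow₀ hu1)
      linarith
    rcases le_or_gt x₀ s.re with h | h
    · have h1 := Hc s hs ht
      rw [← hu] at h1
      have h2 : c * x₀ ^ 3 ≤ ‖xiFun s‖ ^ 4 * u := le_trans (by gcongr) h1
      have h3 : c * η ^ 3 ≤ ‖xiFun s‖ ^ 4 * u ^ 25 := by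
        have : c * η ^ 3 = c * x₀ ^ 3 * u ^ 24 := by rw [hx₀]; field_simp
        rw [this]
        calc c * x₀ ^ 3 * u ^ 24 ≤ ‖xiFun s‖ ^ 4 * u * u ^ 24 := by gcongr
          _ = _ := by ring
      rcases le_total 1 ‖xiFun s‖ with h4 | h4
      · refine (min_le_left _ _).trans ?_
        have : 1 ≤ u ^ 25 := one_le_pow₀ hu1
        nlinarith
      · refine ((min_le_right _ _).trans (min_le_left _ _)).trans (h3.trans ?_)
        gcongr
        exact pow_le_of_le_one (norm_nonneg _) h4 (by norm_num)
    · refine ((min_le_right _ _).trans (min_le_right _ _)).trans ?_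
      by_contra hcon
      push Not at hcon
      set z : ℂ := x₀ + s.im * Complex.I with hz
      have hzre : z.re = x₀ := by simp [hz]
      have hzim : z.im = s.im := by simp [hz]
      have hzs : z ∈ strip := ⟨by rw [hzre]; exact hx₀0, by rw [hzre]; exact hx₀1⟩
      have h1 := Hc z hzs (by rw [hzim]; exact ht)
      rw [hzre, hzim, ← hu] at h1
      have hconv : Convex ℝ (strip ∩ {w : ℂ | w.im = s.im}) := by
        refine Convex.inter ?_ ?_
        · exact (convex_halfSpace_re_gt 0).inter (convex_halfSpace_re_lt (1 / 4))
        · exact convex_hyperplane Complex.imLm.isLinear s.im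
      have h2 : ‖xiFun z - xiFun s‖ ≤ C * u * ‖z - s‖ := by
        refine hconv.norm_image_sub_le_of_norm_deriv_le (fun w hw => ?_) (fun w hw => ?_)
          ⟨hs, rfl⟩ ⟨hzs, hzim⟩
        · exact differentiableAt_xiFun (by linarith [hw.1.1])
        · refine (HD w hw.1).trans ?_
          rw [show w.im = s.im from hw.2, ← hu]
          gcongr
          linarith
      have h3 : ‖z - s‖ ≤ x₀ := by
        have : z - s = ((x₀ - s.re : ℝ) : ℂ) := by
          apply Complex.ext <;> simp [hz]
        rw [this, Complex.norm_real, Real.norm_of_nonneg (by linarith)]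
        linarith [hs.1]
      have h4 : ‖xiFun z‖ * u ^ 7 ≤ 2 * C * η := by
        have h5 : ‖xiFun z‖ ≤ ‖xiFun s‖ + C * u * x₀ := by
          have := norm_sub_norm_le (xiFun z) (xiFun s)
          have h6 : C * u * ‖z - s‖ ≤ C * u * x₀ := by gcongr
          linarith
        have h7 : ‖xiFun s‖ * u ^ 7 ≤ C * η := by
          refine le_trans ?_ hcon.le
          gcongr
          norm_num
        have h8 : C * u * x₀ * u ^ 7 = C * η := by rw [hx₀]; field_simp
        calc ‖xiFun z‖ * u ^ 7 ≤ (‖xiFun s‖ + C * u * x₀) * u ^ 7 := by gcongr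
          _ = ‖xiFun s‖ * u ^ 7 + C * u * x₀ * u ^ 7 := by ring
          _ ≤ _ := by linarith
      have h9 : c * η ^ 3 ≤ (2 * C * η) ^ 4 := by
        calc c * η ^ 3 = c * x₀ ^ 3 * u ^ 24 := by rw [hx₀]; field_simp
          _ ≤ ‖xiFun z‖ ^ 4 * u * u ^ 24 := by gcongr
          _ = ‖xiFun z‖ ^ 4 * u ^ 25 := by ring
          _ ≤ ‖xiFun z‖ ^ 4 * u ^ 28 := by
            gcongr
            norm_num
          _ = (‖xiFun z‖ * u ^ 7) ^ 4 := by ring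
          _ ≤ _ := by gcongr
      have h10 : (2 * C * η) ^ 4 = 16 * C ^ 4 * η * η ^ 3 := by ring
      rw [h10] at h9
      have h11 := le_of_mul_le_mul_right h9 (by positivity)
      nlinarith [show 0 < C ^ 4 * η by positivity]
  set m' := min 1 (min (c * η ^ 3) (C * η)) with hm'
  have hm'0 : 0 < m' := by positivity
  refine ⟨1 / m + 1 / m', by positivity, fun s hs => ?_⟩
  have hx := xiFun_ne_zero hs.1.le
  have hx0 : 0 < ‖xiFun s‖ := norm_pos_iff.mpr hx
  have hpow : ((|s.im| + 2) ^ ε') ^ 25 = (|s.im| + 2) ^ ε := by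
    rw [← Real.rpow_natCast, ← Real.rpow_mul (by positivity), hε']
    congr 1; push_cast; ring
  have hone : 1 ≤ (|s.im| + 2) ^ ε := Real.one_le_rpow (one_le_abs_add_two _) hε.le
  rw [norm_inv]
  rcases le_total |s.im| 1 with ht | ht
  · have h1 : ‖xiFun s‖⁻¹ ≤ 1 / m := by
      rw [one_div]; exact inv_anti₀ hm (Hm s hs ht)
    have h2 : 0 ≤ 1 / m' := by positivity
    have h3 : 0 ≤ 1 / m := by positivity
    nlinarith
  · have h1 := hfar s hs ht
    rw [hpow] at h1
    have h2 : ‖xiFun s‖⁻¹ ≤ 1 / m' * (|s.im| + 2) ^ ε := by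
      rw [inv_le_iff_one_le_mul₀ hx0, one_div, mul_comm, ← mul_assoc, mul_comm ‖xiFun s‖, mul_assoc,
        ← div_eq_inv_mul, le_div_iff₀ hm'0, one_mul]
      exact h1
    have h3 : 0 ≤ 1 / m * (|s.im| + 2) ^ ε := by positivity
    rw [add_mul]; linarith

lemma tempered_inv_xiFun : Tempered 0 (fun s => (xiFun s)⁻¹) :=
  tempered_xiFun.inv (fun _ hs => xiFun_ne_zero hs.1.le) polyBound_inv_xiFun

/-- The logarithmic derivative of `s ζ(1 + s) / (1 + s)` is tempered. -/
lemma tempered_logDeriv_xiFun : Tempered 0 (fun s => deriv xiFun s * (xiFun s)⁻¹) := by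
  simpa using tempered_xiFun.deriv.mul tempered_inv_xiFun

end ArithSeq

/-! ### Logarithms of Euler products with the first-order term removed. -/

namespace ArithSeq

/-- The series `∑ log (1 + u n n ^ (-s)) - v n n ^ (-s)`. -/
noncomputable def logRem (u v : ℕ → ℝ) (s : ℂ) : ℂ :=
  ∑' n : ℕ, (Complex.log (1 + u n * (n : ℂ) ^ (-s)) - v n * (n : ℂ) ^ (-s))

/-- Size conditions under which `logRem u v` is holomorphic to the left of the imaginary axis. -/
structure LogBound (u v : ℕ → ℝ) (C : ℝ) : Prop where
  small : ∀ n, |u n| ≤ 3 / 4 * (n : ℝ) ^ (-(1 / 4) : ℝ)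
  le : ∀ n, |u n| ≤ C * (n : ℝ) ^ (-(7 / 8) : ℝ)
  sub_le : ∀ n, |u n - v n| ≤ C * (n : ℝ) ^ (-(3 / 2) : ℝ)

namespace LogBound

variable {u v : ℕ → ℝ} {C : ℝ}

lemma u_zero (hb : LogBound u v C) : u 0 = 0 := by
  have := hb.small 0
  rw [Nat.cast_zero, Real.zero_rpow (by norm_num), mul_zero] at this
  exact abs_nonpos_iff.mp this

lemma v_zero (hb : LogBound u v C) : v 0 = 0 := by
  have := hb.sub_le 0
  rw [Nat.cast_zero, Real.zero_rpow (by norm_num), mul_zero, hb.u_zero] at this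
  simpa using abs_nonpos_iff.mp this

lemma norm_cpow_le {s : ℂ} (hs : -(1 / 4) ≤ s.re) {n : ℕ} (hn : 0 < n) :
    ‖(n : ℂ) ^ (-s)‖ ≤ (n : ℝ) ^ (1 / 4 : ℝ) := by
  rw [Complex.norm_natCast_cpow_of_pos hn]
  exact Real.rpow_le_rpow_of_exponent_le (by exact_mod_cast hn) (by simp; linarith)

lemma norm_mul_cpow_le (hb : LogBound u v C) {s : ℂ} (hs : -(1 / 4) ≤ s.re) (n : ℕ) :
    ‖(u n : ℂ) * (n : ℂ) ^ (-s)‖ ≤ 3 / 4 := by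
  rcases Nat.eq_zero_or_pos n with rfl | hn
  · rw [hb.u_zero]; norm_num
  have hn' : (0 : ℝ) < n := by exact_mod_cast hn
  rw [norm_mul, Complex.norm_real, Real.norm_eq_abs]
  calc |u n| * ‖(n : ℂ) ^ (-s)‖ ≤ 3 / 4 * (n : ℝ) ^ (-(1 / 4) : ℝ) * (n : ℝ) ^ (1 / 4 : ℝ) :=
        mul_le_mul (hb.small n) (norm_cpow_le hs hn) (norm_nonneg _) (by positivity)
    _ = 3 / 4 := by rw [mul_assoc, ← Real.rpow_add hn']; norm_num

lemma one_add_ne_zero (hb : LogBound u v C) {s : ℂ} (hs : -(1 / 4) ≤ s.re) (n : ℕ) :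
    1 + (u n : ℂ) * (n : ℂ) ^ (-s) ≠ 0 := by
  intro h
  have h1 := hb.norm_mul_cpow_le hs n
  rw [eq_neg_of_add_eq_zero_right h, norm_neg, norm_one] at h1
  norm_num at h1

/-- With z = u n^(-s) of size O(n^(-5/8)), both log(1+z) - z = O(|z|²) and (u - v) n^(-s) are
O(n^(-5/4)), even a quarter to the left of the imaginary axis. The condition `small` keeps |z| ≤
3/4, away from the branch point of the logarithm. -/
lemma norm_term_le (hb : LogBound u v C) {s : ℂ} (hs : -(1 / 4) ≤ s.re) (n : ℕ) :
    ‖Complex.log (1 + u n * (n : ℂ) ^ (-s)) - v n * (n : ℂ) ^ (-s)‖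
      ≤ (2 * C ^ 2 + C) * (n : ℝ) ^ (-(5 / 4) : ℝ) := by
  rcases Nat.eq_zero_or_pos n with rfl | hn
  · simp [hb.u_zero, hb.v_zero, Real.zero_rpow (show (-(5 / 4) : ℝ) ≠ 0 by norm_num)]
  have hn' : (0 : ℝ) < n := by exact_mod_cast hn
  set z := (u n : ℂ) * (n : ℂ) ^ (-s) with hz
  have hz1 : ‖z‖ ≤ 3 / 4 := hb.norm_mul_cpow_le hs n
  have hz2 : ‖z‖ ≤ C * (n : ℝ) ^ (-(5 / 8) : ℝ) := by
    rw [hz, norm_mul, Complex.norm_real, Real.norm_eq_abs]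
    calc |u n| * ‖(n : ℂ) ^ (-s)‖ ≤ C * (n : ℝ) ^ (-(7 / 8) : ℝ) * (n : ℝ) ^ (1 / 4 : ℝ) :=
          mul_le_mul (hb.le n) (norm_cpow_le hs hn) (norm_nonneg _) ((abs_nonneg _).trans (hb.le n))
      _ = C * (n : ℝ) ^ (-(5 / 8) : ℝ) := by rw [mul_assoc, ← Real.rpow_add hn']; norm_num
  have h1 : ‖Complex.log (1 + z) - z‖ ≤ 2 * ‖z‖ ^ 2 := by
    refine (Complex.norm_log_one_add_sub_self_le (by linarith)).trans ?_
    have h2 : (1 - ‖z‖)⁻¹ ≤ 4 := by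
      rw [inv_le_comm₀ (by linarith) (by norm_num)]; linarith
    nlinarith [mul_le_mul_of_nonneg_left h2 (sq_nonneg ‖z‖)]
  have h3 : ‖z - v n * (n : ℂ) ^ (-s)‖ ≤ C * (n : ℝ) ^ (-(5 / 4) : ℝ) := by
    rw [hz, ← sub_mul, norm_mul, ← Complex.ofReal_sub, Complex.norm_real, Real.norm_eq_abs]
    calc |u n - v n| * ‖(n : ℂ) ^ (-s)‖ ≤ C * (n : ℝ) ^ (-(3 / 2) : ℝ) * (n : ℝ) ^ (1 / 4 : ℝ) :=
          mul_le_mul (hb.sub_le n) (norm_cpow_le hs hn) (norm_nonneg _)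
            ((abs_nonneg _).trans (hb.sub_le n))
      _ = C * (n : ℝ) ^ (-(5 / 4) : ℝ) := by rw [mul_assoc, ← Real.rpow_add hn']; norm_num
  have h4 : ‖z‖ ^ 2 ≤ C ^ 2 * (n : ℝ) ^ (-(5 / 4) : ℝ) := by
    calc ‖z‖ ^ 2 ≤ (C * (n : ℝ) ^ (-(5 / 8) : ℝ)) ^ 2 := by gcongr
      _ = _ := by rw [mul_pow, ← Real.rpow_mul_natCast hn'.le]; norm_num
  calc ‖Complex.log (1 + z) - v n * (n : ℂ) ^ (-s)‖
      = ‖(Complex.log (1 + z) - z) + (z - v n * (n : ℂ) ^ (-s))‖ := by congr 1; ring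
    _ ≤ 2 * ‖z‖ ^ 2 + C * (n : ℝ) ^ (-(5 / 4) : ℝ) := (norm_add_le _ _).trans (add_le_add h1 h3)
    _ ≤ _ := by linarith

lemma summable_bound : Summable fun n : ℕ => (2 * C ^ 2 + C) * (n : ℝ) ^ (-(5 / 4) : ℝ) :=
  (Real.summable_nat_rpow.mpr (by norm_num)).mul_left _

lemma summable (hb : LogBound u v C) {s : ℂ} (hs : -(1 / 4) ≤ s.re) :
    Summable fun n : ℕ => Complex.log (1 + u n * (n : ℂ) ^ (-s)) - v n * (n : ℂ) ^ (-s) :=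
  Summable.of_norm_bounded summable_bound (hb.norm_term_le hs)

lemma norm_logRem_le (hb : LogBound u v C) {s : ℂ} (hs : -(1 / 4) ≤ s.re) :
    ‖logRem u v s‖ ≤ ∑' n : ℕ, (2 * C ^ 2 + C) * (n : ℝ) ^ (-(5 / 4) : ℝ) :=
  tsum_of_norm_bounded summable_bound.hasSum (hb.norm_term_le hs)

lemma differentiableOn_logRem (hb : LogBound u v C) :
    DifferentiableOn ℂ (logRem u v) {s | -(1 / 4) < s.re} := by
  refine Complex.differentiableOn_tsum_of_summable_norm summable_bound (fun n => ?_)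
    (isOpen_lt continuous_const Complex.continuous_re)
    (fun n s hs => hb.norm_term_le (le_of_lt hs) n)
  intro s hs
  refine DifferentiableAt.differentiableWithinAt ?_
  rcases Nat.eq_zero_or_pos n with rfl | hn
  · simp [hb.u_zero, hb.v_zero]
  have hn' : (n : ℂ) ≠ 0 := by exact_mod_cast hn.ne'
  have h1 : DifferentiableAt ℂ (fun s : ℂ => (n : ℂ) ^ (-s)) s :=
    (by fun_prop : DifferentiableAt ℂ (fun z : ℂ => -z) s).const_cpow (Or.inl hn')
  refine (((differentiableAt_const _).add ((differentiableAt_const _).mul h1)).clog ?_).sub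
    ((differentiableAt_const _).mul h1)
  left
  have h2 := hb.norm_mul_cpow_le (le_of_lt hs) n
  have h3 := (abs_le.mp ((Complex.abs_re_le_norm _).trans h2)).1
  change 0 < (1 + (u n : ℂ) * (n : ℂ) ^ (-s)).re
  rw [Complex.add_re, Complex.one_re]
  linarith

lemma tempered_logRem (hb : LogBound u v C) : Tempered 0 (logRem u v) := by
  refine tempered_of_wide_strip (r := 1 / 4) (by norm_num)
    (hb.differentiableOn_logRem.mono fun s hs => hs.1) fun ε hε => ?_
  refine ⟨∑' n : ℕ, (2 * C ^ 2 + C) * (n : ℝ) ^ (-(5 / 4) : ℝ), ?_, fun s hs _ => ?_⟩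
  · exact (norm_nonneg _).trans (hb.norm_logRem_le (s := 0) (by norm_num))
  · have h1 := hb.norm_logRem_le hs.le
    refine h1.trans (le_mul_of_one_le_right ((norm_nonneg _).trans h1) ?_)
    exact Real.one_le_rpow (one_le_abs_add_two _) (by linarith)

lemma tendsto_logRem (hb : LogBound u v C) :
    Tendsto (fun x : ℝ => logRem u v x) (𝓝[>] 0) (𝓝 (logRem u v 0)) := by
  have h1 : ContinuousAt (logRem u v) ((0 : ℝ) : ℂ) :=
    (hb.differentiableOn_logRem.differentiableAt
      ((isOpen_lt continuous_const Complex.continuous_re).mem_nhds (by simp))).continuousAt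
  have h2 : ContinuousAt (fun x : ℝ => logRem u v x) 0 :=
    ContinuousAt.comp (f := fun x : ℝ => (x : ℂ)) h1 Complex.continuous_ofReal.continuousAt
  simpa using h2.tendsto.mono_left nhdsWithin_le_nhds

/-- Exponentiating `logRem`. -/
lemma tendsto_prod (hb : LogBound u v C) {s : ℂ} (hs : -(1 / 4) ≤ s.re) :
    Tendsto (fun N => ∏ n ∈ Finset.range N,
      ((1 + u n * (n : ℂ) ^ (-s)) * Complex.exp (-(v n * (n : ℂ) ^ (-s))))) atTop
      (𝓝 (Complex.exp (logRem u v s))) := by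
  have h1 := ((Complex.continuous_exp.tendsto _).comp (hb.summable hs).hasSum.tendsto_sum_nat)
  refine h1.congr fun N => ?_
  rw [Function.comp_apply, Complex.exp_sum]
  refine Finset.prod_congr rfl fun n _ => ?_
  rw [sub_eq_add_neg, Complex.exp_add, Complex.exp_log (hb.one_add_ne_zero hs n)]

lemma tendsto_prod_of_tendsto (hb : LogBound u v C) {s : ℂ} (hs : -(1 / 4) ≤ s.re) {L : ℂ}
    (hL : Tendsto (fun N => ∑ n ∈ Finset.range N, (v n : ℂ) * (n : ℂ) ^ (-s)) atTop (𝓝 L)) :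
    Tendsto (fun N => ∏ n ∈ Finset.range N, (1 + (u n : ℂ) * (n : ℂ) ^ (-s))) atTop
      (𝓝 (Complex.exp (logRem u v s + L))) := by
  have h1 := (hb.tendsto_prod hs).mul ((Complex.continuous_exp.tendsto _).comp hL)
  rw [Complex.exp_add]
  refine h1.congr fun N => ?_
  rw [Function.comp_apply, Complex.exp_sum, ← Finset.prod_mul_distrib]
  refine Finset.prod_congr rfl fun n _ => ?_
  rw [mul_assoc, ← Complex.exp_add, neg_add_cancel, Complex.exp_zero, mul_one]

lemma logRem_ofReal_im (hb : LogBound u v C) {x : ℝ} (hx : 0 ≤ x) : (logRem u v x).im = 0 := by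
  have hs : -(1 / 4) ≤ ((x : ℂ)).re := by simp; linarith
  have h1 := (Complex.hasSum_im (hb.summable hs).hasSum)
  have h2 : (fun n : ℕ => (Complex.log (1 + u n * (n : ℂ) ^ (-(x : ℂ)))
      - v n * (n : ℂ) ^ (-(x : ℂ))).im) = fun _ => 0 := by
    ext n
    have h3 : (n : ℂ) ^ (-(x : ℂ)) = (((n : ℝ) ^ (-x) : ℝ) : ℂ) := by
      rw [Complex.ofReal_cpow (Nat.cast_nonneg n)]; push_cast; rfl
    have h4 := hb.norm_mul_cpow_le hs n
    rw [h3, ← Complex.ofReal_mul, Complex.norm_real, Real.norm_eq_abs] at h4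
    rw [h3, ← Complex.ofReal_mul, ← Complex.ofReal_mul, ← Complex.ofReal_one,
      ← Complex.ofReal_add, ← Complex.ofReal_log (by linarith [(abs_le.mp h4).1]),
      ← Complex.ofReal_sub, Complex.ofReal_im]
  rw [h2] at h1
  exact h1.unique hasSum_zero

end LogBound

/-- Abel's inequality: decreasing weights do not increase the bound for the partial sums. -/
lemma norm_sum_range_smul_le {a : ℕ → ℂ} {w : ℕ → ℝ} {B : ℝ} (hw : Antitone w)
    (hw0 : ∀ n, 0 ≤ w n) (ha : ∀ N, ‖∑ n ∈ Finset.range N, a n‖ ≤ B) (N : ℕ) :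
    ‖∑ n ∈ Finset.range N, w n • a n‖ ≤ w 0 * B := by
  have hB : 0 ≤ B := (norm_nonneg _).trans (ha 0)
  rw [Finset.sum_range_by_parts]
  refine (norm_sub_le _ _).trans ?_
  have h1 : ‖w (N - 1) • ∑ i ∈ Finset.range N, a i‖ ≤ w (N - 1) * B := by
    rw [norm_smul, Real.norm_of_nonneg (hw0 _)]
    exact mul_le_mul_of_nonneg_left (ha N) (hw0 _)
  have h2 : ‖∑ i ∈ Finset.range (N - 1), (w (i + 1) - w i) • ∑ i ∈ Finset.range (i + 1), a i‖
      ≤ ∑ i ∈ Finset.range (N - 1), (w i - w (i + 1)) * B := by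
    refine norm_sum_le_of_le _ fun i _ => ?_
    have h3 : 0 ≤ w i - w (i + 1) := sub_nonneg.mpr (hw (Nat.le_succ i))
    rw [norm_smul, Real.norm_eq_abs, abs_sub_comm, abs_of_nonneg h3]
    exact mul_le_mul_of_nonneg_left (ha _) h3
  rw [← Finset.sum_mul, Finset.sum_range_sub'] at h2
  linarith

end ArithSeq

/-! ### Dirichlet series up to the line Re s = 0 by Abel summation. -/

namespace ArithSeq

/-- The index 0 is replaced by 1, because 0 ^ (-σ) = 0 for σ > 0 would break monotonicity; the
coefficient there vanishes anyway. -/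
lemma antitone_weight {σ : ℝ} (hσ : 0 ≤ σ) :
    Antitone fun n : ℕ => ((max n 1 : ℕ) : ℝ) ^ (-σ) := by
  intro m n hmn
  refine Real.rpow_le_rpow_of_nonpos (by positivity) ?_ (by linarith)
  exact_mod_cast max_le_max_right 1 hmn

lemma cpow_neg_eq_smul {n : ℕ} (hn : n ≠ 0) (s : ℂ) :
    (n : ℂ) ^ (-s) = (((max n 1 : ℕ) : ℝ) ^ (-s.re)) • (n : ℂ) ^ (-(s.im * Complex.I)) := by
  have hn1 : max n 1 = n := max_eq_left (Nat.one_le_iff_ne_zero.mpr hn)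
  have hn' : (n : ℂ) ≠ 0 := by exact_mod_cast hn
  have h1 : (((n : ℝ) ^ (-s.re) : ℝ) : ℂ) = (n : ℂ) ^ (-(s.re : ℂ)) := by
    rw [Complex.ofReal_cpow (Nat.cast_nonneg n)]; push_cast; rfl
  rw [hn1, Complex.real_smul, h1, ← Complex.cpow_add _ _ hn', ← neg_add, Complex.re_add_im]

/-- Abel's inequality for a Dirichlet series to the right of the line `Re s = 0`. -/
lemma norm_sum_mul_cpow_le {f : ℕ → ℂ} (hf : f 0 = 0) {s : ℂ} (hs : 0 ≤ s.re) {B : ℝ}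
    (hB : ∀ N, ‖∑ n ∈ Finset.range N, f n * (n : ℂ) ^ (-(s.im * Complex.I))‖ ≤ B) (N : ℕ) :
    ‖∑ n ∈ Finset.range N, f n * (n : ℂ) ^ (-s)‖ ≤ B := by
  have h1 := norm_sum_range_smul_le (antitone_weight hs)
    (fun n => Real.rpow_nonneg (Nat.cast_nonneg _) _) hB N
  simp only [zero_le, sup_of_le_right, Nat.cast_one, Real.one_rpow, one_mul] at h1
  refine le_of_eq_of_le ?_ h1
  congr 1
  refine Finset.sum_congr rfl fun n _ => ?_
  rcases eq_or_ne n 0 with rfl | hn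
  · simp [hf]
  · rw [cpow_neg_eq_smul hn, mul_smul_comm]

lemma norm_tsum_mul_cpow_le {f : ℕ → ℂ} (hf : f 0 = 0) {s : ℂ} (hs : 0 ≤ s.re)
    (hsum : Summable fun n : ℕ => f n * (n : ℂ) ^ (-s)) {B : ℝ}
    (hB : ∀ N, ‖∑ n ∈ Finset.range N, f n * (n : ℂ) ^ (-(s.im * Complex.I))‖ ≤ B) :
    ‖∑' n : ℕ, f n * (n : ℂ) ^ (-s)‖ ≤ B :=
  le_of_tendsto hsum.hasSum.tendsto_sum_nat.norm
    (Eventually.of_forall (norm_sum_mul_cpow_le hf hs hB))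

/-- The coefficients `c` are `O(n ^ (ε - 1))` for every `ε`. -/
structure SmallCoeff (c : ℕ → ℝ) : Prop where
  zero : c 0 = 0
  le : ∀ ε : ℝ, 0 < ε → ∃ C : ℝ, ∀ n : ℕ, n ≠ 0 → |c n| ≤ C * (n : ℝ) ^ (ε - 1)

namespace SmallCoeff

variable {c : ℕ → ℝ}

lemma term_eq (hc : SmallCoeff c) (s : ℂ) (n : ℕ) :
    LSeries.term (fun n => (c n : ℂ)) s n = (c n : ℂ) * (n : ℂ) ^ (-s) := by
  rcases eq_or_ne n 0 with rfl | hn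
  · simp [hc.zero]
  · rw [LSeries.term_of_ne_zero hn, Complex.cpow_neg, div_eq_mul_inv]

lemma dirSeries_eq (hc : SmallCoeff c) : dirSeries c = LSeries (fun n => (c n : ℂ)) := by
  ext s
  exact tsum_congr fun n => (hc.term_eq s n).symm

lemma abscissa_lt (hc : SmallCoeff c) {s : ℂ} (hs : 0 < s.re) :
    LSeries.abscissaOfAbsConv (fun n => (c n : ℂ)) < s.re := by
  obtain ⟨C, hC⟩ := hc.le (s.re / 2) (by positivity)
  have h1 := LSeries.abscissaOfAbsConv_le_of_le_const_mul_rpow (f := fun n => (c n : ℂ))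
    (x := s.re / 2 - 1) ⟨C, fun n hn => by simpa using hC n hn⟩
  refine h1.trans_lt ?_
  norm_cast
  linarith

lemma summable (hc : SmallCoeff c) {s : ℂ} (hs : 0 < s.re) :
    Summable fun n : ℕ => (c n : ℂ) * (n : ℂ) ^ (-s) :=
  (LSeriesSummable_of_abscissaOfAbsConv_lt_re (hc.abscissa_lt hs)).congr fun n => (hc.term_eq s n)

lemma differentiableOn (hc : SmallCoeff c) :
    DifferentiableOn ℂ (dirSeries c) {s | 0 < s.re} := by
  rw [hc.dirSeries_eq]
  exact (LSeries_differentiableOn _).mono fun s hs => hc.abscissa_lt hs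

lemma dirSeries_ofReal_im (hc : SmallCoeff c) {x : ℝ} (hx : 0 < x) :
    (dirSeries c x).im = 0 := by
  have h1 := Complex.hasSum_im (hc.summable (s := x) (by simpa)).hasSum
  have h2 : (fun n : ℕ => ((c n : ℂ) * (n : ℂ) ^ (-(x : ℂ))).im) = fun _ => 0 := by
    ext n
    have h3 : (n : ℂ) ^ (-(x : ℂ)) = (((n : ℝ) ^ (-x) : ℝ) : ℂ) := by
      rw [Complex.ofReal_cpow (Nat.cast_nonneg n)]; push_cast; rfl
    rw [h3, ← Complex.ofReal_mul, Complex.ofReal_im]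
  rw [h2] at h1
  exact h1.unique hasSum_zero

lemma iterate_logMul_apply (f : ℕ → ℂ) (m n : ℕ) :
    (LSeries.logMul^[m] f) n = Complex.log n ^ m * f n := by
  induction m with
  | zero => simp
  | succ m ih =>
    rw [Function.iterate_succ_apply', LSeries.logMul, ih, pow_succ]
    ring

/-- Bounds for the logarithmically weighted partial sums on the line `Re s = 0` make the
derivative tempered. -/
lemma tempered_deriv (hc : SmallCoeff c)
    (hb : ∀ m : ℕ, 1 ≤ m → ∀ ε : ℝ, 0 < ε → ∃ C : ℝ, ∀ (t : ℝ) (N : ℕ),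
      ‖∑ n ∈ Finset.range N, (Complex.log n ^ m * (c n : ℂ)) * (n : ℂ) ^ (-(t * Complex.I))‖
        ≤ C * (|t| + 2) ^ ε) :
    Tempered 0 (deriv (dirSeries c)) := by
  set f : ℕ → ℂ := fun n => (c n : ℂ) with hf
  have hab : ∀ m : ℕ, ∀ s : ℂ, 0 < s.re →
      LSeries.abscissaOfAbsConv (LSeries.logMul^[m] f) < s.re := fun m s hs => by
    rw [LSeries.absicssaOfAbsConv_logPowMul]; exact hc.abscissa_lt hs
  have hterm : ∀ (m : ℕ) (s : ℂ) (n : ℕ), LSeries.term (LSeries.logMul^[m] f) s n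
      = Complex.log n ^ m * (c n : ℂ) * (n : ℂ) ^ (-s) := fun m s n => by
    rcases eq_or_ne n 0 with rfl | hn
    · simp [hc.zero]
    · rw [LSeries.term_of_ne_zero hn, iterate_logMul_apply, Complex.cpow_neg, div_eq_mul_inv]
  have hpoly : ∀ m : ℕ, 1 ≤ m → PolyBound 0 (LSeries (LSeries.logMul^[m] f)) := by
    intro m hm ε hε
    obtain ⟨C, hC⟩ := hb m hm ε hε
    refine ⟨|C|, abs_nonneg _, fun s hs => ?_⟩
    have hsum : Summable fun n : ℕ => Complex.log n ^ m * (c n : ℂ) * (n : ℂ) ^ (-s) :=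
      (LSeriesSummable_of_abscissaOfAbsConv_lt_re (hab m s hs.1)).congr (hterm m s)
    have h1 : LSeries (LSeries.logMul^[m] f) s
        = ∑' n : ℕ, Complex.log n ^ m * (c n : ℂ) * (n : ℂ) ^ (-s) := tsum_congr (hterm m s)
    rw [h1, zero_add]
    refine norm_tsum_mul_cpow_le (by simp [hc.zero]) hs.1.le hsum fun N => (hC s.im N).trans ?_
    gcongr
    exact le_abs_self C
  have hdiff : ∀ m : ℕ, DifferentiableOn ℂ (LSeries (LSeries.logMul^[m] f)) strip := fun m =>
    (LSeries_differentiableOn _).mono fun s hs => hab m s hs.1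
  have hder : ∀ m : ℕ, ∀ s ∈ strip, deriv (LSeries (LSeries.logMul^[m] f)) s
      = (-1) * LSeries (LSeries.logMul^[m + 1] f) s := fun m s hs => by
    rw [LSeries_deriv (hab m s hs.1), Function.iterate_succ_apply', neg_one_mul]
  -- Each derivative brings a factor -log n into the coefficients, so the derivatives of the series
  -- with weight log^m involve only weights log^j with j ≥ m ≥ 1, all bounded by `hb` and Abel's
  -- inequality.
  have key : ∀ n m : ℕ, 1 ≤ m → TemperedUpTo n 0 (LSeries (LSeries.logMul^[m] f)) := by
    intro n
    induction n with
    | zero => exact fun m hm => ⟨hdiff m, hpoly m hm⟩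
    | succ n ih =>
      intro m hm
      refine ⟨⟨hdiff m, hpoly m hm⟩, ?_⟩
      have h1 := (tempered_const (-1) n).mul (ih (m + 1) (by omega))
      rw [zero_add] at h1
      exact h1.congr fun s hs => (hder m s hs).symm
  have h2 : Tempered 0 (fun s => (-1) * LSeries (LSeries.logMul^[1] f) s) := by
    have := (tempered_const (-1)).mul (fun n => key n 1 le_rfl)
    rwa [zero_add] at this
  refine h2.congr fun s hs => ?_
  rw [hc.dirSeries_eq]
  exact (hder 0 s hs).symm

lemma norm_dirSeries_le (hc : SmallCoeff c) {s : ℂ} (hs : 0 < s.re) {B : ℝ}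
    (hB : ∀ N, ‖∑ n ∈ Finset.range N, (c n : ℂ) * (n : ℂ) ^ (-(s.im * Complex.I))‖ ≤ B) :
    ‖dirSeries c s‖ ≤ B :=
  norm_tsum_mul_cpow_le (f := fun n => (c n : ℂ)) (by simp [hc.zero]) hs.le (hc.summable hs) hB

/-- Abel's theorem for Dirichlet series. -/
lemma tendsto_dirSeries (hc : SmallCoeff c) {l : ℂ}
    (hl : Tendsto (fun N => ∑ n ∈ Finset.range N, (c n : ℂ)) atTop (𝓝 l)) :
    Tendsto (fun x : ℝ => dirSeries c x) (𝓝[>] 0) (𝓝 l) := by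
  rw [Metric.tendsto_nhds]
  intro e he
  obtain ⟨N₀, hN₀⟩ := Metric.tendsto_atTop.mp hl (e / 8) (by positivity)
  -- The tail has all partial sums at most e/4, so Abel's inequality bounds its series by e/4
  -- uniformly in x > 0. The finite remainder is continuous at 0.
  set g : ℕ → ℂ := fun n => if n < N₀ then 0 else (c n : ℂ) with hg
  have hfin : Tendsto (fun x : ℝ => ∑ n ∈ Finset.range N₀, (c n : ℂ) * (n : ℂ) ^ (-(x : ℂ)))
      (𝓝[>] 0) (𝓝 (∑ n ∈ Finset.range N₀, (c n : ℂ))) := by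
    refine tendsto_finsetSum _ fun n _ => ?_
    rcases eq_or_ne n 0 with rfl | hn
    · simp [hc.zero]
    have h1 : ContinuousAt (fun x : ℝ => (c n : ℂ) * (n : ℂ) ^ (-(x : ℂ))) 0 := by
      refine ContinuousAt.mul continuousAt_const ?_
      exact ContinuousAt.const_cpow (by fun_prop) (Or.inl (by exact_mod_cast hn))
    simpa using h1.tendsto.mono_left nhdsWithin_le_nhds
  filter_upwards [Metric.tendsto_nhds.mp hfin (e / 4) (by positivity), self_mem_nhdsWithin]
    with x hx hx0
  have hx0' : 0 < ((x : ℂ)).re := by simpa using hx0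
  have hsum := hc.summable hx0'
  have hsplit : ∀ n : ℕ, g n * (n : ℂ) ^ (-(x : ℂ)) = (c n : ℂ) * (n : ℂ) ^ (-(x : ℂ))
      - (if n < N₀ then (c n : ℂ) * (n : ℂ) ^ (-(x : ℂ)) else 0) := by
    intro n
    simp only [hg]
    split_ifs <;> simp
  have hfs : HasSum (fun n : ℕ => if n < N₀ then (c n : ℂ) * (n : ℂ) ^ (-(x : ℂ)) else 0)
      (∑ n ∈ Finset.range N₀, (c n : ℂ) * (n : ℂ) ^ (-(x : ℂ))) := by
    have h1 : HasSum (fun n : ℕ => if n < N₀ then (c n : ℂ) * (n : ℂ) ^ (-(x : ℂ)) else 0)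
        (∑ n ∈ Finset.range N₀, if n < N₀ then (c n : ℂ) * (n : ℂ) ^ (-(x : ℂ)) else 0) :=
      hasSum_sum_of_ne_finset_zero fun n hn => if_neg (by simpa using hn)
    rwa [Finset.sum_congr rfl fun n hn => if_pos (Finset.mem_range.mp hn)] at h1
  have hgs : HasSum (fun n : ℕ => g n * (n : ℂ) ^ (-(x : ℂ)))
      (dirSeries c x - ∑ n ∈ Finset.range N₀, (c n : ℂ) * (n : ℂ) ^ (-(x : ℂ))) := by
    simp_rw [hsplit]
    exact hsum.hasSum.sub hfs
  have hg0 : g 0 = 0 := by simp [hg, hc.zero]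
  have hpart : ∀ N, ‖∑ n ∈ Finset.range N, g n * (n : ℂ) ^ (-(((x : ℂ)).im * Complex.I))‖
      ≤ e / 4 := by
    intro N
    have h1 : ∑ n ∈ Finset.range N, g n * (n : ℂ) ^ (-(((x : ℂ)).im * Complex.I))
        = ∑ n ∈ Finset.range N, g n := by
      refine Finset.sum_congr rfl fun n _ => ?_
      simp
    rw [h1]
    rcases le_total N N₀ with hN | hN
    · rw [Finset.sum_eq_zero fun n hn => if_pos (by have := Finset.mem_range.mp hn; omega)]
      rw [norm_zero]; positivity
    · have h2 : ∑ n ∈ Finset.range N, g n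
          = ∑ n ∈ Finset.range N, (c n : ℂ) - ∑ n ∈ Finset.range N₀, (c n : ℂ) := by
        rw [← Finset.sum_range_add_sum_Ico _ hN, ← Finset.sum_range_add_sum_Ico
          (fun n => (c n : ℂ)) hN, Finset.sum_eq_zero fun n hn =>
          (if_pos (Finset.mem_range.mp hn) : g n = 0), zero_add, add_sub_cancel_left]
        exact Finset.sum_congr rfl fun n hn =>
          if_neg (by have := (Finset.mem_Ico.mp hn).1; omega)
      rw [h2, ← dist_eq_norm]
      have h3 := hN₀ N hN
      have h4 := hN₀ N₀ le_rfl
      have h5 := dist_triangle_right (∑ n ∈ Finset.range N, (c n : ℂ))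
        (∑ n ∈ Finset.range N₀, (c n : ℂ)) l
      linarith
  have h6 := norm_tsum_mul_cpow_le hg0 hx0'.le hgs.summable hpart
  rw [hgs.tsum_eq, ← dist_eq_norm] at h6
  have h7 := hN₀ N₀ le_rfl
  calc dist (dirSeries c x) l ≤ dist (dirSeries c x)
        (∑ n ∈ Finset.range N₀, (c n : ℂ) * (n : ℂ) ^ (-(x : ℂ)))
        + dist (∑ n ∈ Finset.range N₀, (c n : ℂ) * (n : ℂ) ^ (-(x : ℂ)))
          (∑ n ∈ Finset.range N₀, (c n : ℂ)) + dist (∑ n ∈ Finset.range N₀, (c n : ℂ)) l :=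
        dist_triangle4 _ _ _ _
    _ < e := by linarith

end SmallCoeff

end ArithSeq

/-! ### The prime sums attached to h. -/

namespace ArithSeq

/-- `1 / n` on primes. -/
noncomputable def primeInv (n : ℕ) : ℝ := if n.Prime then 1 / (n : ℝ) else 0

/-- `- (h n - k) / n` on primes. -/
noncomputable def primeDev (h : ArithmeticFunction ℝ) (k : ℝ) (n : ℕ) : ℝ :=
  if n.Prime then -((h n - k) / (n : ℝ)) else 0

/-- `(1 - h n) / n` on primes. -/
noncomputable def primeMain (h : ArithmeticFunction ℝ) (n : ℕ) : ℝ :=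
  if n.Prime then (1 - h n) / (n : ℝ) else 0

/-- `(1 - h n) / (n - 1)` on primes above `P`. -/
noncomputable def primeTail (h : ArithmeticFunction ℝ) (P n : ℕ) : ℝ :=
  if n.Prime ∧ P < n then (1 - h n) / ((n : ℝ) - 1) else 0

lemma smallCoeff_primeInv : SmallCoeff primeInv := by
  refine ⟨by simp [primeInv, Nat.not_prime_zero], fun ε hε => ⟨1, fun n hn => ?_⟩⟩
  have hn' : (1 : ℝ) ≤ n := by exact_mod_cast Nat.one_le_iff_ne_zero.mpr hn
  unfold primeInv
  split_ifs
  · rw [abs_of_nonneg (by positivity), one_mul, one_div, ← Real.rpow_neg_one]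
    exact Real.rpow_le_rpow_of_exponent_le hn' (by linarith)
  · simp only [abs_zero, one_mul]; positivity

lemma logBound_primeInv : LogBound (fun n => -primeInv n) (fun n => -primeInv n) 1 := by
  refine ⟨fun n => ?_, fun n => ?_, fun n => ?_⟩
  · unfold primeInv
    split_ifs with h
    · have h2 : (2 : ℝ) ≤ n := by exact_mod_cast h.two_le
      have h0 : (0 : ℝ) < n := by linarith
      rw [abs_neg, abs_of_nonneg (by positivity)]
      have h3 : (1 : ℝ) / n = (n : ℝ) ^ (-(3 / 4) : ℝ) * (n : ℝ) ^ (-(1 / 4) : ℝ) := by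
        rw [← Real.rpow_add h0, one_div, ← Real.rpow_neg_one]; norm_num
      rw [h3]
      refine mul_le_mul_of_nonneg_right ?_ (by positivity)
      -- The extreme case is n = 2, where 2^(-3/4) ≤ 3/4 because (4/3)⁴ ≤ 8.
      have h4 : (n : ℝ) ^ (-(3 / 4) : ℝ) ≤ (2 : ℝ) ^ (-(3 / 4) : ℝ) :=
        Real.rpow_le_rpow_of_nonpos (by norm_num) h2 (by norm_num)
      refine h4.trans ?_
      rw [Real.rpow_neg (by norm_num), inv_le_comm₀ (by positivity) (by norm_num)]
      have h5 : ((3 / 4 : ℝ)⁻¹) ≤ ((8 : ℝ) ^ (1 / 4 : ℝ)) := by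
        have : ((3 / 4 : ℝ)⁻¹) = (((3 / 4 : ℝ)⁻¹) ^ 4) ^ (1 / 4 : ℝ) := by
          rw [← Real.rpow_natCast, ← Real.rpow_mul (by norm_num)]; norm_num
        rw [this]
        exact Real.rpow_le_rpow (by norm_num) (by norm_num) (by norm_num)
      refine h5.trans_eq ?_
      rw [show (8 : ℝ) = 2 ^ (3 : ℝ) by norm_num, ← Real.rpow_mul (by norm_num)]
      norm_num
    · simp only [neg_zero, abs_zero]; positivity
  · unfold primeInv
    split_ifs with h
    · have h2 : (1 : ℝ) ≤ n := by exact_mod_cast h.one_lt.le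
      rw [abs_neg, abs_of_nonneg (by positivity), one_mul, one_div, ← Real.rpow_neg_one]
      exact Real.rpow_le_rpow_of_exponent_le h2 (by norm_num)
    · simp only [neg_zero, abs_zero, one_mul]; positivity
  · simp only [sub_self, abs_zero, one_mul]; positivity

lemma sum_range_ite_prime {M : Type*} [AddCommMonoid M] (F : ℕ → M) (N : ℕ) :
    ∑ n ∈ Finset.range N, (if n.Prime then F n else 0) = ∑ p ∈ Nat.primesLE (N - 1), F p := by
  rw [← Nat.primesBelow_eq_primesLE_sub_one, Nat.primesBelow, Finset.sum_filter]

section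

variable {h : ArithmeticFunction ℝ} {k : ℝ}

lemma exists_prime_le (hyp : PrimeAverageHypothesis h k) {ε : ℝ}
    (hε : 0 < ε) : ∃ C : ℝ, 0 ≤ C ∧ ∀ n : ℕ, n ≠ 0 → 1 + h n ≤ C * (n : ℝ) ^ ε := by
  obtain ⟨C, hC⟩ := hyp.le_rpow ε hε
  refine ⟨1 + |C|, by positivity, fun n hn => ?_⟩
  have hn' : (1 : ℝ) ≤ n := by exact_mod_cast Nat.one_le_iff_ne_zero.mpr hn
  have h1 := hC n (Nat.one_le_iff_ne_zero.mpr hn)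
  have h2 : 1 ≤ (n : ℝ) ^ ε := Real.one_le_rpow hn' hε.le
  have h3 : C * (n : ℝ) ^ ε ≤ |C| * (n : ℝ) ^ ε :=
    mul_le_mul_of_nonneg_right (le_abs_self C) (by positivity)
  linarith

lemma smallCoeff_primeDev (h_nonneg : ∀ n, 0 ≤ h n) (hyp : PrimeAverageHypothesis h k) :
    SmallCoeff (primeDev h k) := by
  refine ⟨by simp [primeDev, Nat.not_prime_zero], fun ε hε => ?_⟩
  obtain ⟨C, hC0, hC⟩ := exists_prime_le hyp hε
  refine ⟨C * (1 + k), fun n hn => ?_⟩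
  have hk := hyp.nonneg_k
  have hn0 : (0 : ℝ) < n := by exact_mod_cast Nat.pos_of_ne_zero hn
  unfold primeDev
  split_ifs
  · rw [abs_neg, abs_div, abs_of_pos hn0, Real.rpow_sub_one hn0.ne', ← mul_div_assoc]
    refine div_le_div_of_nonneg_right ?_ hn0.le
    have h1 := hC n hn
    have h2 := h_nonneg n
    calc |h n - k| ≤ (1 + h n) * (1 + k) := by
          rw [abs_le]; constructor <;> nlinarith
      _ ≤ C * (n : ℝ) ^ ε * (1 + k) := by gcongr
      _ = _ := by ring
  · simp only [abs_zero]; positivity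

/-- Beyond a suitable threshold, the factors `1 + (1 - h p) / (p - 1)` have good logarithms. -/
lemma exists_logBound_primeTail (h_nonneg : ∀ n, 0 ≤ h n) (hyp : PrimeAverageHypothesis h k)
    (P₁ : ℕ) : ∃ P : ℕ, P₁ ≤ P ∧ ∃ C : ℝ, LogBound (primeTail h P) (primeMain h) C := by
  obtain ⟨C, hC0, hC⟩ := exists_prime_le hyp (ε := 1 / 16) (by norm_num)
  have ht : Tendsto (fun n : ℕ => (n : ℝ) ^ (11 / 16 : ℝ)) atTop atTop :=
    (tendsto_rpow_atTop (by norm_num)).comp tendsto_natCast_atTop_atTop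
  -- From this threshold on, 2C n^(-15/16) ≤ (3/4) n^(-1/4), so each factor of the product has a
  -- logarithm as required by `small`.
  obtain ⟨P₂, hP₂⟩ := eventually_atTop.mp (ht.eventually_ge_atTop (4 / 3 * (2 * C)))
  set P := max P₁ P₂ with hP
  have key : ∀ n : ℕ, n.Prime → |1 - h n| ≤ C * (n : ℝ) ^ (1 / 16 : ℝ) := fun n hn => by
    have h2 := h_nonneg n
    refine le_trans ?_ (hC n hn.ne_zero)
    rw [abs_le]; constructor <;> linarith
  have hval : ∀ n : ℕ, |primeTail h P n| ≤ 2 * C * (n : ℝ) ^ (-(15 / 16) : ℝ) := fun n => by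
    unfold primeTail
    split_ifs with hp
    · have h2 : (2 : ℝ) ≤ n := by exact_mod_cast hp.1.two_le
      have h0 : (0 : ℝ) < n := by linarith
      rw [abs_div, abs_of_pos (show (0 : ℝ) < n - 1 by linarith), div_le_iff₀ (by linarith)]
      refine (key n hp.1).trans ?_
      have h3 : (n : ℝ) ^ (1 / 16 : ℝ) = (n : ℝ) ^ (-(15 / 16) : ℝ) * n := by
        rw [← Real.rpow_add_one h0.ne']; norm_num
      rw [h3]
      have h4 : 0 ≤ C * (n : ℝ) ^ (-(15 / 16) : ℝ) := by positivity
      nlinarith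
    · simp only [abs_zero]; positivity
  -- The factor P + 1 pays for the primes up to P, at which `primeTail` is zero while `primeMain`
  -- need not be.
  refine ⟨P, le_max_left _ _, 2 * C * (P + 1), ⟨fun n => ?_, fun n => ?_, fun n => ?_⟩⟩
  · rcases lt_or_ge P n with hn | hn
    · refine (hval n).trans ?_
      have h0 : (0 : ℝ) < n := by exact_mod_cast (Nat.zero_le P).trans_lt hn
      have h1 : 4 / 3 * (2 * C) ≤ (n : ℝ) ^ (11 / 16 : ℝ) :=
        hP₂ n ((le_max_right _ _).trans hn.le)
      have h3 : (n : ℝ) ^ (-(1 / 4) : ℝ)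
          = (n : ℝ) ^ (11 / 16 : ℝ) * (n : ℝ) ^ (-(15 / 16) : ℝ) := by
        rw [← Real.rpow_add h0]; norm_num
      rw [h3, ← mul_assoc]
      exact mul_le_mul_of_nonneg_right (by linarith) (by positivity)
    · rw [primeTail, if_neg (by omega), abs_zero]; positivity
  · rcases Nat.eq_zero_or_pos n with rfl | hn
    · simp [primeTail, Nat.not_prime_zero]
    · refine (hval n).trans ?_
      have h1 : (1 : ℝ) ≤ n := by exact_mod_cast hn
      have h2 : (n : ℝ) ^ (-(15 / 16) : ℝ) ≤ (n : ℝ) ^ (-(7 / 8) : ℝ) :=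
        Real.rpow_le_rpow_of_exponent_le h1 (by norm_num)
      have h3 : 2 * C ≤ 2 * C * (P + 1) := by
        nlinarith [Nat.cast_nonneg (α := ℝ) P]
      exact mul_le_mul h3 h2 (by positivity) (by positivity)
  · unfold primeTail primeMain
    by_cases hp : n.Prime
    · have h2 : (2 : ℝ) ≤ n := by exact_mod_cast hp.two_le
      have h0 : (0 : ℝ) < n := by linarith
      have h3 : (n : ℝ) ^ (1 / 16 : ℝ) = (n : ℝ) ^ (9 / 16 : ℝ) * (n : ℝ) ^ (-(3 / 2) : ℝ) * n := by
        rw [← Real.rpow_add h0, ← Real.rpow_add_one h0.ne']; norm_num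
      have h4 : (n : ℝ) ^ (9 / 16 : ℝ) ≤ n := by
        calc (n : ℝ) ^ (9 / 16 : ℝ) ≤ (n : ℝ) ^ (1 : ℝ) :=
              Real.rpow_le_rpow_of_exponent_le (by linarith) (by norm_num)
          _ = n := Real.rpow_one _
      have h5 := key n hp
      rw [h3] at h5
      set w := (n : ℝ) ^ (-(3 / 2) : ℝ) with hw
      have hw0 : 0 ≤ w := by positivity
      rcases lt_or_ge P n with hn | hn
      · rw [if_pos ⟨hp, hn⟩, if_pos hp]
        have h6 : (1 - h n) / ((n : ℝ) - 1) - (1 - h n) / n = (1 - h n) / (n * (n - 1)) := by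
          have : (n : ℝ) - 1 ≠ 0 := by linarith
          field_simp
          ring
        rw [h6, abs_div, abs_of_pos (show (0 : ℝ) < n * (n - 1) by nlinarith),
          div_le_iff₀ (by nlinarith)]
        have h7 : |1 - h n| ≤ C * (n * w * n) := h5.trans (by gcongr)
        refine h7.trans ?_
        have h8 : 0 ≤ C * w * n := by positivity
        have h9 : (n : ℝ) ≤ 2 * (n - 1) := by linarith
        have h10 : (1 : ℝ) ≤ (P : ℝ) + 1 := by linarith [Nat.cast_nonneg (α := ℝ) P]
        calc C * (n * w * n) = C * w * n * n * 1 := by ring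
          _ ≤ C * w * n * (2 * (n - 1)) * (P + 1) := by
            refine mul_le_mul (mul_le_mul_of_nonneg_left h9 h8) h10 (by norm_num) ?_
            exact mul_nonneg h8 (by linarith)
          _ = _ := by ring
      · rw [if_neg (by omega), if_pos hp, zero_sub, abs_neg, abs_div, abs_of_pos h0,
          div_le_iff₀ h0]
        refine h5.trans ?_
        have h11 : (n : ℝ) ≤ P := by exact_mod_cast hn
        have h12 : (n : ℝ) ^ (9 / 16 : ℝ) ≤ 2 * (P + 1) := by linarith [Nat.cast_nonneg (α := ℝ) P]
        calc C * ((n : ℝ) ^ (9 / 16 : ℝ) * w * n) ≤ C * (2 * (P + 1) * w * n) := by gcongr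
          _ = _ := by ring
    · rw [if_neg (by tauto), if_neg hp, sub_zero, abs_zero]; positivity

lemma cpow_log_div {p : ℕ} (hp : p.Prime) (m : ℕ) (t x : ℝ) :
    (((x) * Real.log p ^ m : ℝ) : ℂ) / (p : ℂ) ^ (1 + t * Complex.I)
      = Complex.log p ^ m * ((x / p : ℝ) : ℂ) * (p : ℂ) ^ (-(t * Complex.I)) := by
  have hp' : (p : ℂ) ≠ 0 := by exact_mod_cast hp.ne_zero
  rw [Complex.cpow_add _ _ hp', Complex.cpow_one, Complex.cpow_neg, ← Complex.natCast_log]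
  have h1 : (p : ℂ) ^ (t * Complex.I) ≠ 0 := by simp [Complex.cpow_eq_zero_iff, hp']
  push_cast
  field_simp

lemma sum_primeDev (m : ℕ) (t : ℝ) (N : ℕ) :
    ∑ n ∈ Finset.range N, Complex.log n ^ m * (primeDev h k n : ℂ) * (n : ℂ) ^ (-(t * Complex.I))
      = -∑ p ∈ Nat.primesLE (N - 1),
        (((h p - k) * Real.log p ^ m : ℝ) : ℂ) / (p : ℂ) ^ (1 + t * Complex.I) := by
  rw [← Finset.sum_neg_distrib, ← sum_range_ite_prime]
  refine Finset.sum_congr rfl fun n _ => ?_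
  unfold primeDev
  split_ifs with hp
  · rw [cpow_log_div hp]
    push_cast; ring
  · simp

lemma tempered_deriv_primeDev (h_nonneg : ∀ n, 0 ≤ h n) (hyp : PrimeAverageHypothesis h k) :
    Tempered 0 (deriv (dirSeries (primeDev h k))) := by
  refine (smallCoeff_primeDev h_nonneg hyp).tempered_deriv fun m hm ε hε => ?_
  obtain ⟨C, hC⟩ := hyp.twisted_log m hm ε hε
  refine ⟨C, fun t N => ?_⟩
  rw [sum_primeDev, norm_neg]
  exact hC t (N - 1)

/-- Abel's inequality carries the bound for the sums with p^(1+it) into the strip. After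
exponentiation it becomes growth at most |t|^(1/2). -/
lemma exists_norm_dirSeries_primeDev_le (h_nonneg : ∀ n, 0 ≤ h n)
    (hyp : PrimeAverageHypothesis h k) : ∃ C : ℝ, ∀ s ∈ strip,
      ‖dirSeries (primeDev h k) s‖ ≤ 1 / 2 * Real.log (|s.im| + 2) + C := by
  obtain ⟨δ, hδ, C, hC⟩ := hyp.twisted
  refine ⟨C, fun s hs => ?_⟩
  have h1 : 0 ≤ Real.log (|s.im| + 2) := Real.log_nonneg (one_le_abs_add_two _)
  refine ((smallCoeff_primeDev h_nonneg hyp).norm_dirSeries_le hs.1 fun N => ?_).trans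
    (show (1 / 2 - δ) * Real.log (|s.im| + 2) + C ≤ _ by nlinarith)
  have h2 := sum_primeDev (h := h) (k := k) 0 s.im N
  simp only [pow_zero, one_mul, mul_one] at h2
  rw [h2, norm_neg]
  exact hC s.im (N - 1)

lemma tendsto_dirSeries_primeDev (h_nonneg : ∀ n, 0 ≤ h n) (hyp : PrimeAverageHypothesis h k) :
    ∃ l : ℝ, Tendsto (fun N => ∑ n ∈ Finset.range N, primeDev h k n) atTop (𝓝 l) ∧
      Tendsto (fun x : ℝ => dirSeries (primeDev h k) x) (𝓝[>] 0) (𝓝 l) := by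
  obtain ⟨l, hl⟩ := hyp.convergent
  have h1 : Tendsto (fun N => ∑ n ∈ Finset.range N, primeDev h k n) atTop (𝓝 (-l)) := by
    have h2 := (hl.comp (tendsto_sub_atTop_nat 1)).neg
    refine h2.congr fun N => ?_
    rw [Function.comp_apply, ← Finset.sum_neg_distrib, ← sum_range_ite_prime]
    rfl
  refine ⟨-l, h1, (smallCoeff_primeDev h_nonneg hyp).tendsto_dirSeries ?_⟩
  refine ((Complex.continuous_ofReal.tendsto _).comp h1).congr fun N => ?_
  simp

end

end ArithSeq

/-! ### A branch of log(s ζ(1+s)) and its exponentials. -/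

namespace ArithSeq

/-- The branch of `log (s ζ(1 + s))` given by the Euler product. -/
noncomputable def zetaLog (s : ℂ) : ℂ :=
  dirSeries primeInv s - logRem (fun n => -primeInv n) (fun n => -primeInv n) s + Complex.log s

lemma prod_range_ite_prime {M : Type*} [CommMonoid M] (F : ℕ → M) (N : ℕ) :
    ∏ n ∈ Finset.range N, (if n.Prime then F n else 1) = ∏ p ∈ Nat.primesBelow N, F p := by
  rw [Nat.primesBelow, Finset.prod_filter]

/-- The product of the factors 1 - p^(-1-s) tends both to 1/ζ(1+s) and to the exponential of
`logRem` minus ∑ p^(-1-s); adding log s cancels the pole. -/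
lemma exp_zetaLog {s : ℂ} (hs : 0 < s.re) : Complex.exp (zetaLog s) = (1 + s) * xiFun s := by
  have hs0 : s ≠ 0 := by rintro rfl; simp at hs
  have hs1 : 1 + s ≠ 0 := one_add_ne_zero_of_re (by linarith)
  have hL : Tendsto (fun N => ∑ n ∈ Finset.range N, ((-primeInv n : ℝ) : ℂ) * (n : ℂ) ^ (-s)) atTop
      (𝓝 (-dirSeries primeInv s)) := by
    refine (smallCoeff_primeInv.summable hs).hasSum.tendsto_sum_nat.neg.congr fun N => ?_
    rw [← Finset.sum_neg_distrib]
    exact Finset.sum_congr rfl fun n _ => by push_cast; ring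
  have h1 := logBound_primeInv.tendsto_prod_of_tendsto (s := s) (by linarith) hL
  have h2 := riemannZeta_eulerProduct (s := 1 + s) (by simpa using hs)
  have h3 : riemannZeta (1 + s) * Complex.exp (logRem (fun n => -primeInv n)
      (fun n => -primeInv n) s + -dirSeries primeInv s) = 1 := by
    refine tendsto_nhds_unique (h2.mul h1) (tendsto_const_nhds.congr fun N => ?_)
    have h4 : ∏ n ∈ Finset.range N, (1 + ((-primeInv n : ℝ) : ℂ) * (n : ℂ) ^ (-s))
        = ∏ p ∈ Nat.primesBelow N, (1 - (p : ℂ) ^ (-(1 + s))) := by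
      rw [← prod_range_ite_prime]
      refine Finset.prod_congr rfl fun n _ => ?_
      unfold primeInv
      split_ifs with hn
      · have hn' : (n : ℂ) ≠ 0 := by exact_mod_cast hn.ne_zero
        rw [neg_add, Complex.cpow_add _ _ hn', Complex.cpow_neg_one]
        push_cast; ring
      · simp
    rw [h4, ← Finset.prod_mul_distrib]
    refine (Finset.prod_eq_one fun p hp => inv_mul_cancel₀ ?_).symm
    have hp' := Nat.prime_of_mem_primesBelow hp
    intro h5
    have h6 : ‖(p : ℂ) ^ (-(1 + s))‖ < 1 := by
      rw [Complex.norm_natCast_cpow_of_pos hp'.pos]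
      exact Real.rpow_lt_one_of_one_lt_of_neg (by exact_mod_cast hp'.one_lt) (by simp; linarith)
    rw [← sub_eq_zero.mp h5, norm_one] at h6
    exact lt_irrefl _ h6
  rw [zetaLog, Complex.exp_add, Complex.exp_log hs0, xiFun_eq hs, mul_div_cancel₀ _ hs1, mul_comm]
  congr 1
  set L := logRem (fun n => -primeInv n) (fun n => -primeInv n) s
  set Q := dirSeries primeInv s
  calc Complex.exp (Q - L) = riemannZeta (1 + s) * Complex.exp (L + -Q) * Complex.exp (Q - L) := by
        rw [h3, one_mul]
    _ = _ := by
      rw [mul_assoc, ← Complex.exp_add, show L + -Q + (Q - L) = 0 by ring, Complex.exp_zero, mul_one]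

lemma differentiableOn_zetaLog : DifferentiableOn ℂ zetaLog strip := by
  refine ((smallCoeff_primeInv.differentiableOn.mono fun s hs => hs.1).sub
    (logBound_primeInv.differentiableOn_logRem.mono fun s hs => ?_)).add fun s hs => ?_
  · have := hs.1
    change -(1 / 4) < s.re
    linarith
  · exact (Complex.differentiableAt_log (Or.inl hs.1)).differentiableWithinAt

lemma tempered_one_add : Tempered 1 (fun s : ℂ => 1 + s) := by
  have := ((tempered_const 1).mono zero_le_one).add tempered_id
  exact this.congr fun s _ => rfl

lemma one_le_norm_one_add {s : ℂ} (hs : 0 < s.re) : 1 ≤ ‖1 + s‖ := by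
  refine le_trans ?_ (Complex.abs_re_le_norm _)
  rw [Complex.add_re, Complex.one_re, abs_of_pos (by linarith)]
  linarith

lemma polyBound_inv_one_add : PolyBound 0 (fun s : ℂ => (1 + s)⁻¹) := by
  refine polyBound_of_bounded (C := 1) fun s hs => ?_
  rw [norm_inv]
  exact inv_le_one_of_one_le₀ (one_le_norm_one_add hs.1)

lemma one_add_ne_zero_of_strip {s : ℂ} (hs : s ∈ strip) : 1 + s ≠ 0 :=
  one_add_ne_zero_of_re (by linarith [hs.1])

lemma tempered_inv_one_add : Tempered 0 (fun s : ℂ => (1 + s)⁻¹) := by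
  have hd : DifferentiableOn ℂ (fun s : ℂ => (1 + s)⁻¹) strip :=
    ((differentiableOn_const 1).add differentiableOn_id).inv fun s hs => one_add_ne_zero_of_strip hs
  intro n
  induction n with
  | zero => exact ⟨hd, polyBound_inv_one_add⟩
  | succ n ih =>
    refine ⟨⟨hd, polyBound_inv_one_add⟩, ?_⟩
    have := (tempered_const (-1) n).mul (ih.mul ih)
    simp only [zero_add] at this
    refine this.congr fun s hs => ?_
    have h1 : HasDerivAt (fun s : ℂ => 1 + s) 1 s := by
      simpa using (hasDerivAt_id s).const_add 1
    have h2 := (h1.inv (one_add_ne_zero_of_strip hs)).deriv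
    rw [show (fun s : ℂ => (1 + s)⁻¹) = (fun s : ℂ => 1 + s)⁻¹ from rfl, h2]
    have := one_add_ne_zero_of_strip hs
    field_simp

lemma deriv_zetaLog {s : ℂ} (hs : s ∈ strip) :
    deriv zetaLog s = (1 + s)⁻¹ + deriv xiFun s * (xiFun s)⁻¹ := by
  have h0 : HasDerivAt zetaLog (deriv zetaLog s) s :=
    (differentiableAt_of_strip differentiableOn_zetaLog hs).hasDerivAt
  have h1 := h0.cexp
  have h2 : HasDerivAt (fun s : ℂ => (1 + s) * xiFun s)
      (1 * xiFun s + (1 + s) * deriv xiFun s) s := by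
    refine HasDerivAt.mul ?_ (differentiableAt_xiFun (by linarith [hs.1])).hasDerivAt
    simpa using (hasDerivAt_id s).const_add 1
  have h3 : (fun s => Complex.exp (zetaLog s)) =ᶠ[𝓝 s] fun s => (1 + s) * xiFun s :=
    Filter.eventuallyEq_of_mem (isOpen_strip.mem_nhds hs) fun z hz => exp_zetaLog hz.1
  have h4 := h1.unique (h2.congr_of_eventuallyEq h3)
  rw [exp_zetaLog hs.1] at h4
  have h5 := one_add_ne_zero_of_strip hs
  have h6 := xiFun_ne_zero hs.1.le
  field_simp
  linear_combination h4

lemma tempered_deriv_zetaLog : Tempered 0 (deriv zetaLog) :=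
  (tempered_inv_one_add.add tempered_logDeriv_xiFun).congr fun _ hs => (deriv_zetaLog hs).symm

/-- Growth of the real powers of a zero-free function. -/
lemma polyBound_exp_mul {f L : ℂ → ℂ} {c : ℝ} (hL : ∀ s ∈ strip, Complex.exp (L s) = f s)
    (hf : PolyBound c f) (hf' : PolyBound c fun s => (f s)⁻¹) (β : ℝ) :
    PolyBound (c * |β|) fun s => Complex.exp (β * L s) := by
  have main : ∀ {g M : ℂ → ℂ}, (∀ s ∈ strip, Complex.exp (M s) = g s) → PolyBound c g →
      ∀ β : ℝ, 0 ≤ β → PolyBound (c * β) fun s => Complex.exp (β * M s) := by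
    intro g M hM hg β hβ ε hε
    obtain ⟨C, hC, H⟩ := hg (ε / (β + 1)) (by positivity)
    refine ⟨C ^ β, by positivity, fun s hs => ?_⟩
    have h0 : 0 < |s.im| + 2 := by positivity
    have h1 : ‖Complex.exp (β * M s)‖ = ‖g s‖ ^ β := by
      rw [← hM s hs, Complex.norm_exp, Complex.norm_exp, ← Real.exp_mul, Complex.re_ofReal_mul,
        mul_comm]
    rw [h1]
    calc ‖g s‖ ^ β ≤ (C * (|s.im| + 2) ^ (c + ε / (β + 1))) ^ β :=
          Real.rpow_le_rpow (norm_nonneg _) (H s hs) hβ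
      _ = C ^ β * (|s.im| + 2) ^ ((c + ε / (β + 1)) * β) := by
          rw [Real.mul_rpow hC (by positivity), ← Real.rpow_mul h0.le]
      _ ≤ C ^ β * (|s.im| + 2) ^ (c * β + ε) := by
          gcongr
          · exact one_le_abs_add_two _
          · rw [add_mul]
            have : ε / (β + 1) * β ≤ ε := by
              rw [div_mul_eq_mul_div, div_le_iff₀ (by positivity)]; nlinarith
            linarith
  rcases le_total 0 β with hβ | hβ
  · rw [abs_of_nonneg hβ]
    exact main hL hf β hβ
  · rw [abs_of_nonpos hβ]
    refine (main (M := fun s => -L s) (fun s hs => ?_) hf' (-β) (by linarith)).congr fun s _ => ?_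
    · rw [Complex.exp_neg, hL s hs]
    · push_cast; ring_nf

/-- As (e^f)' = f' e^f, temperedness of f' reduces everything to the size of e^f itself. -/
lemma tempered_exp_of_polyBound {f : ℂ → ℂ} {c : ℝ} (hf : DifferentiableOn ℂ f strip)
    (hf' : Tempered 0 (deriv f)) (hb : PolyBound c fun s => Complex.exp (f s)) :
    Tempered c fun s => Complex.exp (f s) := by
  refine tempered_of_deriv_eq_mul hf.cexp hb hf' fun s hs => ?_
  rw [deriv_cexp (differentiableAt_of_strip hf hs), mul_comm]

lemma tempered_exp_zetaLog (β : ℝ) : Tempered |β| fun s => Complex.exp (β * zetaLog s) := by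
  refine tempered_exp_of_polyBound (differentiableOn_zetaLog.const_mul _) ?_ ?_
  · have := (tempered_const β).mul tempered_deriv_zetaLog
    rw [zero_add] at this
    refine this.congr fun s hs => ?_
    exact (deriv_const_mul _ (differentiableAt_of_strip differentiableOn_zetaLog hs)).symm
  · have h1 : PolyBound 1 fun s => (1 + s) * xiFun s := by
      have := tempered_one_add.polyBound.mul tempered_xiFun.polyBound
      rwa [add_zero] at this
    have h2 : PolyBound 1 fun s => ((1 + s) * xiFun s)⁻¹ := by
      have := polyBound_inv_one_add.mul polyBound_inv_xiFun
      rw [add_zero] at this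
      exact (this.mono zero_le_one).congr fun s _ => (mul_inv _ _).symm
    have := polyBound_exp_mul (fun s hs => exp_zetaLog hs.1) h1 h2 β
    rwa [one_mul] at this

lemma zetaLog_ofReal_im {x : ℝ} (hx : 0 < x) : (zetaLog x).im = 0 := by
  rw [zetaLog, Complex.add_im, Complex.sub_im, smallCoeff_primeInv.dirSeries_ofReal_im hx,
    logBound_primeInv.logRem_ofReal_im hx.le, ← Complex.ofReal_log hx.le, Complex.ofReal_im]
  norm_num

/-- On the positive axis `zetaLog` is real, hence equal to the real logarithm of |(1+x) ξ(x)|, which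
tends to log 1. Realness excludes a multiple of 2πi. -/
lemma tendsto_zetaLog : Tendsto (fun x : ℝ => zetaLog x) (𝓝[>] 0) (𝓝 0) := by
  have h1 : ContinuousAt (fun x : ℝ => (1 + (x : ℂ)) * xiFun x) 0 := by
    refine ContinuousAt.mul (by fun_prop) ?_
    exact ContinuousAt.comp (f := fun x : ℝ => (x : ℂ)) (g := xiFun)
      (differentiableAt_xiFun (by norm_num)).continuousAt Complex.continuous_ofReal.continuousAt
  have h2 : Tendsto (fun x : ℝ => (1 + (x : ℂ)) * xiFun x) (𝓝[>] 0) (𝓝 1) := by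
    have := h1.tendsto.mono_left (nhdsWithin_le_nhds (s := Ioi 0))
    simpa [xiFun_zero] using this
  have h3 : Tendsto (fun x : ℝ => Real.log ‖(1 + (x : ℂ)) * xiFun x‖) (𝓝[>] 0) (𝓝 0) := by
    have := (h2.norm).log (by simp)
    simpa using this
  have h4 := (Complex.continuous_ofReal.tendsto _).comp h3
  rw [Complex.ofReal_zero] at h4
  refine h4.congr' ?_
  filter_upwards [self_mem_nhdsWithin] with x hx
  have hx' : 0 < ((x : ℂ)).re := by simpa using hx
  rw [Function.comp_apply, ← exp_zetaLog hx', Complex.norm_exp, Real.log_exp]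
  exact Complex.ext (by simp) (by simp [zetaLog_ofReal_im hx])

end ArithSeq

/-! ### The regularized Euler product over large primes. -/

namespace ArithSeq

/-- The regularized Euler product over the primes above `P`. -/
noncomputable def eulerReg (h : ArithmeticFunction ℝ) (k : ℝ) (P : ℕ) (s : ℂ) : ℂ :=
  Complex.exp ((1 - k : ℝ) * zetaLog s) * Complex.exp (dirSeries (primeDev h k) s) *
    Complex.exp ((1 - k : ℝ) * logRem (fun n => -primeInv n) (fun n => -primeInv n) s
      + logRem (primeTail h P) (primeMain h) s)

lemma primeMain_eq (h : ArithmeticFunction ℝ) (k : ℝ) (n : ℕ) :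
    primeMain h n = (1 - k) * primeInv n + primeDev h k n := by
  unfold primeMain primeInv primeDev
  split_ifs <;> ring

section

variable {h : ArithmeticFunction ℝ} {k : ℝ} {P : ℕ} {C : ℝ}

lemma tempered_exp_dirSeries_primeDev (h_nonneg : ∀ n, 0 ≤ h n)
    (hyp : PrimeAverageHypothesis h k) :
    Tempered (1 / 2) fun s => Complex.exp (dirSeries (primeDev h k) s) := by
  refine tempered_exp_of_polyBound
    ((smallCoeff_primeDev h_nonneg hyp).differentiableOn.mono fun s hs => hs.1)
    (tempered_deriv_primeDev h_nonneg hyp) fun ε hε => ?_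
  obtain ⟨C, hC⟩ := exists_norm_dirSeries_primeDev_le h_nonneg hyp
  refine ⟨Real.exp C, by positivity, fun s hs => ?_⟩
  have h0 : 0 < |s.im| + 2 := by positivity
  rw [Complex.norm_exp]
  calc Real.exp (dirSeries (primeDev h k) s).re
      ≤ Real.exp (1 / 2 * Real.log (|s.im| + 2) + C) :=
        Real.exp_le_exp.mpr ((Complex.re_le_norm _).trans (hC s hs))
    _ = Real.exp C * (|s.im| + 2) ^ (1 / 2 : ℝ) := by
        rw [add_comm, Real.exp_add, Real.rpow_def_of_pos h0, mul_comm (1 / 2 : ℝ)]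
    _ ≤ _ := by
        gcongr
        · exact one_le_abs_add_two _
        · linarith

lemma tempered_eulerReg (h_nonneg : ∀ n, 0 ≤ h n) (hyp : PrimeAverageHypothesis h k)
    (hb : LogBound (primeTail h P) (primeMain h) C) :
    Tempered (|1 - k| + 1 / 2) (eulerReg h k P) := by
  have h1 : Tempered 0 fun s => (1 - k : ℝ) * logRem (fun n => -primeInv n) (fun n => -primeInv n) s
      + logRem (primeTail h P) (primeMain h) s := by
    have := (tempered_const ((1 - k : ℝ) : ℂ)).mul logBound_primeInv.tempered_logRem
    rw [zero_add] at this
    exact this.add hb.tempered_logRem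
  have h2 := tempered_exp_of_polyBound h1.differentiableOn h1.deriv (c := 0)
    (polyBound_of_bounded (C := Real.exp (|1 - k| *
      (∑' n : ℕ, (2 * 1 ^ 2 + 1) * (n : ℝ) ^ (-(5 / 4) : ℝ))
      + ∑' n : ℕ, (2 * C ^ 2 + C) * (n : ℝ) ^ (-(5 / 4) : ℝ))) fun s hs => by
    have h3 : -(1 / 4) ≤ s.re := by linarith [hs.1]
    rw [Complex.norm_exp]
    refine Real.exp_le_exp.mpr ((Complex.re_le_norm _).trans ((norm_add_le _ _).trans ?_))
    rw [norm_mul, Complex.norm_real, Real.norm_eq_abs]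
    exact add_le_add (mul_le_mul_of_nonneg_left (logBound_primeInv.norm_logRem_le h3)
      (abs_nonneg _)) (hb.norm_logRem_le h3))
  have h4 := ((tempered_exp_zetaLog (1 - k)).mul (tempered_exp_dirSeries_primeDev h_nonneg hyp)).mul h2
  rw [add_zero] at h4
  exact h4

/-- To first order the logarithm is ∑ (1-h(p)) p^(-1-s) = (1-k) ∑ p^(-1-s) - ∑ (h(p)-k) p^(-1-s).
The first sum is -log s plus a function regular at 0, which produces the power s^(k-1). -/
lemma tendsto_prod_primeTail (h_nonneg : ∀ n, 0 ≤ h n) (hyp : PrimeAverageHypothesis h k)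
    (hb : LogBound (primeTail h P) (primeMain h) C) {s : ℂ} (hs : 0 < s.re) :
    Tendsto (fun N => ∏ n ∈ Finset.range N, (1 + (primeTail h P n : ℂ) * (n : ℂ) ^ (-s))) atTop
      (𝓝 (s ^ ((k - 1 : ℝ) : ℂ) * eulerReg h k P s)) := by
  have hs0 : s ≠ 0 := by rintro rfl; simp at hs
  have hL : Tendsto (fun N => ∑ n ∈ Finset.range N, (primeMain h n : ℂ) * (n : ℂ) ^ (-s)) atTop
      (𝓝 ((1 - k : ℝ) * dirSeries primeInv s + dirSeries (primeDev h k) s)) := by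
    have h1 := ((smallCoeff_primeInv.summable hs).hasSum.mul_left (((1 - k : ℝ) : ℂ))).add
      ((smallCoeff_primeDev h_nonneg hyp).summable hs).hasSum
    refine h1.tendsto_sum_nat.congr fun N => Finset.sum_congr rfl fun n _ => ?_
    rw [primeMain_eq h k]
    push_cast; ring
  have h2 := hb.tendsto_prod_of_tendsto (s := s) (by linarith) hL
  convert h2 using 2
  rw [Complex.cpow_def_of_ne_zero hs0, eulerReg, ← Complex.exp_add, ← Complex.exp_add,
    ← Complex.exp_add, zetaLog]
  congr 1
  push_cast
  ring

/-- The value of the regularized Euler product at the origin. -/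
lemma exists_tendsto_eulerReg (h_nonneg : ∀ n, 0 ≤ h n) (hyp : PrimeAverageHypothesis h k)
    (hb : LogBound (primeTail h P) (primeMain h) C) : ∃ X₀ : ℝ, 0 < X₀ ∧
      Tendsto (fun x : ℝ => eulerReg h k P x) (𝓝[>] 0) (𝓝 X₀) ∧
      Tendsto (fun N => ∏ n ∈ Finset.range N, ((1 + primeTail h P n) * (1 - primeInv n) ^ (1 - k)))
        atTop (𝓝 X₀) := by
  obtain ⟨l, hl, hl'⟩ := tendsto_dirSeries_primeDev h_nonneg hyp
  set L₀ := (logRem (fun n => -primeInv n) (fun n => -primeInv n) 0).re with hL₀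
  set L₁ := (logRem (primeTail h P) (primeMain h) 0).re with hL₁
  have real_eq : ∀ {u v : ℕ → ℝ} {C : ℝ}, LogBound u v C →
      logRem u v 0 = ((logRem u v 0).re : ℂ) := fun {u v C} hb => by
    have := hb.logRem_ofReal_im le_rfl
    rw [Complex.ofReal_zero] at this
    exact Complex.ext (by simp) (by simpa using this)
  have real_prod : ∀ {u v : ℕ → ℝ} {C : ℝ}, LogBound u v C →
      Tendsto (fun N => ∏ n ∈ Finset.range N, ((1 + u n) * Real.exp (-(v n)))) atTop
        (𝓝 (Real.exp (logRem u v 0).re)) := fun {u v C} hb => by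
    have h1 := hb.tendsto_prod (s := 0) (by norm_num)
    rw [real_eq hb, ← Complex.ofReal_exp] at h1
    have h2 := (Complex.continuous_re.tendsto _).comp h1
    rw [Complex.ofReal_re] at h2
    refine h2.congr fun N => ?_
    rw [Function.comp_apply, ← Complex.ofReal_re (∏ n ∈ Finset.range N, _)]
    congr 1
    push_cast
    refine Finset.prod_congr rfl fun n _ => ?_
    simp
  refine ⟨Real.exp l * Real.exp ((1 - k) * L₀ + L₁), by positivity, ?_, ?_⟩
  · have h1 : Tendsto (fun x : ℝ => Complex.exp ((1 - k : ℝ) * zetaLog x)) (𝓝[>] 0) (𝓝 1) := by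
      have := (Complex.continuous_exp.tendsto _).comp (tendsto_zetaLog.const_mul ((1 - k : ℝ) : ℂ))
      simpa [Function.comp_def] using this
    have h2 := (Complex.continuous_exp.tendsto _).comp hl'
    have h3 := (Complex.continuous_exp.tendsto _).comp
      ((logBound_primeInv.tendsto_logRem.const_mul ((1 - k : ℝ) : ℂ)).add hb.tendsto_logRem)
    have h4 := (h1.mul h2).mul h3
    rw [real_eq hb, real_eq logBound_primeInv, one_mul] at h4
    push_cast
    push_cast at h4
    exact h4.congr fun x => by simp [eulerReg]
  -- At s = 0 the series of `primeDev` converges, possibly only conditionally. Its exponential, the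
  -- product of (1-1/p)e^(1/p) to the power 1-k, and the product of (1+u)e^(-v) with u =
  -- `primeTail`, v = `primeMain`, multiply together so that all exponentials cancel factor by
  -- factor.
  · have h1 := (real_prod logBound_primeInv).rpow_const (p := 1 - k) (Or.inl (Real.exp_ne_zero _))
    have h2 := (Real.continuous_exp.tendsto _).comp hl
    have h3 := (h2.mul h1).mul (real_prod hb)
    rw [← Real.exp_mul, mul_assoc, ← Real.exp_add, mul_comm _ (1 - k)] at h3
    refine h3.congr fun N => ?_
    have hpos : ∀ n, 0 ≤ 1 + -primeInv n := fun n => by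
      have h4 := logBound_primeInv.norm_mul_cpow_le (s := 0) (by norm_num) n
      simp only [neg_zero, Complex.cpow_zero, mul_one, Complex.norm_real, Real.norm_eq_abs] at h4
      linarith [(abs_le.mp h4).1]
    rw [Function.comp_apply, Real.exp_sum, ← Real.finsetProd_rpow _ _ fun n _ =>
      mul_nonneg (hpos n) (Real.exp_pos _).le, ← Finset.prod_mul_distrib,
      ← Finset.prod_mul_distrib]
    refine Finset.prod_congr rfl fun n _ => ?_
    rw [Real.mul_rpow (hpos n) (Real.exp_pos _).le, ← Real.exp_mul, primeMain_eq h k,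
      ← sub_eq_add_neg]
    have h5 : Real.exp (primeDev h k n) * Real.exp (- -primeInv n * (1 - k))
        * Real.exp (-((1 - k) * primeInv n + primeDev h k n)) = 1 := by
      rw [← Real.exp_add, ← Real.exp_add, ← Real.exp_zero]
      congr 1; ring
    linear_combination ((1 - primeInv n) ^ (1 - k) * (1 + primeTail h P n)) * h5

end

end ArithSeq

/-! ### Local structure of q g_a(q) and of its convolution quotient by 1. -/

namespace ArithSeq

lemma gDensity_one {h : ArithmeticFunction ℝ} (h_mult : h.IsMultiplicative) (a : ℤ) :
    gDensity h a 1 = 1 := by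
  simp [gDensity, h_mult.map_one]

lemma sum_divisors_mul_of_coprime {m n : ℕ} (hmn : m.Coprime n) (F G H : ℕ → ℝ)
    (hF : ∀ d ∈ m.divisors, ∀ e ∈ n.divisors, F (d * e) = G d * H e) :
    ∑ d ∈ (m * n).divisors, F d = (∑ d ∈ m.divisors, G d) * ∑ e ∈ n.divisors, H e := by
  rw [Nat.divisors_mul, ← Finset.image_mul_product, Finset.sum_image hmn.mul_injOn_divisors,
    Finset.sum_product, Finset.sum_mul_sum]
  exact Finset.sum_congr rfl fun d hd => Finset.sum_congr rfl fun e he => hF d hd e he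

lemma gDensity_mul {h : ArithmeticFunction ℝ} (h_mult : h.IsMultiplicative) (a : ℤ) {m n : ℕ}
    (hmn : m.Coprime n) : gDensity h a (m * n) = gDensity h a m * gDensity h a n := by
  have hg : ∀ q : ℕ, Int.gcd q a = Nat.gcd q a.natAbs := fun q => by simp [Int.gcd]
  have hgm := Nat.gcd_dvd_left m a.natAbs
  have hgn := Nat.gcd_dvd_left n a.natAbs
  have h1 : Nat.gcd (m * n) a.natAbs = Nat.gcd m a.natAbs * Nat.gcd n a.natAbs := by
    rw [Nat.gcd_comm, hmn.gcd_mul, Nat.gcd_comm, Nat.gcd_comm _ n]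
  unfold gDensity
  simp only [hg, h1]
  set g₁ := Nat.gcd m a.natAbs
  set g₂ := Nat.gcd n a.natAbs
  have hd₁ : m / g₁ ∣ m := Nat.div_dvd_of_dvd hgm
  have hd₂ : n / g₂ ∣ n := Nat.div_dvd_of_dvd hgn
  have hq : (m / g₁).Coprime (n / g₂) := (hmn.coprime_dvd_left hd₁).coprime_dvd_right hd₂
  rw [Nat.mul_div_mul_comm hgm hgn, Nat.totient_mul hq,
    sum_divisors_mul_of_coprime hq _
      (fun d => (ArithmeticFunction.moebius d : ℝ) * (h (g₁ * d) / ((g₁ : ℝ) * d)))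
      (fun d => (ArithmeticFunction.moebius d : ℝ) * (h (g₂ * d) / ((g₂ : ℝ) * d))) ?_]
  · push_cast
    rw [one_div, one_div, one_div, mul_inv]
    ring
  · intro d hd e he
    have hde₁ : g₁ * d ∣ m := by
      have := Nat.mul_dvd_mul_left g₁ (Nat.dvd_of_mem_divisors hd)
      rwa [Nat.mul_div_cancel' hgm] at this
    have hde₂ : g₂ * e ∣ n := by
      have := Nat.mul_dvd_mul_left g₂ (Nat.dvd_of_mem_divisors he)
      rwa [Nat.mul_div_cancel' hgn] at this
    have hc : (g₁ * d).Coprime (g₂ * e) := (hmn.coprime_dvd_left hde₁).coprime_dvd_right hde₂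
    have hc' : d.Coprime e :=
      (hc.coprime_dvd_left (Dvd.intro_left g₁ rfl)).coprime_dvd_right (Dvd.intro_left g₂ rfl)
    rw [show g₁ * g₂ * (d * e) = g₁ * d * (g₂ * e) by ring, h_mult.map_mul_of_coprime hc,
      ArithmeticFunction.isMultiplicative_moebius.map_mul_of_coprime hc']
    push_cast
    rw [div_eq_mul_inv, div_eq_mul_inv, div_eq_mul_inv]
    rw [show (g₁ : ℝ) * g₂ * (d * e) = (g₁ * d) * (g₂ * e) by ring, mul_inv]
    ring

/-- The arithmetic function `q ↦ q g_a(q)`. -/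
noncomputable def scaledDensity (h : ArithmeticFunction ℝ) (a : ℤ) : ArithmeticFunction ℝ :=
  ⟨fun q => q * gDensity h a q, by simp⟩

lemma scaledDensity_apply (h : ArithmeticFunction ℝ) (a : ℤ) (q : ℕ) :
    scaledDensity h a q = q * gDensity h a q := rfl

lemma isMultiplicative_scaledDensity {h : ArithmeticFunction ℝ} (h_mult : h.IsMultiplicative)
    (a : ℤ) : (scaledDensity h a).IsMultiplicative := by
  refine ⟨by simp [scaledDensity_apply, gDensity_one h_mult], fun {m n} hmn => ?_⟩
  rw [scaledDensity_apply, scaledDensity_apply, scaledDensity_apply, gDensity_mul h_mult a hmn]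
  push_cast; ring

/-- The local constant `(h(p^f) - h(p^(f+1)) / p) / (1 - 1/p)`. -/
noncomputable def localConst (h : ArithmeticFunction ℝ) (a : ℤ) (p : ℕ) : ℝ :=
  (h (p ^ padicValInt p a) - h (p ^ (padicValInt p a + 1)) / p) / (1 - 1 / (p : ℝ))

lemma gcd_prime_pow {a : ℤ} (ha : a ≠ 0) {p : ℕ} (hp : p.Prime) (e : ℕ) :
    Int.gcd (p ^ e : ℕ) a = p ^ min e (padicValInt p a) := by
  have : Fact p.Prime := ⟨hp⟩
  have h1 : Int.gcd (p ^ e : ℕ) a = Nat.gcd (p ^ e) a.natAbs := by simp [Int.gcd]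
  have ha' : a.natAbs ≠ 0 := Int.natAbs_ne_zero.mpr ha
  rw [h1]
  obtain ⟨i, hi, hi'⟩ := (Nat.dvd_prime_pow hp).mp (Nat.gcd_dvd_left (p ^ e) a.natAbs)
  rw [hi']
  congr 1
  refine le_antisymm (le_min hi ?_) ?_
  · rw [padicValInt, ← padicValNat_dvd_iff_le ha', ← hi']
    exact Nat.gcd_dvd_right _ _
  · rw [← Nat.pow_dvd_pow_iff_le_right hp.one_lt, ← hi']
    refine Nat.dvd_gcd (pow_dvd_pow _ (min_le_left _ _)) ?_
    rw [padicValNat_dvd_iff_le ha']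
    exact min_le_right _ _

lemma scaledDensity_prime_pow_of_le (h : ArithmeticFunction ℝ) {a : ℤ} (ha : a ≠ 0) {p : ℕ}
    (hp : p.Prime) {e : ℕ} (he : e ≤ padicValInt p a) : scaledDensity h a (p ^ e) = h (p ^ e) := by
  have hpe : p ^ e ≠ 0 := pow_ne_zero _ hp.ne_zero
  have hpe' : ((p : ℝ) ^ e) ≠ 0 := by exact_mod_cast hpe
  rw [scaledDensity_apply, gDensity, gcd_prime_pow ha hp, min_eq_left he,
    Nat.div_self (Nat.pos_of_ne_zero hpe)]
  simp
  field_simp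

/-- Once e exceeds the exponent f of p in a, the gcd stays p^f and the Möbius sum keeps only d = 1
and d = p; the powers of p cancel against φ. Constancy in e makes `coeff` vanish beyond p^(f+1). -/
lemma scaledDensity_prime_pow_of_lt (h : ArithmeticFunction ℝ) {a : ℤ} (ha : a ≠ 0) {p : ℕ}
    (hp : p.Prime) {e : ℕ} (he : padicValInt p a < e) :
    scaledDensity h a (p ^ e) = localConst h a p := by
  have hp1 : (1 : ℝ) < p := by exact_mod_cast hp.one_lt
  have hp0 : (p : ℝ) ≠ 0 := by linarith
  have hp2 : (p : ℝ) - 1 ≠ 0 := by linarith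
  obtain ⟨j, rfl⟩ := Nat.exists_eq_add_of_lt he
  rw [scaledDensity_apply, gDensity, gcd_prime_pow ha hp, min_eq_right he.le]
  set f := padicValInt p a with hf
  have h1 : p ^ (f + j + 1) / p ^ f = p ^ (j + 1) := by
    rw [add_assoc, pow_add, Nat.mul_div_cancel_left _ (pow_pos hp.pos f)]
  have h2 : (ArithmeticFunction.moebius p : ℤ) = -1 := ArithmeticFunction.moebius_apply_prime hp
  rw [h1, Nat.totient_prime_pow hp (Nat.succ_pos j), Nat.sum_divisors_prime_pow hp,
    Finset.sum_range_succ', Finset.sum_range_succ', Finset.sum_eq_zero, localConst]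
  · simp only [zero_add, pow_one, pow_zero, mul_one, h2, ArithmeticFunction.moebius_apply_one,
      Nat.succ_eq_add_one, Nat.add_sub_cancel, Nat.cast_mul, Nat.cast_pow, Nat.cast_pred hp.pos]
    push_cast
    rw [← hf, ← pow_succ]
    field_simp
    ring
  · intro i _
    have h3 : ArithmeticFunction.moebius (p ^ (i + 1 + 1)) = 0 := by
      rw [ArithmeticFunction.moebius_apply_prime_pow hp (by omega), if_neg (by omega)]
    rw [h3]
    simp

/-- The Dirichlet convolution quotient of `q ↦ q g_a(q)` by `1`. -/
noncomputable def coeff (h : ArithmeticFunction ℝ) (a : ℤ) : ArithmeticFunction ℝ :=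
  (ArithmeticFunction.moebius : ArithmeticFunction ℝ) * scaledDensity h a

lemma isMultiplicative_coeff {h : ArithmeticFunction ℝ} (h_mult : h.IsMultiplicative) (a : ℤ) :
    (coeff h a).IsMultiplicative :=
  ArithmeticFunction.isMultiplicative_moebius.intCast.mul (isMultiplicative_scaledDensity h_mult a)

lemma sum_divisors_coeff (h : ArithmeticFunction ℝ) (a : ℤ) (q : ℕ) :
    ∑ d ∈ q.divisors, coeff h a d = scaledDensity h a q := by
  rw [← ArithmeticFunction.coe_zeta_mul_apply, coeff, ← mul_assoc,
    ArithmeticFunction.coe_zeta_mul_coe_moebius, one_mul]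

lemma coeff_prime_pow_succ (h : ArithmeticFunction ℝ) (a : ℤ) {p : ℕ} (hp : p.Prime) (e : ℕ) :
    coeff h a (p ^ (e + 1)) = scaledDensity h a (p ^ (e + 1)) - scaledDensity h a (p ^ e) := by
  rw [← sum_divisors_coeff, ← sum_divisors_coeff, Nat.sum_divisors_prime_pow hp,
    Nat.sum_divisors_prime_pow hp, Finset.sum_range_succ]
  ring

lemma coeff_prime_pow_eq_zero (h : ArithmeticFunction ℝ) {a : ℤ} (ha : a ≠ 0) {p : ℕ}
    (hp : p.Prime) {e : ℕ} (he : padicValInt p a + 1 < e) : coeff h a (p ^ e) = 0 := by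
  obtain ⟨j, rfl⟩ := Nat.exists_eq_add_of_lt he
  rw [coeff_prime_pow_succ h a hp, scaledDensity_prime_pow_of_lt h ha hp (by omega),
    scaledDensity_prime_pow_of_lt h ha hp (by omega), sub_self]

/-- The local factor of the Dirichlet series of `coeff`. -/
noncomputable def localFactor (h : ArithmeticFunction ℝ) (a : ℤ) (p : ℕ) (x : ℂ) : ℂ :=
  (1 - x) * ∑ j ∈ Finset.range (padicValInt p a + 1), (h (p ^ j) : ℂ) * x ^ j
    + (localConst h a p : ℂ) * x ^ (padicValInt p a + 1)

/-- Summation by parts isolates the factor 1 - x of the local series. With x = p^(-s) it becomes the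
zero at s = 0 of an exceptional prime. -/
lemma sum_range_sub_mul_pow (θ : ℕ → ℂ) (x : ℂ) (n : ℕ) :
    θ 0 + ∑ j ∈ Finset.range (n + 1), (θ (j + 1) - θ j) * x ^ (j + 1)
      = (1 - x) * ∑ j ∈ Finset.range (n + 1), θ j * x ^ j + θ (n + 1) * x ^ (n + 1) := by
  induction n with
  | zero => simp; ring
  | succ n ih =>
    rw [Finset.sum_range_succ, ← add_assoc, ih, Finset.sum_range_succ _ (n + 1)]
    ring

lemma hasSum_coeff_prime_pow {h : ArithmeticFunction ℝ} (h_mult : h.IsMultiplicative) {a : ℤ}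
    (ha : a ≠ 0) {p : ℕ} (hp : p.Prime) (x : ℂ) :
    HasSum (fun e : ℕ => (coeff h a (p ^ e) : ℂ) * x ^ e) (localFactor h a p x) := by
  have h1 : HasSum (fun e : ℕ => (coeff h a (p ^ e) : ℂ) * x ^ e)
      (∑ e ∈ Finset.range (padicValInt p a + 1 + 1), (coeff h a (p ^ e) : ℂ) * x ^ e) := by
    refine hasSum_sum_of_ne_finset_zero fun e he => ?_
    rw [coeff_prime_pow_eq_zero h ha hp (by simpa using he)]
    simp
  convert h1 using 1
  rw [Finset.sum_range_succ', add_comm]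
  have h2 := sum_range_sub_mul_pow (fun j => (scaledDensity h a (p ^ j) : ℂ)) x (padicValInt p a)
  simp only [coeff_prime_pow_succ h a hp, pow_zero, (isMultiplicative_coeff h_mult a).map_one,
    (isMultiplicative_scaledDensity h_mult a).map_one] at h2 ⊢
  push_cast
  push_cast at h2
  rw [mul_one, h2, localFactor, scaledDensity_prime_pow_of_lt h ha hp (Nat.lt_succ_self _)]
  congr 2
  refine Finset.sum_congr rfl fun j hj => ?_
  rw [scaledDensity_prime_pow_of_le h ha hp (Nat.lt_succ_iff.mp (Finset.mem_range.mp hj))]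

lemma padicValInt_eq_zero_of_lt {a : ℤ} (ha : a ≠ 0) {p : ℕ} (hp : a.natAbs < p) :
    padicValInt p a = 0 := by
  rw [padicValInt]
  exact padicValNat.eq_zero_of_not_dvd fun hd =>
    absurd (Nat.le_of_dvd (Int.natAbs_pos.mpr ha) hd) (by omega)

lemma localConst_of_lt {h : ArithmeticFunction ℝ} (h_mult : h.IsMultiplicative) {a : ℤ}
    (ha : a ≠ 0) {p : ℕ} (hp : p.Prime) (hpa : a.natAbs < p) :
    localConst h a p = 1 + (1 - h p) / ((p : ℝ) - 1) := by
  have hp1 : (1 : ℝ) < p := by exact_mod_cast hp.one_lt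
  have hp0 : (p : ℝ) ≠ 0 := by linarith
  have hp2 : (p : ℝ) - 1 ≠ 0 := by linarith
  rw [localConst, padicValInt_eq_zero_of_lt ha hpa, zero_add, pow_zero, pow_one, h_mult.map_one]
  field_simp
  ring

lemma localFactor_of_lt {h : ArithmeticFunction ℝ} (h_mult : h.IsMultiplicative) {a : ℤ}
    (ha : a ≠ 0) {p : ℕ} (hp : p.Prime) (hpa : a.natAbs < p) (x : ℂ) :
    localFactor h a p x = 1 + (((1 - h p) / ((p : ℝ) - 1) : ℝ) : ℂ) * x := by
  rw [localFactor, localConst_of_lt h_mult ha hp hpa, padicValInt_eq_zero_of_lt ha hpa]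
  simp [h_mult.map_one]
  ring

end ArithSeq

/-! ### Absolute convergence of the Dirichlet series with a polynomial bound in 1/σ. -/

namespace ArithSeq

lemma re_mul_natCast_cpow (c x : ℝ) (n : ℕ) :
    ((c : ℂ) * (n : ℂ) ^ (-(x : ℂ))).re = c * (n : ℝ) ^ (-x) := by
  have h3 : (n : ℂ) ^ (-(x : ℂ)) = (((n : ℝ) ^ (-x) : ℝ) : ℂ) := by
    rw [Complex.ofReal_cpow (Nat.cast_nonneg n)]; push_cast; rfl
  rw [h3, ← Complex.ofReal_mul, Complex.ofReal_re]

lemma SmallCoeff.hasSum_re {c : ℕ → ℝ} (hc : SmallCoeff c) {x : ℝ} (hx : 0 < x) :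
    HasSum (fun n : ℕ => c n * (n : ℝ) ^ (-x)) (dirSeries c x).re := by
  have h1 := Complex.hasSum_re (hc.summable (s := x) (by simpa)).hasSum
  simp only [re_mul_natCast_cpow] at h1
  exact h1

/-- The prime sum of `(1 + h p) / p ^ (1 + x)`. -/
lemma exists_primeSum_le {h : ArithmeticFunction ℝ} {k : ℝ} (h_nonneg : ∀ n, 0 ≤ h n)
    (hyp : PrimeAverageHypothesis h k) (K : ℝ) (hK : 0 ≤ K) :
    ∃ C₀ C₁ : ℝ, 0 ≤ C₀ ∧ ∀ σ : ℝ, 0 < σ → σ ≤ 1 / 4 → ∀ N : ℕ,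
      Real.exp (K * ∑ p ∈ Nat.primesBelow N, (1 + h p) / p * (p : ℝ) ^ (-σ)) ≤ C₀ * σ ^ (-C₁) := by
  have hk := hyp.nonneg_k
  obtain ⟨B, hB⟩ := exists_norm_dirSeries_primeDev_le h_nonneg hyp
  obtain ⟨C, hC0, hC⟩ := (tempered_one_add.mul tempered_xiFun).polyBound 1 one_pos
  set R := ∑' n : ℕ, ((2 : ℝ) * 1 ^ 2 + 1) * (n : ℝ) ^ (-(5 / 4) : ℝ) with hR
  -- This is ∑ p^(-1-x) = log(1/x) + O(1) in exponential form, from `exp_zetaLog` on the real axis.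
  have hinv : ∀ x : ℝ, 0 < x → x < 1 / 4 →
      Real.exp (dirSeries primeInv x).re ≤ C * 2 ^ (1 + 0 + 1 : ℝ) * Real.exp R * x⁻¹ := by
    intro x hx hx4
    have hs : (x : ℂ) ∈ strip := ⟨by simpa, by simpa using hx4⟩
    have h1 : (dirSeries primeInv x).re = (zetaLog x).re
        + (logRem (fun n => -primeInv n) (fun n => -primeInv n) x).re + -Real.log x := by
      rw [zetaLog, ← Complex.ofReal_log hx.le]
      simp only [Complex.add_re, Complex.sub_re, Complex.ofReal_re]
      ring
    rw [h1, Real.exp_add, Real.exp_add, Real.exp_neg, Real.exp_log hx, ← Complex.norm_exp,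
      exp_zetaLog hs.1]
    have h2 := hC x hs
    simp only [Complex.ofReal_im, abs_zero, zero_add] at h2
    have h3 : (logRem (fun n => -primeInv n) (fun n => -primeInv n) x).re ≤ R :=
      (Complex.re_le_norm _).trans (logBound_primeInv.norm_logRem_le (by simp; linarith))
    gcongr
  set E := K * (1 + k) with hE
  have hE0 : 0 ≤ E := by positivity
  set A := C * 2 ^ (1 + 0 + 1 : ℝ) * Real.exp R with hA
  have hA0 : 0 ≤ A := by positivity
  refine ⟨(A * 2) ^ E * Real.exp (K * (1 / 2 * Real.log 2 + B)), E, by positivity,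
    fun σ hσ hσ4 N => ?_⟩
  -- The series are evaluated at σ/2, which lies in the open strip even for σ = 1/4; the nonnegative
  -- sum at σ is smaller.
  have hx0 : 0 < σ / 2 := by positivity
  have hs : ((σ / 2 : ℝ) : ℂ) ∈ strip := by
    constructor
    · rw [Complex.ofReal_re]; exact hx0
    · rw [Complex.ofReal_re]; linarith
  have hsum := ((smallCoeff_primeInv.hasSum_re hx0).mul_left (1 + k)).sub
    ((smallCoeff_primeDev h_nonneg hyp).hasSum_re hx0)
  have hterm : ∀ n : ℕ, (1 + k) * (primeInv n * (n : ℝ) ^ (-(σ / 2)))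
      - primeDev h k n * (n : ℝ) ^ (-(σ / 2))
      = if n.Prime then (1 + h n) / n * (n : ℝ) ^ (-(σ / 2)) else 0 := by
    intro n
    unfold primeInv primeDev
    split_ifs <;> ring
  simp only [hterm] at hsum
  have h4 : ∑ p ∈ Nat.primesBelow N, (1 + h p) / p * (p : ℝ) ^ (-σ)
      ≤ (1 + k) * (dirSeries primeInv (σ / 2 : ℝ)).re
        - (dirSeries (primeDev h k) (σ / 2 : ℝ)).re := by
    refine le_trans ?_ (sum_le_hasSum (Finset.range N) (fun n _ => ?_) hsum)
    · rw [Nat.primesBelow, Finset.sum_filter]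
      refine Finset.sum_le_sum fun n _ => ?_
      split_ifs with hn
      · have hn1 : (1 : ℝ) ≤ n := by exact_mod_cast hn.one_lt.le
        have := h_nonneg n
        gcongr
        linarith
      · exact le_rfl
    · have := h_nonneg n
      split_ifs <;> positivity
  have h5 : -(dirSeries (primeDev h k) (σ / 2 : ℝ)).re ≤ 1 / 2 * Real.log 2 + B := by
    have := hB _ hs
    rw [Complex.ofReal_im, abs_zero, zero_add] at this
    exact (neg_le_abs _).trans ((Complex.abs_re_le_norm _).trans this)
  have h6 := hinv (σ / 2) hx0 (by linarith)
  calc Real.exp (K * ∑ p ∈ Nat.primesBelow N, (1 + h p) / p * (p : ℝ) ^ (-σ))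
      ≤ Real.exp ((dirSeries primeInv (σ / 2 : ℝ)).re * E + K * (1 / 2 * Real.log 2 + B)) := by
        refine Real.exp_le_exp.mpr ?_
        calc _ ≤ K * ((1 + k) * (dirSeries primeInv (σ / 2 : ℝ)).re
              + (1 / 2 * Real.log 2 + B)) := mul_le_mul_of_nonneg_left (by linarith) hK
          _ = _ := by rw [hE]; ring
    _ = Real.exp (dirSeries primeInv (σ / 2 : ℝ)).re ^ E
          * Real.exp (K * (1 / 2 * Real.log 2 + B)) := by rw [Real.exp_add, Real.exp_mul]
    _ ≤ (A * (σ / 2)⁻¹) ^ E * Real.exp (K * (1 / 2 * Real.log 2 + B)) := by gcongr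
    _ = _ := by
      rw [show A * (σ / 2)⁻¹ = A * 2 * σ⁻¹ by field_simp, Real.mul_rpow (by positivity) (by positivity),
        Real.inv_rpow hσ.le, ← Real.rpow_neg hσ.le]
      ring

section

variable {h : ArithmeticFunction ℝ} {a : ℤ}

/-- For p > |a| only the coefficient (1 - h(p))/(p - 1) at p occurs. The finitely many primes p ≤
|a| are absorbed into K. -/
lemma exists_sum_abs_coeff_le (h_mult : h.IsMultiplicative) (h_nonneg : ∀ n, 0 ≤ h n)
    (ha : a ≠ 0) : ∃ K : ℝ, 0 ≤ K ∧ ∀ p : ℕ, p.Prime →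
      ∑ e ∈ Finset.range (padicValInt p a + 1), |coeff h a (p ^ (e + 1))| ≤ K * ((1 + h p) / p) := by
  set S : ℕ → ℝ := fun p =>
    p * ∑ e ∈ Finset.range (padicValInt p a + 1), |coeff h a (p ^ (e + 1))| with hS
  have hS0 : ∀ p, 0 ≤ S p := fun p =>
    mul_nonneg (Nat.cast_nonneg _) (Finset.sum_nonneg fun _ _ => abs_nonneg _)
  have hT0 : 0 ≤ ∑ p ∈ Finset.range (a.natAbs + 1), S p := Finset.sum_nonneg fun p _ => hS0 p
  refine ⟨2 + ∑ p ∈ Finset.range (a.natAbs + 1), S p, by positivity, fun p hp => ?_⟩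
  have hp2 : (2 : ℝ) ≤ p := by exact_mod_cast hp.two_le
  have hp0 : (0 : ℝ) < p := by linarith
  have hhp := h_nonneg p
  rw [← mul_div_assoc, le_div_iff₀ hp0, mul_comm]
  change S p ≤ _
  rcases lt_or_ge a.natAbs p with hpa | hpa
  · have h1 : S p ≤ 2 * (1 + h p) := by
      simp only [hS, padicValInt_eq_zero_of_lt ha hpa, zero_add, Finset.sum_range_one]
      have h2 := coeff_prime_pow_succ h a hp 0
      rw [zero_add] at h2
      rw [h2, scaledDensity_prime_pow_of_lt h ha hp (by rw [padicValInt_eq_zero_of_lt ha hpa]; simp),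
        pow_zero, (isMultiplicative_scaledDensity h_mult a).map_one,
        localConst_of_lt h_mult ha hp hpa, add_sub_cancel_left, abs_div,
        abs_of_pos (show (0 : ℝ) < p - 1 by linarith), mul_div_assoc', div_le_iff₀ (by linarith)]
      have h3 : |1 - h p| ≤ 1 + h p := by rw [abs_le]; constructor <;> linarith
      calc (p : ℝ) * |1 - h p| ≤ (2 * (p - 1)) * (1 + h p) :=
            mul_le_mul (by linarith) h3 (abs_nonneg _) (by linarith)
        _ = _ := by ring
    exact h1.trans (mul_le_mul_of_nonneg_right (by linarith) (by linarith))
  · have h1 : S p ≤ ∑ p ∈ Finset.range (a.natAbs + 1), S p :=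
      Finset.single_le_sum (fun p _ => hS0 p) (Finset.mem_range.mpr (by omega))
    have h2 : (1 : ℝ) ≤ 1 + h p := by linarith
    nlinarith

/-- Every d with 1 ≤ d < N has only prime factors below N, so the partial sum is at most the finite
Euler product over p < N. By 1 + y ≤ e^y this is at most exp(K ∑ (1+h(p)) p^(-1-σ)), a power of 1/σ.
-/
lemma exists_sumBound_coeff {k : ℝ} (h_mult : h.IsMultiplicative) (h_nonneg : ∀ n, 0 ≤ h n)
    (hyp : PrimeAverageHypothesis h k) (ha : a ≠ 0) :
    ∃ C₀ C₁ : ℝ, SumBound (coeff h a) C₀ C₁ := by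
  obtain ⟨K, hK, hcoeff⟩ := exists_sum_abs_coeff_le h_mult h_nonneg ha
  obtain ⟨C₀, C₁, hC₀, hbound⟩ := exists_primeSum_le h_nonneg hyp K hK
  have hmul := isMultiplicative_coeff h_mult a
  have main : ∀ σ : ℝ, 0 < σ → σ ≤ 1 / 4 → ∀ N : ℕ,
      ∑ d ∈ Finset.range N, |coeff h a d| * (d : ℝ) ^ (-σ) ≤ C₀ * σ ^ (-C₁) := by
    intro σ hσ hσ4 N
    set f : ℕ → ℝ := fun d => |coeff h a d| * (d : ℝ) ^ (-σ) with hf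
    have hf0 : ∀ d, 0 ≤ f d := fun d => by positivity
    have hf1 : f 1 = 1 := by simp [hf, hmul.map_one]
    have hfmul : ∀ {m n : ℕ}, m.Coprime n → f (m * n) = f m * f n := by
      intro m n hmn
      simp only [hf]
      rw [hmul.map_mul_of_coprime hmn, abs_mul, Nat.cast_mul,
        Real.mul_rpow (Nat.cast_nonneg _) (Nat.cast_nonneg _)]
      ring
    have hfs : ∀ {p : ℕ}, p.Prime → HasSum (fun e : ℕ => f (p ^ e))
        (∑ e ∈ Finset.range (padicValInt p a + 1 + 1), f (p ^ e)) := by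
      intro p hp
      refine hasSum_sum_of_ne_finset_zero fun e he => ?_
      simp only [hf]
      rw [coeff_prime_pow_eq_zero h ha hp (by simpa using he), abs_zero, zero_mul]
    have hprod := EulerProduct.summable_and_hasSum_factoredNumbers_prod_filter_prime_tsum hf1 hfmul
      (fun {p} hp => ((hfs hp).summable).norm) (Finset.range N)
    rw [← Nat.smoothNumbers_eq_factoredNumbers] at hprod
    have h1 : ∑ d ∈ Finset.range N, f d
        ≤ ∏ p ∈ Finset.range N with p.Prime, ∑' e : ℕ, f (p ^ e) := by
      refine le_trans (Finset.sum_le_sum fun d hd => ?_) (sum_le_hasSum (Finset.range N)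
        (fun d _ => Set.indicator_nonneg (fun d _ => hf0 d) d)
        (hasSum_subtype_iff_indicator.mp hprod.2))
      rcases Nat.eq_zero_or_pos d with rfl | hd0
      · refine le_of_eq_of_le ?_ (Set.indicator_nonneg (fun d _ => hf0 d) 0)
        simp [hf]
      · rw [Set.indicator_of_mem]
        exact Nat.mem_smoothNumbers_of_lt hd0 (Finset.mem_range.mp hd)
    refine h1.trans (le_trans ?_ (hbound σ hσ hσ4 N))
    rw [Finset.mul_sum, Real.exp_sum]
    refine Finset.prod_le_prod (fun p _ => tsum_nonneg fun e => hf0 _) fun p hp => ?_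
    have hp' := Nat.prime_of_mem_primesBelow hp
    have hp1 : (1 : ℝ) ≤ p := by exact_mod_cast hp'.one_lt.le
    rw [(hfs hp').tsum_eq, Finset.sum_range_succ', pow_zero, hf1, add_comm, add_comm (1 : ℝ)]
    refine le_trans ?_ (Real.add_one_le_exp _)
    refine add_le_add_left ?_ 1
    calc ∑ e ∈ Finset.range (padicValInt p a + 1), f (p ^ (e + 1))
        ≤ ∑ e ∈ Finset.range (padicValInt p a + 1),
            |coeff h a (p ^ (e + 1))| * (p : ℝ) ^ (-σ) := by
          refine Finset.sum_le_sum fun e _ => ?_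
          simp only [hf]
          refine mul_le_mul_of_nonneg_left ?_ (abs_nonneg _)
          refine Real.rpow_le_rpow_of_nonpos (by linarith) ?_ (by linarith)
          exact_mod_cast Nat.le_self_pow (Nat.succ_ne_zero e) p
      _ ≤ K * ((1 + h p) / p) * (p : ℝ) ^ (-σ) := by
          rw [← Finset.sum_mul]
          exact mul_le_mul_of_nonneg_right (hcoeff p hp') (by positivity)
      _ = _ := by ring
  refine ⟨C₀, C₁, ⟨by simp, hC₀, fun σ hσ hσ4 => ?_, fun σ hσ hσ4 => ?_⟩⟩
  · exact summable_of_sum_range_le (fun d => by positivity) (main σ hσ hσ4)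
  · exact Real.tsum_le_of_sum_range_le (fun d => by positivity) (main σ hσ hσ4)

end

end ArithSeq

/-! ### Factorization of the Dirichlet series and its behaviour at s = 0. -/

namespace ArithSeq

lemma prod_primesBelow_split {M : Type*} [CommMonoid M] (F : ℕ → M) {P N : ℕ} (hPN : P < N) :
    ∏ p ∈ Nat.primesBelow N, F p = (∏ p ∈ Nat.primesLE P, F p) *
      ∏ n ∈ Finset.range N, (if n.Prime ∧ P < n then F n else 1) := by
  have h1 : ∏ p ∈ Nat.primesLE P, F p
      = ∏ n ∈ Finset.range N, (if n.Prime ∧ n ≤ P then F n else 1) := by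
    rw [← Finset.prod_filter]
    refine Finset.prod_congr ?_ fun _ _ => rfl
    ext n
    simp only [Nat.mem_primesLE, Finset.mem_filter, Finset.mem_range]
    constructor
    · exact fun h => ⟨by omega, h.2, h.1⟩
    · exact fun h => ⟨h.2.2, h.2.1⟩
  rw [h1, ← Finset.prod_mul_distrib, ← prod_range_ite_prime]
  refine Finset.prod_congr rfl fun n _ => ?_
  by_cases hn : n.Prime <;> by_cases hP : n ≤ P
  · simp [hn, hP, not_lt.mpr hP]
  · simp [hn, hP, not_le.mp hP]
  · simp [hn]
  · simp [hn]

section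

variable {h : ArithmeticFunction ℝ} {a : ℤ} {k : ℝ} {P : ℕ} {C : ℝ}

/-- The Euler product of the Dirichlet series of `coeff`. -/
lemma dirSeries_coeff (h_mult : h.IsMultiplicative) (h_nonneg : ∀ n, 0 ≤ h n)
    (hyp : PrimeAverageHypothesis h k) (ha : a ≠ 0) (hP : a.natAbs ≤ P)
    (hb : LogBound (primeTail h P) (primeMain h) C) {s : ℂ} (hs : s ∈ strip) :
    dirSeries (coeff h a) s = (∏ p ∈ Nat.primesLE P, localFactor h a p ((p : ℂ) ^ (-s))) *
      (s ^ ((k - 1 : ℝ) : ℂ) * eulerReg h k P s) := by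
  obtain ⟨C₀, C₁, hsb⟩ := exists_sumBound_coeff h_mult h_nonneg hyp ha
  have hmul := isMultiplicative_coeff h_mult a
  set f : ℕ → ℂ := fun d => (coeff h a d : ℂ) * (d : ℂ) ^ (-s) with hf
  have hf1 : f 1 = 1 := by simp [hf, hmul.map_one]
  have hf0 : f 0 = 0 := by simp [hf]
  have hfmul : ∀ {m n : ℕ}, m.Coprime n → f (m * n) = f m * f n := by
    intro m n hmn
    simp only [hf]
    rw [hmul.map_mul_of_coprime hmn, Nat.cast_mul, Complex.natCast_mul_natCast_cpow]
    push_cast; ring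
  have hfs : Summable fun d => ‖f d‖ := by
    refine (hsb.summable s.re hs.1 hs.2.le).congr fun d => ?_
    rcases Nat.eq_zero_or_pos d with rfl | hd
    · simp [hf]
    · simp only [hf]
      rw [norm_mul, Complex.norm_natCast_cpow_of_pos hd, Complex.norm_real, Real.norm_eq_abs,
        Complex.neg_re]
  have h1 := EulerProduct.eulerProduct hf1 hfmul hfs hf0
  have hlocal : ∀ p : ℕ, p.Prime → ∑' e : ℕ, f (p ^ e) = localFactor h a p ((p : ℂ) ^ (-s)) := by
    intro p hp
    rw [← (hasSum_coeff_prime_pow h_mult ha hp _).tsum_eq]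
    refine tsum_congr fun e => ?_
    simp only [hf]
    rw [Nat.cast_pow, ← Complex.natCast_cpow_natCast_mul, mul_comm (e : ℂ),
      Complex.cpow_mul_nat]
  refine tendsto_nhds_unique h1 (((tendsto_prod_primeTail h_nonneg hyp hb hs.1).const_mul
    (∏ p ∈ Nat.primesLE P, localFactor h a p ((p : ℂ) ^ (-s)))).congr' ?_)
  filter_upwards [eventually_gt_atTop P] with N hN
  rw [Finset.prod_congr rfl fun p hp => hlocal p (Nat.prime_of_mem_primesBelow hp),
    prod_primesBelow_split _ hN]
  congr 1
  refine Finset.prod_congr rfl fun n _ => ?_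
  unfold primeTail
  split_ifs with hn
  · rw [localFactor_of_lt h_mult ha hn.1 (by omega)]
  · simp

/-- The holomorphic function `(1 - p ^ (-s)) / s`. -/
noncomputable def slopeFactor (p : ℕ) : ℂ → ℂ := dslope (fun s : ℂ => -(p : ℂ) ^ (-s)) 0

open Classical in
/-- The local factor with its zero at the origin removed. -/
noncomputable def regFactor (h : ArithmeticFunction ℝ) (a : ℤ) (p : ℕ) (s : ℂ) : ℂ :=
  if IsExceptional h a p then
    slopeFactor p s * ∑ j ∈ Finset.range (padicValInt p a + 1), (h (p ^ j) : ℂ) * ((p : ℂ) ^ (-s)) ^ j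
  else localFactor h a p ((p : ℂ) ^ (-s))

open Classical in
/-- The value of `regFactor` at the origin. -/
noncomputable def regValue (h : ArithmeticFunction ℝ) (a : ℤ) (p : ℕ) : ℝ :=
  if IsExceptional h a p then
    Real.log p * ∑ j ∈ Finset.range (padicValInt p a + 1), h (p ^ j)
  else localConst h a p

lemma localConst_eq_zero {p : ℕ} (hp : IsExceptional h a p) : localConst h a p = 0 := by
  rw [localConst, hp, sub_self, zero_div]

lemma mul_slopeFactor (p : ℕ) (s : ℂ) : s * slopeFactor p s = 1 - (p : ℂ) ^ (-s) := by
  have := sub_smul_dslope (fun s : ℂ => -(p : ℂ) ^ (-s)) 0 s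
  rw [sub_zero, smul_eq_mul] at this
  rw [slopeFactor, this]
  simp; ring

-- At an exceptional prime `localConst` is zero, so the local factor is a multiple of 1 - p^(-s).
-- Each such prime therefore raises the exponent of s by one, and `regFactor` is what remains.
open Classical in
lemma localFactor_eq (p : ℕ) (s : ℂ) : localFactor h a p ((p : ℂ) ^ (-s))
    = (if IsExceptional h a p then s else 1) * regFactor h a p s := by
  unfold regFactor
  split_ifs with hp
  · rw [localFactor, localConst_eq_zero hp, ← mul_assoc, mul_slopeFactor]
    simp
  · rw [one_mul]

lemma not_isExceptional_of_lt (h_mult : h.IsMultiplicative) (hyp : PrimeAverageHypothesis h k)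
    {p : ℕ} (hp : p.Prime) (hf : padicValInt p a = 0) : ¬ IsExceptional h a p := by
  have hp0 : (0 : ℝ) < p := by exact_mod_cast hp.pos
  rw [IsExceptional, hf, pow_zero, zero_add, pow_one, h_mult.map_one, eq_div_iff hp0.ne', one_mul]
  exact (hyp.lt_self p hp).ne'

open Classical in
lemma exceptionalPrimes_eq (h_mult : h.IsMultiplicative) (hyp : PrimeAverageHypothesis h k)
    (ha : a ≠ 0) (hP : a.natAbs ≤ P) :
    exceptionalPrimes h a = {p ∈ Nat.primesLE P | IsExceptional h a p} := by
  ext p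
  simp only [exceptionalPrimes, Finset.mem_filter, Nat.mem_primesLE, Nat.mem_primeFactors]
  constructor
  · rintro ⟨⟨hp, hd, -⟩, he⟩
    exact ⟨⟨(Nat.le_of_dvd (Int.natAbs_pos.mpr ha) hd).trans hP, hp⟩, he⟩
  · rintro ⟨⟨-, hp⟩, he⟩
    refine ⟨⟨hp, ?_, Int.natAbs_ne_zero.mpr ha⟩, he⟩
    by_contra hd
    exact not_isExceptional_of_lt h_mult hyp hp (padicValNat.eq_zero_of_not_dvd hd) he

lemma prod_localFactor (h_mult : h.IsMultiplicative) (hyp : PrimeAverageHypothesis h k)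
    (ha : a ≠ 0) (hP : a.natAbs ≤ P) (s : ℂ) :
    ∏ p ∈ Nat.primesLE P, localFactor h a p ((p : ℂ) ^ (-s))
      = s ^ omegaH h a * ∏ p ∈ Nat.primesLE P, regFactor h a p s := by
  classical
  simp only [localFactor_eq]
  rw [Finset.prod_mul_distrib, omegaH, exceptionalPrimes_eq h_mult hyp ha hP, ← Finset.prod_filter,
    Finset.prod_const]

lemma tempered_natCast_cpow {p : ℕ} (hp : p.Prime) : Tempered 0 fun s : ℂ => (p : ℂ) ^ (-s) := by
  have hp1 : (1 : ℝ) ≤ p := by exact_mod_cast hp.one_lt.le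
  have hp' : (p : ℂ) ≠ 0 := by exact_mod_cast hp.ne_zero
  refine tempered_of_wide_strip (r := 1) one_pos (fun s _ => ?_) fun ε hε => ?_
  · exact ((by fun_prop : DifferentiableAt ℂ (fun z : ℂ => -z) s).const_cpow
      (Or.inl hp')).differentiableWithinAt
  · refine ⟨p, by positivity, fun s hs _ => ?_⟩
    rw [Complex.norm_natCast_cpow_of_pos hp.pos]
    calc (p : ℝ) ^ (-s).re ≤ (p : ℝ) ^ (1 : ℝ) :=
          Real.rpow_le_rpow_of_exponent_le hp1 (by simp; linarith)
      _ = p := Real.rpow_one _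
      _ ≤ _ := le_mul_of_one_le_right (by positivity)
          (Real.one_le_rpow (one_le_abs_add_two _) (by linarith))

/-- The function is entire: compactness bounds it on the unit disc, and outside it |s| ≥ 1 makes it
at most |1 - p^(-s)|. -/
lemma tempered_slopeFactor {p : ℕ} (hp : p.Prime) : Tempered 0 (slopeFactor p) := by
  have hp1 : (1 : ℝ) ≤ p := by exact_mod_cast hp.one_lt.le
  have hp' : (p : ℂ) ≠ 0 := by exact_mod_cast hp.ne_zero
  have hd : DifferentiableOn ℂ (slopeFactor p) univ :=
    (Complex.differentiableOn_dslope univ_mem).mpr fun s _ =>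
      (((by fun_prop : DifferentiableAt ℂ (fun z : ℂ => -z) s).const_cpow
        (Or.inl hp')).neg).differentiableWithinAt
  obtain ⟨B, hB⟩ := (isCompact_closedBall (0 : ℂ) 1).exists_bound_of_continuousOn
    (hd.continuousOn.mono (subset_univ _))
  refine tempered_of_wide_strip (r := 1) one_pos (hd.mono (subset_univ _)) fun ε hε => ?_
  refine ⟨max B (1 + p), le_max_of_le_right (by positivity), fun s hs _ => ?_⟩
  refine le_trans ?_ (le_mul_of_one_le_right (le_max_of_le_right (by positivity))
    (Real.one_le_rpow (one_le_abs_add_two _) (by linarith)))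
  rcases le_total ‖s‖ 1 with h1 | h1
  · exact (hB s (by simpa using h1)).trans (le_max_left _ _)
  · refine le_trans ?_ (le_max_right _ _)
    have h2 : ‖slopeFactor p s‖ ≤ ‖s‖ * ‖slopeFactor p s‖ :=
      le_mul_of_one_le_left (norm_nonneg _) h1
    rw [← norm_mul, mul_slopeFactor] at h2
    refine h2.trans ((norm_sub_le _ _).trans ?_)
    rw [norm_one, Complex.norm_natCast_cpow_of_pos hp.pos]
    have : (p : ℝ) ^ (-s).re ≤ (p : ℝ) ^ (1 : ℝ) :=
      Real.rpow_le_rpow_of_exponent_le hp1 (by simp; linarith)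
    rw [Real.rpow_one] at this
    linarith

lemma Tempered.sum {ι : Type*} (S : Finset ι) {f : ι → ℂ → ℂ} (hf : ∀ i ∈ S, Tempered 0 (f i)) :
    Tempered 0 (fun s => ∑ i ∈ S, f i s) := by
  classical
  induction S using Finset.induction_on with
  | empty => simpa using tempered_const 0
  | insert a S ha ih =>
    have := (hf a (Finset.mem_insert_self _ _)).add
      (ih fun i hi => hf i (Finset.mem_insert_of_mem hi))
    simpa only [Finset.sum_insert ha] using this

lemma Tempered.pow {f : ℂ → ℂ} (hf : Tempered 0 f) (n : ℕ) : Tempered 0 (fun s => f s ^ n) := by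
  have := Tempered.prod (Finset.range n) (f := fun _ => f) fun _ _ => hf
  simpa using this

lemma Tempered.const_mul {f : ℂ → ℂ} (hf : Tempered 0 f) (c : ℂ) :
    Tempered 0 (fun s => c * f s) := by
  simpa using (tempered_const c).mul hf

lemma tempered_regFactor {p : ℕ} (hp : p.Prime) : Tempered 0 (regFactor h a p) := by
  have h1 := tempered_natCast_cpow hp
  have h2 : Tempered 0 fun s : ℂ => ∑ j ∈ Finset.range (padicValInt p a + 1),
      (h (p ^ j) : ℂ) * ((p : ℂ) ^ (-s)) ^ j :=
    Tempered.sum _ fun j _ => (h1.pow j).const_mul _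
  unfold regFactor
  split_ifs
  · simpa using (tempered_slopeFactor hp).mul h2
  · have h3 : Tempered 0 fun s : ℂ => 1 - (p : ℂ) ^ (-s) :=
      ((tempered_const 1).add (h1.const_mul (-1))).congr fun s _ => by simp; ring
    have h4 := h3.mul h2
    rw [add_zero] at h4
    exact h4.add ((h1.pow _).const_mul _)

lemma tendsto_regFactor {p : ℕ} (hp : p.Prime) :
    Tendsto (fun x : ℝ => regFactor h a p x) (𝓝[>] 0) (𝓝 (regValue h a p : ℂ)) := by
  have hp' : (p : ℂ) ≠ 0 := by exact_mod_cast hp.ne_zero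
  have hd : ∀ s : ℂ, HasDerivAt (fun s : ℂ => -(p : ℂ) ^ (-s))
      ((p : ℂ) ^ (-s) * Complex.log p) s := fun s => by
    exact ((hasDerivAt_neg s).const_cpow (c := (p : ℂ)) (Or.inl hp')).fun_neg.congr_deriv (by simp)
  have h1 : ContinuousAt (fun x : ℝ => (p : ℂ) ^ (-(x : ℂ))) 0 :=
    ContinuousAt.const_cpow (by fun_prop) (Or.inl hp')
  have h2 : ContinuousAt (fun x : ℝ => slopeFactor p x) 0 := by
    refine ContinuousAt.comp (f := fun x : ℝ => (x : ℂ)) (g := slopeFactor p) ?_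
      Complex.continuous_ofReal.continuousAt
    rw [Complex.ofReal_zero]
    exact continuousAt_dslope_same.mpr (hd 0).differentiableAt
  have h3 : ContinuousAt (fun x : ℝ => regFactor h a p x) 0 := by
    unfold regFactor localFactor
    split_ifs
    · refine h2.mul ?_
      fun_prop
    · fun_prop
  have h4 : regFactor h a p ((0 : ℝ) : ℂ) = regValue h a p := by
    unfold regFactor regValue
    split_ifs
    · rw [slopeFactor, Complex.ofReal_zero, dslope_same, (hd 0).deriv]
      simp
    · simp [localFactor]
  rw [← h4]
  exact h3.tendsto.mono_left nhdsWithin_le_nhds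

/-- This makes the leading constant V₀ nonzero, so that an absolute error can be turned into the
relative error of the theorem. -/
lemma regValue_ne_zero (h_mult : h.IsMultiplicative) (h_nonneg : ∀ n, 0 ≤ h n) {p : ℕ}
    (hp : p.Prime) : regValue h a p ≠ 0 := by
  have hp1 : (1 : ℝ) < p := by exact_mod_cast hp.one_lt
  unfold regValue
  split_ifs with he
  · refine mul_ne_zero (Real.log_pos hp1).ne' (ne_of_gt ?_)
    refine lt_of_lt_of_le zero_lt_one ?_
    have := Finset.single_le_sum (f := fun j => h (p ^ j)) (fun j _ => h_nonneg _)
      (Finset.mem_range.mpr (Nat.succ_pos (padicValInt p a)))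
    simpa [h_mult.map_one] using this
  · refine div_ne_zero (sub_ne_zero.mpr he) (ne_of_gt ?_)
    rw [sub_pos, div_lt_one (by linarith)]
    exact hp1

/-- The factorization of the Dirichlet series, its kernel weight included. -/
lemma exists_tempered_factor (h_mult : h.IsMultiplicative) (h_nonneg : ∀ n, 0 ≤ h n)
    (hyp : PrimeAverageHypothesis h k) (ha : a ≠ 0) :
    ∃ (V : ℂ → ℂ) (c V₀ : ℝ), V₀ ≠ 0 ∧ Tempered c V ∧
      (∀ s ∈ strip, dirSeries (coeff h a) s * (kernFactor s / s)
        = s ^ ((k + omegaH h a - 2 : ℝ) : ℂ) * V s) ∧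
      Tendsto (fun x : ℝ => V x) (𝓝[>] 0) (𝓝 (V₀ : ℂ)) ∧
      ∃ W : ℝ, Tendsto (regularPartialProduct h k a) atTop (𝓝 W) ∧
        (∏ p ∈ exceptionalPrimes h a,
          (∑ j ∈ Finset.range (padicValInt p a + 1), h (p ^ j)) / (1 - 1 / (p : ℝ)) ^ (k - 1)
            * Real.log p) * W = 2 * V₀ := by
  classical
  obtain ⟨P, hP, C, hb⟩ := exists_logBound_primeTail h_nonneg hyp a.natAbs
  obtain ⟨X₀, hX₀, hX, hX'⟩ := exists_tendsto_eulerReg h_nonneg hyp hb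
  have hprime : ∀ p ∈ Nat.primesLE P, p.Prime := fun p hp => Nat.prime_of_mem_primesLE hp
  have hq0 : ∀ p : ℕ, p.Prime → (0 : ℝ) < 1 - 1 / p := fun p hp => by
    have : (1 : ℝ) < p := by exact_mod_cast hp.one_lt
    rw [sub_pos, div_lt_one (by linarith)]; exact this
  have hT := ((Tempered.prod (Nat.primesLE P) (f := regFactor h a)
    fun p hp => tempered_regFactor (hprime p hp)).mul (tempered_eulerReg h_nonneg hyp hb)).mul
      tempered_kernFactor
  refine ⟨_, _, (∏ p ∈ Nat.primesLE P, regValue h a p) * X₀ * (1 / 2), ?_, hT, ?_, ?_, ?_⟩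
  · exact mul_ne_zero (mul_ne_zero (Finset.prod_ne_zero_iff.mpr fun p hp =>
      regValue_ne_zero h_mult h_nonneg (hprime p hp)) hX₀.ne') (by norm_num)
  · intro s hs
    have hs0 : s ≠ 0 := by rintro rfl; simpa using hs.1
    rw [dirSeries_coeff h_mult h_nonneg hyp ha hP hb hs, prod_localFactor h_mult hyp ha hP]
    -- The exponent collects ω from the exceptional primes, k - 1 from the Euler product and -1 from
    -- the 1/s of the kernel's transform.
    have h1 : s ^ ((k + omegaH h a - 2 : ℝ) : ℂ)
        = s ^ omegaH h a * s ^ ((k - 1 : ℝ) : ℂ) * s⁻¹ := by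
      rw [← Complex.cpow_natCast, ← Complex.cpow_neg_one, ← Complex.cpow_add _ _ hs0,
        ← Complex.cpow_add _ _ hs0]
      congr 1
      push_cast; ring
    rw [h1, div_eq_mul_inv]
    ring
  · have h1 := ((tendsto_finsetProd (Nat.primesLE P) fun p hp =>
      tendsto_regFactor (h := h) (a := a) (hprime p hp)).mul hX).mul tendsto_kernFactor
    convert h1 using 2
    push_cast
    rfl
  · set G : ℕ → ℝ := fun p => if ¬ IsExceptional h a p then
      (h (p ^ padicValInt p a) - h (p ^ (padicValInt p a + 1)) / p) / (1 - 1 / (p : ℝ)) ^ k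
      else 1 with hG
    have hlc : ∀ p : ℕ, p.Prime → h (p ^ padicValInt p a) - h (p ^ (padicValInt p a + 1)) / p
        = localConst h a p * (1 - 1 / (p : ℝ)) := fun p hp => by
      rw [localConst, div_mul_cancel₀ _ (hq0 p hp).ne']
    set Z : ℝ := ∏ p ∈ Nat.primesLE P, (1 - 1 / (p : ℝ)) ^ (1 - k) with hZ
    have hZ0 : Z ≠ 0 := (Finset.prod_pos fun p hp => Real.rpow_pos_of_pos (hq0 p (hprime p hp)) _).ne'
    -- The limit X₀ includes the factors (1-1/p)^(1-k) of the primes p ≤ P, where `primeTail` is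
    -- zero. Z removes them, and the factors G of the regular product are put in their place.
    refine ⟨(∏ p ∈ Nat.primesLE P, G p) * Z⁻¹ * X₀, ?_, ?_⟩
    · refine ((hX'.comp (tendsto_add_atTop_nat 1)).const_mul
        ((∏ p ∈ Nat.primesLE P, G p) * Z⁻¹)).congr' ?_
      filter_upwards [eventually_ge_atTop P] with N hN
      have h1 : regularPartialProduct h k a N = ∏ p ∈ Nat.primesBelow (N + 1), G p := by
        rw [regularPartialProduct, Finset.prod_filter]
        rfl
      have h2 : ∏ n ∈ Finset.range (N + 1), ((1 + primeTail h P n) * (1 - primeInv n) ^ (1 - k))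
          = Z * ∏ n ∈ Finset.range (N + 1), (if n.Prime ∧ P < n then G n else 1) := by
        have h3 : ∏ n ∈ Finset.range (N + 1), (1 - primeInv n) ^ (1 - k)
            = ∏ p ∈ Nat.primesBelow (N + 1), (1 - 1 / (p : ℝ)) ^ (1 - k) := by
          rw [← prod_range_ite_prime]
          refine Finset.prod_congr rfl fun n _ => ?_
          unfold primeInv
          split_ifs <;> simp
        rw [Finset.prod_mul_distrib, h3, prod_primesBelow_split _ (Nat.lt_succ_of_le hN), ← hZ,
          mul_left_comm, ← Finset.prod_mul_distrib]
        congr 1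
        refine Finset.prod_congr rfl fun n _ => ?_
        unfold primeTail
        split_ifs with hn
        · have hna : a.natAbs < n := by omega
          simp only [hG]
          rw [if_pos (not_isExceptional_of_lt h_mult hyp hn.1 (padicValInt_eq_zero_of_lt ha hna)),
            hlc n hn.1, localConst_of_lt h_mult ha hn.1 hna, mul_div_assoc]
          congr 1
          rw [Real.rpow_sub (hq0 n hn.1), Real.rpow_one]
        · simp
      rw [Function.comp_apply, h1, h2, prod_primesBelow_split _ (Nat.lt_succ_of_le hN)]
      field_simp
    · rw [exceptionalPrimes_eq h_mult hyp ha hP, Finset.prod_filter, hZ, ← Finset.prod_inv_distrib,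
        ← mul_assoc, ← Finset.prod_mul_distrib, ← Finset.prod_mul_distrib,
        show ∀ x : ℝ, 2 * (x * X₀ * (1 / 2)) = x * X₀ from fun x => by ring]
      congr 1
      refine Finset.prod_congr rfl fun p hp => ?_
      have hq := hq0 p (hprime p hp)
      have h5 : (1 - 1 / (p : ℝ)) ^ (k - 1) * (1 - 1 / (p : ℝ)) ^ (1 - k) = 1 := by
        rw [← Real.rpow_add hq]; norm_num
      have h6 : (1 - 1 / (p : ℝ)) ^ k * (1 - 1 / (p : ℝ)) ^ (1 - k) = 1 - 1 / (p : ℝ) := by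
        rw [← Real.rpow_add hq, add_sub_cancel, Real.rpow_one]
      have h7 := (Real.rpow_pos_of_pos hq (k - 1)).ne'
      have h8 := (Real.rpow_pos_of_pos hq (1 - k)).ne'
      have h9 := (Real.rpow_pos_of_pos hq k).ne'
      unfold regValue
      simp only [hG]
      by_cases he : IsExceptional h a p
      · simp only [he, not_true_eq_false, if_true, if_false]
        rw [← eq_inv_of_mul_eq_one_left h5]
        field_simp
      · simp only [he, not_false_eq_true, if_true, if_false, one_mul]
        rw [hlc p (hprime p hp), mul_div_assoc, mul_assoc, ← div_eq_mul_inv, div_div, h6,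
          div_self hq.ne', mul_one]

end

end ArithSeq

/-! ### From the sums of g to the oscillating sum. -/

namespace ArithSeq

lemma sum_Icc_sum_divisors (F : ℕ → ℕ → ℝ) (N : ℕ) :
    ∑ r ∈ Finset.Icc 1 N, ∑ d ∈ r.divisors, F d r
      = ∑ d ∈ Finset.Icc 1 N, ∑ m ∈ Finset.Icc 1 (N / d), F d (d * m) := by
  rw [Finset.sum_sigma', Finset.sum_sigma']
  refine Finset.sum_bij' (fun x _ => ⟨x.2, x.1 / x.2⟩) (fun y _ => ⟨y.1 * y.2, y.1⟩) ?_ ?_ ?_ ?_ ?_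
  · rintro ⟨r, d⟩ hx
    simp only [Finset.mem_sigma, Finset.mem_Icc, Nat.mem_divisors] at hx ⊢
    obtain ⟨⟨h1, h2⟩, h3, h4⟩ := hx
    have hd : 0 < d := Nat.pos_of_dvd_of_pos h3 h1
    have hdr := Nat.le_of_dvd h1 h3
    exact ⟨⟨hd, hdr.trans h2⟩, Nat.div_pos hdr hd, Nat.div_le_div_right h2⟩
  · rintro ⟨d, m⟩ hx
    simp only [Finset.mem_sigma, Finset.mem_Icc, Nat.mem_divisors] at hx ⊢
    obtain ⟨⟨h1, h2⟩, h3, h4⟩ := hx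
    refine ⟨⟨Nat.mul_pos h1 h3, ?_⟩, Dvd.intro m rfl, (Nat.mul_pos h1 h3).ne'⟩
    rw [mul_comm]
    exact (Nat.le_div_iff_mul_le h1).mp h4
  · rintro ⟨r, d⟩ hx
    simp only [Finset.mem_sigma, Finset.mem_Icc, Nat.mem_divisors] at hx
    simp only [Nat.mul_div_cancel' hx.2.1]
  · rintro ⟨d, m⟩ hx
    simp only [Finset.mem_sigma, Finset.mem_Icc] at hx
    simp only [Nat.mul_div_cancel_left m hx.1.1]
  · rintro ⟨r, d⟩ hx
    simp only [Finset.mem_sigma, Finset.mem_Icc, Nat.mem_divisors] at hx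
    simp only [Nat.mul_div_cancel' hx.2.1]

lemma sum_Icc_one_div (n : ℕ) : ∑ m ∈ Finset.Icc 1 n, 1 / (m : ℝ) = (harmonic n : ℝ) := by
  rw [harmonic_eq_sum_Icc]
  push_cast
  exact Finset.sum_congr rfl fun m _ => one_div _

namespace SumBound

variable {b : ℕ → ℝ} {C₀ C₁ : ℝ}

lemma summable_div (hb : SumBound b C₀ C₁) : Summable fun d : ℕ => b d / d := by
  refine Summable.of_norm_bounded (hb.summable (1 / 4) (by norm_num) le_rfl) fun d => ?_
  rcases Nat.eq_zero_or_pos d with rfl | hd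
  · simp [hb.zero]
  have hd1 : (1 : ℝ) ≤ d := by exact_mod_cast hd
  rw [Real.norm_eq_abs, abs_div, Nat.abs_cast, div_eq_mul_inv, ← Real.rpow_neg_one]
  exact mul_le_mul_of_nonneg_left (Real.rpow_le_rpow_of_exponent_le hd1 (by norm_num))
    (abs_nonneg _)

lemma summable_mul_log_div (hb : SumBound b C₀ C₁) :
    Summable fun d : ℕ => b d / d * Real.log d := by
  refine Summable.of_norm_bounded ((hb.summable (1 / 4) (by norm_num) le_rfl).mul_left (4 / 3))
    fun d => ?_
  rcases Nat.eq_zero_or_pos d with rfl | hd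
  · simp [hb.zero]
  have hd0 : (0 : ℝ) < d := by exact_mod_cast hd
  have hd1 : (1 : ℝ) ≤ d := by exact_mod_cast hd
  have h1 := Real.log_le_rpow_div hd0.le (ε := 3 / 4) (by norm_num)
  rw [Real.norm_eq_abs, abs_mul, abs_div, Nat.abs_cast, abs_of_nonneg (Real.log_nonneg hd1)]
  have h2 : (d : ℝ) ^ (3 / 4 : ℝ) = (d : ℝ) ^ (-(1 / 4) : ℝ) * d := by
    rw [← Real.rpow_add_one hd0.ne']; norm_num
  calc |b d| / d * Real.log d ≤ |b d| / d * ((d : ℝ) ^ (3 / 4 : ℝ) / (3 / 4)) := by gcongr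
    _ = _ := by rw [h2]; field_simp

/-- The weighted partial sums of `∑_{d ∣ r} b d / r`. -/
lemma sum_weighted (hb : SumBound b C₀ C₁) {g : ℕ → ℝ}
    (hg : ∀ r : ℕ, 1 ≤ r → g r = (∑ d ∈ r.divisors, b d) / r) {M : ℝ} (hM : 0 < M) :
    ∑ r ∈ Finset.Icc 1 ⌊M⌋₊, g r * (1 - r / M)
      = oscSum b (Real.log M) / M
        + (∑' d : ℕ, b d / d) * (Real.log M + Real.eulerMascheroniConstant - 1)
        - ∑' d : ℕ, b d / d * Real.log d := by
  have h1 : ∑ r ∈ Finset.Icc 1 ⌊M⌋₊, g r * (1 - r / M)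
      = ∑ d ∈ Finset.Icc 1 ⌊M⌋₊, ∑ m ∈ Finset.Icc 1 (⌊M⌋₊ / d),
        b d / (d * m : ℕ) * (1 - (d * m : ℕ) / M) := by
    rw [← sum_Icc_sum_divisors (fun d r => b d / r * (1 - r / M))]
    refine Finset.sum_congr rfl fun r hr => ?_
    rw [hg r (Finset.mem_Icc.mp hr).1, Finset.sum_div, Finset.sum_mul]
  set c := Real.log M + Real.eulerMascheroniConstant - 1 with hc
  have h2 : ∀ d : ℕ, 1 ≤ d → ∑ m ∈ Finset.Icc 1 (⌊M⌋₊ / d),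
      b d / (d * m : ℕ) * (1 - (d * m : ℕ) / M)
      = M⁻¹ * (b d * kern (Real.log M - Real.log d)) + b d / d * c - b d / d * Real.log d := by
    intro d hd
    have hd0 : (0 : ℝ) < d := by exact_mod_cast hd
    have h3 : ∑ m ∈ Finset.Icc 1 (⌊M⌋₊ / d), b d / (d * m : ℕ) * (1 - (d * m : ℕ) / M)
        = b d / d * ∑ m ∈ Finset.Icc 1 (⌊M⌋₊ / d), 1 / (m : ℝ)
          - b d / M * ∑ m ∈ Finset.Icc 1 (⌊M⌋₊ / d), (1 : ℝ) := by
      rw [Finset.mul_sum, Finset.mul_sum, ← Finset.sum_sub_distrib]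
      refine Finset.sum_congr rfl fun m hm => ?_
      have hm0 : (0 : ℝ) < m := by exact_mod_cast (Finset.mem_Icc.mp hm).1
      push_cast
      field_simp
    rw [h3, sum_Icc_one_div, Finset.sum_const, Nat.card_Icc, Nat.add_sub_cancel, nsmul_eq_mul,
      mul_one, kern, Real.exp_sub, Real.exp_log hM, Real.exp_log hd0, ← Nat.floor_div_natCast, hc]
    field_simp
    ring
  have h4 : HasSum (fun d : ℕ => M⁻¹ * (b d * kern (Real.log M - Real.log d)) + b d / d * c
      - b d / d * Real.log d) (M⁻¹ * oscSum b (Real.log M) + (∑' d : ℕ, b d / d) * c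
        - ∑' d : ℕ, b d / d * Real.log d) :=
    (((hb.summable_term _).hasSum.mul_left _).add (hb.summable_div.hasSum.mul_right c)).sub
      hb.summable_mul_log_div.hasSum
  -- For d > M the inner sum is empty while h2 still holds: the kernel at a negative argument
  -- cancels the two linear terms. So the finite sum is already the whole series.
  have h5 : HasSum (fun d : ℕ => M⁻¹ * (b d * kern (Real.log M - Real.log d)) + b d / d * c
      - b d / d * Real.log d) (∑ d ∈ Finset.Icc 1 ⌊M⌋₊, (M⁻¹ * (b d * kern (Real.log M - Real.log d))
        + b d / d * c - b d / d * Real.log d)) := by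
    refine hasSum_sum_of_ne_finset_zero fun d hd => ?_
    rcases Nat.eq_zero_or_pos d with rfl | hd0
    · simp [hb.zero]
    · rw [← h2 d hd0, Nat.div_eq_of_lt (by simp at hd; exact hd hd0)]
      simp
  rw [h1, Finset.sum_congr rfl fun d hd => h2 d (Finset.mem_Icc.mp hd).1, h5.unique h4]
  ring

/-- The error term of `sum_unweighted`. -/
lemma exists_sum_unweighted (hb : SumBound b C₀ C₁) {g : ℕ → ℝ}
    (hg : ∀ r : ℕ, 1 ≤ r → g r = (∑ d ∈ r.divisors, b d) / r) {σ : ℝ} (hσ : 0 < σ)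
    (hσ4 : σ ≤ 1 / 4) {Q : ℝ} (hQ : 0 < Q) :
    |∑ r ∈ Finset.Icc 1 ⌊Q⌋₊, g r
      - ((∑' d : ℕ, b d / d) * (Real.log Q + Real.eulerMascheroniConstant)
        - ∑' d : ℕ, b d / d * Real.log d)| ≤ 4 * (C₀ * σ ^ (-C₁)) * Q ^ (σ - 1) := by
  have h1 : ∑ r ∈ Finset.Icc 1 ⌊Q⌋₊, g r
      = ∑ d ∈ Finset.Icc 1 ⌊Q⌋₊, ∑ m ∈ Finset.Icc 1 (⌊Q⌋₊ / d), b d / (d * m : ℕ) := by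
    rw [← sum_Icc_sum_divisors (fun d r => b d / r)]
    refine Finset.sum_congr rfl fun r hr => ?_
    rw [hg r (Finset.mem_Icc.mp hr).1, Finset.sum_div]
  set c := Real.log Q + Real.eulerMascheroniConstant with hc
  have h2 : ∀ d : ℕ, 1 ≤ d → ∑ m ∈ Finset.Icc 1 (⌊Q⌋₊ / d), b d / (d * m : ℕ)
      = b d / d * harmErr (Q / d) + (b d / d * c - b d / d * Real.log d) := by
    intro d hd
    have hd0 : (0 : ℝ) < d := by exact_mod_cast hd
    have h3 : ∑ m ∈ Finset.Icc 1 (⌊Q⌋₊ / d), b d / (d * m : ℕ)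
        = b d / d * ∑ m ∈ Finset.Icc 1 (⌊Q⌋₊ / d), 1 / (m : ℝ) := by
      rw [Finset.mul_sum]
      refine Finset.sum_congr rfl fun m hm => ?_
      have hm0 : (0 : ℝ) < m := by exact_mod_cast (Finset.mem_Icc.mp hm).1
      push_cast
      field_simp
    rw [h3, sum_Icc_one_div, harmErr, ← Nat.floor_div_natCast, hc, Real.log_div hQ.ne' hd0.ne']
    ring
  have hbd : ∀ d : ℕ, ‖b d / d * harmErr (Q / d)‖
      ≤ 4 * Q ^ (σ - 1) * (|b d| * (d : ℝ) ^ (-σ)) := by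
    intro d
    rcases Nat.eq_zero_or_pos d with rfl | hd
    · simp [hb.zero]
    have hd0 : (0 : ℝ) < d := by exact_mod_cast hd
    -- With u = Q/d the derivative bound for the kernel reads u |harmErr u| ≤ 4 u^σ.
    have h3 := abs_kern_deriv_le hσ.le (by linarith) (Real.log (Q / d))
    rw [Real.exp_log (by positivity), abs_mul, abs_of_pos (show 0 < Q / d by positivity),
      mul_comm σ, ← Real.rpow_def_of_pos (by positivity)] at h3
    rw [Real.norm_eq_abs, abs_mul, abs_div, Nat.abs_cast]
    calc |b d| / d * |harmErr (Q / d)| = |b d| * Q⁻¹ * (Q / d * |harmErr (Q / d)|) := by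
          field_simp
      _ ≤ |b d| * Q⁻¹ * (4 * (Q / d) ^ σ) := by gcongr
      _ = _ := by
          rw [Real.div_rpow hQ.le hd0.le, Real.rpow_sub_one hQ.ne', Real.rpow_neg hd0.le]
          field_simp
  have hs := (hb.summable σ hσ hσ4).mul_left (4 * Q ^ (σ - 1))
  have hsum : Summable fun d : ℕ => b d / d * harmErr (Q / d) := Summable.of_norm_bounded hs hbd
  have h4 := hsum.hasSum.add ((hb.summable_div.hasSum.mul_right c).sub
      hb.summable_mul_log_div.hasSum)
  have h5 : HasSum (fun d : ℕ => b d / d * harmErr (Q / d) + (b d / d * c - b d / d * Real.log d))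
      (∑ d ∈ Finset.Icc 1 ⌊Q⌋₊,
        (b d / d * harmErr (Q / d) + (b d / d * c - b d / d * Real.log d))) := by
    refine hasSum_sum_of_ne_finset_zero fun d hd => ?_
    rcases Nat.eq_zero_or_pos d with rfl | hd0
    · simp [hb.zero]
    · rw [← h2 d hd0, Nat.div_eq_of_lt (by simp at hd; exact hd hd0)]
      simp
  rw [h1, Finset.sum_congr rfl fun d hd => h2 d (Finset.mem_Icc.mp hd).1, h5.unique h4,
    add_sub_cancel_right]
  refine (tsum_of_norm_bounded hs.hasSum hbd).trans ?_
  rw [tsum_mul_left]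
  calc _ ≤ 4 * Q ^ (σ - 1) * (C₀ * σ ^ (-C₁)) :=
        mul_le_mul_of_nonneg_left (hb.le σ hσ hσ4) (by positivity)
    _ = _ := by ring

/-- Only the oscillating term at `M` survives in the combination of sums. -/
lemma exists_combination_le (hb : SumBound b C₀ C₁) {g : ℕ → ℝ}
    (hg : ∀ r : ℕ, 1 ≤ r → g r = (∑ d ∈ r.divisors, b d) / r) {δ : ℝ} (hδ : 0 < δ) :
    ∃ C : ℝ, 0 ≤ C ∧ ∀ x M R : ℝ, 1 < M → M ^ (1 + δ) ≤ R → R ≤ Real.sqrt x →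
      |∑ r ∈ Finset.Icc 1 ⌊R⌋₊, g r * (1 - r / R) - ∑ r ∈ Finset.Icc 1 ⌊M⌋₊, g r * (1 - r / M)
        - ∑ q ∈ Finset.Ioc ⌊x / R⌋₊ ⌊x / M⌋₊, g q + oscSum b (Real.log M) / M|
        ≤ C * M ^ (-1 - δ / 2) := by
  -- Chosen so that (1+δ)(σ-1) ≤ -1 - δ/2: an error y^(σ-1) with y ≥ R ≥ M^(1+δ) is then at most
  -- M^(-1-δ/2).
  set σ := min (1 / 4) (δ / (2 * (1 + δ))) with hσd
  have hσ : 0 < σ := by positivity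
  have hσ4 : σ ≤ 1 / 4 := min_le_left _ _
  have hσδ : (1 + δ) * σ ≤ δ / 2 := by
    have := min_le_right (1 / 4) (δ / (2 * (1 + δ)))
    calc (1 + δ) * σ ≤ (1 + δ) * (δ / (2 * (1 + δ))) := by gcongr
      _ = δ / 2 := by field_simp
  set B := C₀ * σ ^ (-C₁) with hB
  have hB0 : 0 ≤ B := mul_nonneg hb.nonneg (by positivity)
  -- 19 = 11 + 4 + 4: the oscillating sum at R and the unweighted sums up to x/R and up to x/M.
  refine ⟨19 * B, by positivity, fun x M R hM hMR hRx => ?_⟩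
  have hM0 : 0 < M := by linarith
  have hMR' : M ≤ R := by
    refine le_trans ?_ hMR
    calc M = M ^ (1 : ℝ) := (Real.rpow_one M).symm
      _ ≤ _ := Real.rpow_le_rpow_of_exponent_le hM.le (by linarith)
  have hR0 : 0 < R := by linarith
  have hxR : R ^ 2 ≤ x := by
    have h1 : 0 < Real.sqrt x := hR0.trans_le hRx
    calc R ^ 2 ≤ Real.sqrt x ^ 2 := by gcongr
      _ = x := Real.sq_sqrt (Real.sqrt_pos.mp h1).le
  have hx0 : 0 < x := by nlinarith
  have hRxR : R ≤ x / R := by rw [le_div_iff₀ hR0]; nlinarith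
  have hxRM : x / R ≤ x / M := by gcongr
  have hIoc : ∑ q ∈ Finset.Ioc ⌊x / R⌋₊ ⌊x / M⌋₊, g q
      = ∑ q ∈ Finset.Icc 1 ⌊x / M⌋₊, g q - ∑ q ∈ Finset.Icc 1 ⌊x / R⌋₊, g q := by
    have h1 : ∀ n : ℕ, Finset.Icc 1 n = Finset.Ioc 0 n := fun n => rfl
    rw [h1, h1, eq_sub_iff_add_eq', Finset.sum_Ioc_consecutive _ (Nat.zero_le _)
      (Nat.floor_le_floor hxRM)]
  have hpow : ∀ y : ℝ, R ≤ y → y ^ (σ - 1) ≤ M ^ (-1 - δ / 2) := fun y hy => by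
    calc y ^ (σ - 1) ≤ R ^ (σ - 1) := Real.rpow_le_rpow_of_nonpos hR0 hy (by linarith)
      _ ≤ (M ^ (1 + δ)) ^ (σ - 1) :=
          Real.rpow_le_rpow_of_nonpos (by positivity) hMR (by linarith)
      _ = M ^ ((1 + δ) * (σ - 1)) := by rw [← Real.rpow_mul hM0.le]
      _ ≤ _ := Real.rpow_le_rpow_of_exponent_le hM.le (by linarith)
  have hosc : |oscSum b (Real.log R) / R| ≤ 11 * B * M ^ (-1 - δ / 2) := by
    rw [abs_div, abs_of_pos hR0, div_le_iff₀ hR0]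
    refine (hb.abs_oscSum_le hσ hσ4 (Real.log R)).trans ?_
    rw [mul_comm σ, ← Real.rpow_def_of_pos hR0, ← hB]
    have h1 : R ^ σ = R ^ (σ - 1) * R := by rw [← Real.rpow_add_one hR0.ne']; norm_num
    rw [h1]
    calc 11 * (R ^ (σ - 1) * R) * B = 11 * B * R ^ (σ - 1) * R := by ring
      _ ≤ 11 * B * M ^ (-1 - δ / 2) * R := by
        have := hpow R le_rfl
        gcongr
  have hE : ∀ y : ℝ, R ≤ y → |∑ r ∈ Finset.Icc 1 ⌊y⌋₊, g r
      - ((∑' d : ℕ, b d / d) * (Real.log y + Real.eulerMascheroniConstant)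
        - ∑' d : ℕ, b d / d * Real.log d)| ≤ 4 * B * M ^ (-1 - δ / 2) := fun y hy =>
    (hb.exists_sum_unweighted hg hσ hσ4 (hR0.trans_le hy)).trans
      (mul_le_mul_of_nonneg_left (hpow y hy) (by positivity))
  have hE1 := hE _ hRxR
  have hE2 := hE _ (hRxR.trans hxRM)
  rw [Real.log_div hx0.ne' hR0.ne'] at hE1
  rw [Real.log_div hx0.ne' hM0.ne'] at hE2
  -- The linear parts cancel because log R - log M = log(x/M) - log(x/R), and the constants cancel
  -- in pairs.
  rw [hIoc, hb.sum_weighted hg hR0, hb.sum_weighted hg hM0]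
  rw [abs_le] at hosc hE1 hE2 ⊢
  constructor <;> linarith [hosc.1, hosc.2, hE1.1, hE1.2, hE2.1, hE2.2]

end SumBound

end ArithSeq

/-! ### Assembly of the theorem. -/

namespace ArithSeq

lemma gammaFactor_ne_zero {h : ArithmeticFunction ℝ} {k : ℝ} (hyp : PrimeAverageHypothesis h k)
    (q : ℕ) : gammaFactor h q ≠ 0 := by
  refine Finset.prod_ne_zero_iff.mpr fun p hp => ?_
  have hp' := Nat.prime_of_mem_primeFactors hp
  have hp1 : (1 : ℝ) < p := by exact_mod_cast hp'.one_lt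
  refine div_ne_zero (ne_of_gt ?_) (ne_of_gt ?_)
  · rw [sub_pos, div_lt_one (by linarith)]; exact hp1
  · rw [sub_pos, div_lt_one (by linarith)]; exact hyp.lt_self p hp'

lemma fDensity_div {h : ArithmeticFunction ℝ} {k : ℝ} (hyp : PrimeAverageHypothesis h k) (a : ℤ)
    {q : ℕ} (hq : 1 ≤ q) : fDensity h a q / (q * gammaFactor h q) = gDensity h a q := by
  have hq0 : (q : ℝ) ≠ 0 := by exact_mod_cast (by omega : q ≠ 0)
  have := gammaFactor_ne_zero hyp q
  rw [fDensity]
  field_simp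

lemma arithmeticSum_eq {h : ArithmeticFunction ℝ} {k : ℝ} (hyp : PrimeAverageHypothesis h k)
    (a : ℤ) (x M R : ℝ) : arithmeticSum h a x M R
      = ∑ r ∈ Finset.Icc 1 ⌊R⌋₊, gDensity h a r * (1 - r / R)
        - ∑ r ∈ Finset.Icc 1 ⌊M⌋₊, gDensity h a r * (1 - r / M)
        - ∑ q ∈ Finset.Ioc ⌊x / R⌋₊ ⌊x / M⌋₊, gDensity h a q := by
  unfold arithmeticSum
  congr 1
  · congr 1 <;>
    exact Finset.sum_congr rfl fun r hr => by rw [fDensity_div hyp a (Finset.mem_Icc.mp hr).1]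
  · refine Finset.sum_congr rfl fun r hr => fDensity_div hyp a ?_
    have := (Finset.mem_Ioc.mp hr).1
    omega

lemma gDensity_eq_sum_coeff (h : ArithmeticFunction ℝ) (a : ℤ) {r : ℕ} (hr : 1 ≤ r) :
    gDensity h a r = (∑ d ∈ r.divisors, coeff h a d) / r := by
  have hr0 : (r : ℝ) ≠ 0 := by exact_mod_cast (by omega : r ≠ 0)
  rw [sum_divisors_coeff, scaledDensity_apply, mul_div_cancel_left₀ _ hr0]

lemma exists_rpow_le_div_log_rpow {δ A : ℝ} (hδ : 0 < δ) (hA : 0 < A) :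
    ∃ C : ℝ, 0 ≤ C ∧ ∀ M : ℝ, 1 < M → M ^ (-1 - δ / 2) ≤ C * (1 / (M * Real.log M ^ A)) := by
  set ε := δ / (2 * A) with hε
  have hε0 : 0 < ε := by positivity
  refine ⟨(ε ^ A)⁻¹, by positivity, fun M hM => ?_⟩
  have hM0 : 0 < M := by linarith
  have hv : 0 < Real.log M := Real.log_pos hM
  have h1 : Real.log M ^ A ≤ M ^ (δ / 2) * (ε ^ A)⁻¹ := by
    calc Real.log M ^ A ≤ (M ^ ε / ε) ^ A :=
          Real.rpow_le_rpow hv.le (Real.log_le_rpow_div hM0.le hε0) hA.le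
      _ = M ^ (ε * A) * (ε ^ A)⁻¹ := by
          rw [Real.div_rpow (by positivity) hε0.le, ← Real.rpow_mul hM0.le, div_eq_mul_inv]
      _ = _ := by rw [hε]; congr 2; field_simp
  have h2 : 0 < Real.log M ^ A := by positivity
  rw [mul_one_div, le_div_iff₀ (by positivity)]
  calc M ^ (-1 - δ / 2) * (M * Real.log M ^ A)
      ≤ M ^ (-1 - δ / 2) * (M * (M ^ (δ / 2) * (ε ^ A)⁻¹)) := by gcongr
    _ = M ^ (-1 - δ / 2 + 1 + δ / 2) * (ε ^ A)⁻¹ := by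
        rw [Real.rpow_add hM0, Real.rpow_add_one hM0.ne']; ring
    _ = _ := by ring_nf; simp

lemma one_le_abs_log_div {v : ℝ} (h0 : 0 < v) (h1 : v ≤ 1 / 2) : 1 ≤ |Real.log v| / v := by
  rw [le_div_iff₀ h0, one_mul]
  have h2 : Real.log v ≤ -Real.log 2 := by
    rw [← Real.log_inv]
    exact Real.log_le_log h0 (by linarith)
  have h3 := Real.log_two_gt_d9
  rw [abs_of_nonpos (by linarith)]
  linarith

lemma rpow_le_four_rpow_abs {v : ℝ} (h0 : 1 / 2 < v) (h4 : v ≤ 4) (β : ℝ) :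
    v ^ β ≤ 4 ^ |β| := by
  rcases le_total 0 β with hβ | hβ
  · rw [abs_of_nonneg hβ]
    exact Real.rpow_le_rpow (by linarith) h4 hβ
  · rw [abs_of_nonpos hβ, Real.rpow_neg (by norm_num), ← Real.inv_rpow (by norm_num)]
    exact Real.rpow_le_rpow_of_nonpos (by norm_num) (by linarith) hβ

end ArithSeq

open ArithSeq in
theorem mainTheorem3 (h : ArithmeticFunction ℝ) (h_mult : h.IsMultiplicative)
    (h_nonneg : ∀ n : ℕ, 0 ≤ h n) (k : ℝ) (hyp : ArithSeq.PrimeAverageHypothesis h k)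
    (a : ℤ) (ha : a ≠ 0) (δ : ℝ) (hδ : 0 < δ) :
    Filter.Tendsto (ArithSeq.regularPartialProduct h k a) Filter.atTop
        (nhds (ArithSeq.regularProduct h k a)) ∧
      ∃ C : ℝ, ∀ A : ℝ, 0 < A → ∃ C_A : ℝ, ∀ x M R : ℝ,
        1 < M → M ^ (1 + δ) ≤ R → R ≤ Real.sqrt x →
          ∃ E₁ E₂ : ℝ,
            ArithSeq.arithmeticSum h a x M R =
                ArithSeq.muAverage h k a M / M * (1 + E₁) + E₂ ∧
              |E₁| ≤ C * (|Real.log (Real.log M)| / Real.log M) ∧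
              |E₂| ≤ C_A * (1 / (M * Real.log M ^ A)) := by
  obtain ⟨V, c, V₀, hV₀, hT, hV, hlim, W, hW, hWV⟩ :=
    exists_tempered_factor h_mult h_nonneg hyp ha
  have hreg : regularProduct h k a = W := hW.limUnder_eq
  refine ⟨by rw [hreg]; exact hW, ?_⟩
  obtain ⟨C₀, C₁, hb⟩ := exists_sumBound_coeff h_mult h_nonneg hyp ha
  obtain ⟨B, hB0, hB⟩ := hb.exists_combination_le
    (fun r hr => gDensity_eq_sum_coeff h a hr) hδ
  set α : ℝ := k + omegaH h a - 2 with hα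
  -- In terms of α the average is minus the leading term of `oscSum`, since the two products in
  -- `muAverage` multiply to 2 V₀.
  have hmu : ∀ M : ℝ, muAverage h k a M
      = -(V₀ * (Real.log M ^ (-α - 1) / Real.Gamma (-α))) := fun M => by
    rw [muAverage, hreg, mul_assoc, hWV, show 1 - k - (omegaH h a : ℝ) = -α - 1 by rw [hα]; ring,
      show 2 - k - (omegaH h a : ℝ) = -α by rw [hα]; ring]
    ring
  have hS : ∀ x M R : ℝ, 1 < M → M ^ (1 + δ) ≤ R → R ≤ Real.sqrt x →
      |arithmeticSum h a x M R + oscSum (coeff h a) (Real.log M) / M| ≤ B * M ^ (-1 - δ / 2) :=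
    fun x M R h1 h2 h3 => by
      rw [arithmeticSum_eq hyp]
      exact hB x M R h1 h2 h3
  -- Logarithms of bounded size.
  have hsmall : ∀ A : ℝ, 0 < A → ∃ D : ℝ, 0 ≤ D ∧ ∀ x M R : ℝ, 1 < M → M ^ (1 + δ) ≤ R →
      R ≤ Real.sqrt x → Real.log M ≤ 4 →
        |arithmeticSum h a x M R| ≤ D * (1 / (M * Real.log M ^ A)) := by
    intro A hA
    obtain ⟨D₁, hD₁, hD₁'⟩ := exists_rpow_le_div_log_rpow hδ hA
    set L := 11 * Real.exp (1 / 4 * 4) * (C₀ * (1 / 4 : ℝ) ^ (-C₁)) with hL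
    have hL0 : 0 ≤ L := by have := hb.nonneg; positivity
    refine ⟨B * D₁ + L * 4 ^ A, by positivity, fun x M R h1 h2 h3 h4 => ?_⟩
    have hM0 : 0 < M := by linarith
    have hv : 0 < Real.log M := Real.log_pos h1
    have h5 : |oscSum (coeff h a) (Real.log M)| ≤ L := by
      refine (hb.abs_oscSum_le (by norm_num) le_rfl _).trans ?_
      have := hb.nonneg
      rw [hL]
      gcongr
    have h6 : |oscSum (coeff h a) (Real.log M) / M| ≤ L * 4 ^ A * (1 / (M * Real.log M ^ A)) := by
      rw [abs_div, abs_of_pos hM0]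
      have h7 : Real.log M ^ A ≤ 4 ^ A := Real.rpow_le_rpow hv.le h4 hA.le
      have h8 : 0 < Real.log M ^ A := by positivity
      calc |oscSum (coeff h a) (Real.log M)| / M ≤ L / M := by gcongr
        _ = L * Real.log M ^ A * (1 / (M * Real.log M ^ A)) := by field_simp
        _ ≤ _ := by gcongr
    have h9 := abs_sub_abs_le_abs_sub (arithmeticSum h a x M R)
      (-(oscSum (coeff h a) (Real.log M) / M))
    rw [sub_neg_eq_add, abs_neg] at h9
    have h10 := hS x M R h1 h2 h3
    have h11 := mul_le_mul_of_nonneg_left (hD₁' M h1) hB0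
    rw [add_mul]
    linarith
  -- If α is a natural number, -α is a pole of Γ and `muAverage` is zero. The rapid decay of
  -- `oscSum` then puts the whole sum into E₂.
  by_cases hpole : ∃ n : ℕ, α = n
  · obtain ⟨n, hn⟩ := hpole
    refine ⟨0, fun A hA => ?_⟩
    obtain ⟨D, hD, hD'⟩ := hsmall A hA
    obtain ⟨D₁, hD₁, hD₁'⟩ := exists_rpow_le_div_log_rpow hδ hA
    obtain ⟨D₂, hD₂, hD₂'⟩ := hb.oscSum_decay n
      (fun s hs => by rw [← hn]; exact hV s hs) hT A
    refine ⟨D + (B * D₁ + D₂), fun x M R h1 h2 h3 => ⟨0, arithmeticSum h a x M R, ?_, by simp, ?_⟩⟩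
    · rw [hmu, hn, Real.Gamma_neg_nat_eq_zero]; simp
    have hM0 : 0 < M := by linarith
    have hv : 0 < Real.log M := Real.log_pos h1
    have hw : 0 ≤ 1 / (M * Real.log M ^ A) := by positivity
    rcases le_or_gt (Real.log M) 4 with h4 | h4
    · exact (hD' x M R h1 h2 h3 h4).trans
        (mul_le_mul_of_nonneg_right (le_add_of_nonneg_right (by positivity)) hw)
    · have h5 : |oscSum (coeff h a) (Real.log M) / M| ≤ D₂ * (1 / (M * Real.log M ^ A)) := by
        rw [abs_div, abs_of_pos hM0, div_le_iff₀ hM0]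
        refine (hD₂' _ h4).trans (le_of_eq ?_)
        rw [Real.rpow_neg hv.le]
        field_simp
      have h9 := abs_sub_abs_le_abs_sub (arithmeticSum h a x M R)
        (-(oscSum (coeff h a) (Real.log M) / M))
      rw [sub_neg_eq_add, abs_neg] at h9
      have h10 := hS x M R h1 h2 h3
      have h11 := mul_le_mul_of_nonneg_left (hD₁' M h1) hB0
      have h12 := mul_nonneg hD hw
      rw [add_mul, add_mul]
      linarith
  · push Not at hpole
    have hΓ : Real.Gamma (-α) ≠ 0 :=
      Real.Gamma_ne_zero fun m hm => hpole m (neg_injective hm)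
    obtain ⟨D₂, hD₂, hD₂'⟩ := hb.oscSum_asymptotic hV hT hlim hpole
    set Q := D₂ * |Real.Gamma (-α)| / |V₀| with hQ
    have hQ0 : 0 ≤ Q := by positivity
    refine ⟨1 + Q, fun A hA => ?_⟩
    obtain ⟨D, hD, hD'⟩ := hsmall A hA
    obtain ⟨D₁, hD₁, hD₁'⟩ := exists_rpow_le_div_log_rpow hδ hA
    set U := |V₀| * (4 ^ |-α - 1| / |Real.Gamma (-α)|) with hU
    have hU0 : 0 ≤ U := by positivity
    refine ⟨D + (B * D₁ + U * 4 ^ A), fun x M R h1 h2 h3 => ?_⟩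
    have hM0 : 0 < M := by linarith
    have hv : 0 < Real.log M := Real.log_pos h1
    have hw : 0 ≤ 1 / (M * Real.log M ^ A) := by positivity
    have h12 := mul_nonneg hD hw
    have h13 := mul_nonneg (mul_nonneg hB0 hD₁) hw
    have h14 := mul_nonneg (show 0 ≤ U * 4 ^ A by positivity) hw
    rcases le_or_gt (Real.log M) 4 with h4 | h4
    · have h5 := hD' x M R h1 h2 h3 h4
      -- As log M tends to 0 the main term may blow up, but |log log M|/log M ≥ 1 permits E₁ = -1,
      -- which deletes it. Near log M = 1 that ratio vanishes, so for 1/2 < log M ≤ 4 one takes E₁ =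
      -- 0 and moves the main term, bounded by a constant over M, into E₂.
      rcases le_or_gt (Real.log M) (1 / 2) with hv2 | hv2
      · refine ⟨-1, arithmeticSum h a x M R, by ring, ?_, ?_⟩
        · have h6 := one_le_abs_log_div hv hv2
          rw [abs_neg, abs_one]
          nlinarith
        · rw [add_mul, add_mul]
          linarith
      · refine ⟨0, arithmeticSum h a x M R - muAverage h k a M / M, by ring, ?_, ?_⟩
        · rw [abs_zero]; positivity
        · have h6 : |muAverage h k a M / M| ≤ U * 4 ^ A * (1 / (M * Real.log M ^ A)) := by
            have h7 : Real.log M ^ A ≤ 4 ^ A := Real.rpow_le_rpow hv.le h4 hA.le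
            have h8 : 0 < Real.log M ^ A := by positivity
            have h9 := rpow_le_four_rpow_abs hv2 h4 (-α - 1)
            rw [hmu, abs_div, abs_neg, abs_mul, abs_div, abs_of_pos hM0,
              abs_of_pos (Real.rpow_pos_of_pos hv (-α - 1))]
            calc |V₀| * (Real.log M ^ (-α - 1) / |Real.Gamma (-α)|) / M ≤ U / M := by
                  rw [hU]; gcongr
              _ = U * Real.log M ^ A * (1 / (M * Real.log M ^ A)) := by field_simp
              _ ≤ _ := by gcongr
          have h7 := abs_sub (arithmeticSum h a x M R) (muAverage h k a M / M)
          rw [add_mul, add_mul]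
          linarith
    · have h5 := hD₂' _ h4
      set v := Real.log M with hvdef
      set T := V₀ * (v ^ (-α - 1) / Real.Gamma (-α)) with hTdef
      have hvp : 0 < v ^ (-α - 1) := Real.rpow_pos_of_pos hv _
      have hT0 : T ≠ 0 := mul_ne_zero hV₀ (div_ne_zero hvp.ne' hΓ)
      -- E₁ is the relative error of the asymptotics of `oscSum`. It is O(1/v), which suffices
      -- because |log v| ≥ 1 for v > 4.
      refine ⟨(oscSum (coeff h a) v - T) / T,
        arithmeticSum h a x M R + oscSum (coeff h a) v / M, ?_, ?_, ?_⟩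
      · rw [hmu, ← hTdef]
        field_simp
        ring
      · rw [abs_div]
        have h6 : |T| = |V₀| * (v ^ (-α - 1) / |Real.Gamma (-α)|) := by
          rw [hTdef, abs_mul, abs_div, abs_of_pos hvp]
        have h7 : v ^ (-α - 2) = v ^ (-α - 1) * v⁻¹ := by
          rw [← Real.rpow_neg_one, ← Real.rpow_add hv]; congr 1; ring
        have h8 : |oscSum (coeff h a) v - T| / |T| ≤ Q * v⁻¹ := by
          rw [div_le_iff₀ (abs_pos.mpr hT0)]
          refine h5.trans (le_of_eq ?_)
          have := abs_pos.mpr hV₀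
          have := abs_pos.mpr hΓ
          rw [h6, h7, hQ]
          field_simp
        refine h8.trans ?_
        have h9 : 1 ≤ |Real.log v| := by
          have h10 : Real.log 4 ≤ Real.log v := Real.log_le_log (by norm_num) h4.le
          have h11 : Real.log 4 = 2 * Real.log 2 := by
            rw [show (4 : ℝ) = 2 ^ 2 by norm_num, Real.log_pow]; norm_num
          have := Real.log_two_gt_d9
          exact le_trans (by linarith) (le_abs_self _)
        calc Q * v⁻¹ = Q * (1 / v) := by rw [one_div]
          _ ≤ (1 + Q) * (|Real.log v| / v) := by gcongr; linarith
      · have h10 := hS x M R h1 h2 h3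
        have h11 := mul_le_mul_of_nonneg_left (hD₁' M h1) hB0
        rw [add_mul, add_mul]
        linarith
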